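/- Let $X$ be an arbitrary metric space and let $\Delta^k$ denote the regular $k$-simplex. *Simplices.* $\mathrm{Lip}(\Delta^k,X)$ is the set of Lipschitz maps $\Delta^k\to X$. It carries the topology induced by $\sigma\mapsto\delta\circ\sigma$ from the norm $\|F\|_\infty+\mathrm{Lip}(F)$ on the bounded Lipschitz maps $F:\Delta^k\to \mathrm{Lip}_{x_0}(X)^*$. Here $\mathrm{Lip}(\cdot)$ of a map is its smallest Lipschitz constant, $\mathrm{Lip}_{x_0}(X)$ is the Banach space of real Lipschitz functions on $X$ vanishing at $x_0$, normed by $\mathrm{Lip}(\cdot)$, and $\delta_x(h)=h(x)$; the topology does not depend on $x_0\in X$. Let $\mathscr C^L_k(X)$ be the real vector space of signed Borel measures $\mu$ on $\mathrm{Lip}(\Delta^k,X)$ of finite total variation which have a compact determination set, i.e. a compact set $K$ such that $\mu(A)=0$ for every Borel set $A$ disjoint from $K$. With $\partial=\sum_{i=0}^k(-1)^i (r_i)_\#$, where $r_i$ is the restriction to the $i$-th face, $\mathscr C^L_\bullet(X)$ is a chain complex (the Lipschitz measure complex). *Currents.* Let $\mathrm{Lip}(X)$ be the set of real Lipschitz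 functions on $X$, $\mathrm{Lip}_b(X)$ the subset of bounded ones, and $\mathcal D^k(X)=\mathrm{Lip}_b(X)\times \mathrm{Lip}(X)^k$, with elements written $f\,d\pi=f\,d\pi_1\wedge\dots\wedge d\pi_k$. A $k$-current in $X$ is a multilinear map $T:\mathcal D^k(X)\to\mathbb R$ such that - (locality) $T(f\,d\pi)=0$ if some $\pi_i$ is constant on $\{f\ne0\}$; - (continuity) $T(f\,d\pi^h)\to T(f\,d\pi)$ if $\pi_i^h\to\pi_i$ pointwise for all $i$ and $\sup_{i,h}\mathrm{Lip}(\pi^h_i)<\infty$; - (finite mass) there is a finite tight Borel measure $\nu$ on $X$ with $|T(f\,d\pi)|\le\prod_i\mathrm{Lip}(\pi_i)\int_X|f|\,d\nu$ for all $f\,d\pi$. The support of $T$ is the intersection of the supports of all such $\nu$. The boundary of $T$ is $\partial T(f\,d\pi)=T(1\,df\wedge d\pi)$, and $T$ is normal if $k=0$ or $\partial T$ has finite mass. The normal currents with compact support form a chain complex $\mathbf N^c_\bullet(X)$. *The map.* For $\sigma\in\mathrm{Lip}(\Delta^k,X)$ put $[\sigma](f\,d\pi)=\int_{\Delta^k}(f\circ\sigma)\det\nabla(\pi\circ\sigma)\,d\mathcal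 L^k$, where $\Delta^k$ is regarded as a subset of $\mathbb R^k$ oriented by the order of its vertices. For $\mu\in\mathscr C^L_k(X)$ put $$T^\mu(f\,d\pi)=\int_{\mathrm{Lip}(\Delta^k,X)}[\sigma](f\,d\pi)\,d\mu(\sigma).$$ **Theorem.** For every $k\ge0$ and $\mu\in\mathscr C^L_k(X)$, the integral defining $T^\mu$ exists for all $f\,d\pi\in\mathcal D^k(X)$, and $T^\mu$ is a normal $k$-current in $X$ with compact support. Moreover $\mu\mapsto T^\mu$ is a chain map $\mathscr C^L_\bullet(X)\to\mathbf N^c_\bullet(X)$, i.e. it is linear and $\partial T^\mu=T^{\partial\mu}$. -/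

import Mathlib

open Filter Topology MeasureTheory
open scoped NNReal ENNReal

namespace LipCurrent

noncomputable section

universe u v w

/-! ### Lipschitz maps and their smallest Lipschitz constant -/

section Lip

variable {X : Type u} {Y : Type v} [PseudoMetricSpace X] [PseudoMetricSpace Y]

/-- `f` is Lipschitz. -/
def IsLip (f : X → Y) : Prop := ∃ K : ℝ≥0, LipschitzWith K f

/-- The smallest Lipschitz constant of a Lipschitz map. -/
def lipConst (f : X → Y) : ℝ≥0 := sInf {K : ℝ≥0 | LipschitzWith K f}

theorem lipConst_le {f : X → Y} {K : ℝ≥0} (h : LipschitzWith K f) : lipConst f ≤ K :=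
  csInf_le (OrderBot.bddBelow _) h

theorem IsLip.lipschitzWith {f : X → Y} (h : IsLip f) : LipschitzWith (lipConst f) f := by
  refine LipschitzWith.of_dist_le_mul fun x y => ?_
  by_contra! hlt
  have hd : 0 < dist x y := by
    rcases (dist_nonneg (x := x) (y := y)).eq_or_lt with h0 | h0
    · obtain ⟨K, hK⟩ := h
      have := hK.dist_le_mul x y
      rw [← h0] at this hlt
      simp only [mul_zero] at this hlt
      linarith
    · exact h0
  have h1 : (lipConst f : ℝ) < dist (f x) (f y) / dist x y := by rwa [lt_div_iff₀ hd]
  have h2 : lipConst f < (⟨dist (f x) (f y) / dist x y, by positivity⟩ : ℝ≥0) := by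
    exact_mod_cast h1
  obtain ⟨K, hK, hK2⟩ := exists_lt_of_csInf_lt (s := {K : ℝ≥0 | LipschitzWith K f}) h h2
  have h3 : (K : ℝ) < dist (f x) (f y) / dist x y := by exact_mod_cast hK2
  rw [lt_div_iff₀ hd] at h3
  exact absurd (hK.dist_le_mul x y) (not_le.2 h3)

end Lip

section LipNormed

variable {X : Type u} [PseudoMetricSpace X] {B : Type v} [NormedAddCommGroup B]

theorem lipschitzWith_const_smul [NormedSpace ℝ B] {f : X → B} {K : ℝ≥0} (h : LipschitzWith K f) (c : ℝ) :
    LipschitzWith (‖c‖₊ * K) (c • f) := by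
  refine LipschitzWith.of_dist_le_mul fun x y => ?_
  have := h.dist_le_mul x y
  rw [Pi.smul_apply, Pi.smul_apply, dist_smul₀, NNReal.coe_mul, coe_nnnorm, mul_assoc]
  exact mul_le_mul_of_nonneg_left this (norm_nonneg c)

theorem isLip_zero : IsLip (0 : X → B) := ⟨0, LipschitzWith.const 0⟩

theorem IsLip.add {f g : X → B} (hf : IsLip f) (hg : IsLip g) : IsLip (f + g) :=
  ⟨_, hf.lipschitzWith.add hg.lipschitzWith⟩

theorem IsLip.smul [NormedSpace ℝ B] {f : X → B} (hf : IsLip f) (c : ℝ) : IsLip (c • f) :=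
  ⟨_, lipschitzWith_const_smul hf.lipschitzWith c⟩

theorem lipConst_zero : lipConst (0 : X → B) = 0 :=
  le_antisymm (lipConst_le (LipschitzWith.const 0)) zero_le

theorem lipConst_add_le {f g : X → B} (hf : IsLip f) (hg : IsLip g) :
    lipConst (f + g) ≤ lipConst f + lipConst g :=
  lipConst_le (hf.lipschitzWith.add hg.lipschitzWith)

theorem lipConst_smul_le [NormedSpace ℝ B] {f : X → B} (hf : IsLip f) (c : ℝ) :
    lipConst (c • f) ≤ ‖c‖₊ * lipConst f :=
  lipConst_le (lipschitzWith_const_smul hf.lipschitzWith c)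

theorem lipConst_neg (f : X → B) : lipConst (-f) = lipConst f := by
  have : ∀ K : ℝ≥0, LipschitzWith K (-f) ↔ LipschitzWith K f := fun K => by
    simp only [lipschitzWith_iff_dist_le_mul, Pi.neg_apply, dist_neg_neg]
  simp only [lipConst, this]

end LipNormed

/-! ### The double dual of a pointed metric space -/

section DoubleDual

variable {X : Type u} [MetricSpace X]

/-- Real Lipschitz functions vanishing at the base point `x₀`, as a vector space. -/
def lipZeroSubmodule (x₀ : X) : Submodule ℝ (X → ℝ) where
  carrier := {h | IsLip h ∧ h x₀ = 0}
  add_mem' ha hb := ⟨ha.1.add hb.1, by simp [ha.2, hb.2]⟩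
  zero_mem' := ⟨isLip_zero, rfl⟩
  smul_mem' c _ ha := ⟨ha.1.smul c, by simp [ha.2]⟩

/-- The Banach space `Lip_{x₀}(X)` of real Lipschitz functions vanishing at `x₀`; its norm (below)
is the smallest Lipschitz constant. -/
def LipZero (x₀ : X) : Type u := lipZeroSubmodule x₀

instance (x₀ : X) : AddCommGroup (LipZero x₀) := inferInstanceAs (AddCommGroup (lipZeroSubmodule x₀))

instance (x₀ : X) : Module ℝ (LipZero x₀) := inferInstanceAs (Module ℝ (lipZeroSubmodule x₀))

instance (x₀ : X) : NormedAddCommGroup (LipZero x₀) :=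
  AddGroupNorm.toNormedAddCommGroup
    { toFun := fun h : LipZero x₀ => (lipConst h.1 : ℝ)
      map_zero' := by
        have : lipConst (0 : X → ℝ) = 0 := lipConst_zero
        exact_mod_cast this
      add_le' := fun f g => by
        have := lipConst_add_le f.2.1 g.2.1
        exact_mod_cast this
      neg' := fun f => by
        have := lipConst_neg f.1
        exact_mod_cast this
      eq_zero_of_map_eq_zero' := fun f hf => by
        apply Subtype.ext
        funext x
        have h1 := f.2.1.lipschitzWith.dist_le_mul x x₀
        have h2 : (lipConst f.1 : ℝ) = 0 := hf
        rw [h2, zero_mul, f.2.2, dist_zero_right] at h1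
        exact norm_le_zero_iff.1 h1 }

theorem LipZero.norm_def {x₀ : X} (h : LipZero x₀) : ‖h‖ = (lipConst h.1 : ℝ) := rfl

instance (x₀ : X) : NormedSpace ℝ (LipZero x₀) where
  norm_smul_le c f := by
    have := lipConst_smul_le f.2.1 c
    rw [LipZero.norm_def, LipZero.norm_def, ← coe_nnnorm]
    exact_mod_cast this

/-- The continuous dual of `Lip_{x₀}(X)`. -/
abbrev DoubleDual (x₀ : X) : Type u := StrongDual ℝ (LipZero x₀)

/-- The evaluation embedding `X → (Lip_{x₀}(X))*`, `δ_x(h) = h(x)`. -/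
def delta (x₀ x : X) : DoubleDual x₀ :=
  LinearMap.mkContinuous
    { toFun := fun h : LipZero x₀ => h.1 x
      map_add' := fun _ _ => rfl
      map_smul' := fun _ _ => rfl } (dist x x₀) fun h => by
    have h1 := h.2.1.lipschitzWith.dist_le_mul x x₀
    rw [h.2.2, dist_zero_right] at h1
    rw [LipZero.norm_def, mul_comm]
    exact h1

theorem norm_delta_sub_le (x₀ x y : X) : ‖delta x₀ x - delta x₀ y‖ ≤ dist x y := by
  refine ContinuousLinearMap.opNorm_le_bound _ dist_nonneg fun h => ?_
  have h1 := h.2.1.lipschitzWith.dist_le_mul x y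
  rw [Real.dist_eq] at h1
  rw [LipZero.norm_def, mul_comm]
  exact h1

theorem delta_lipschitz (x₀ : X) : LipschitzWith 1 (delta x₀) :=
  LipschitzWith.of_dist_le_mul fun x y => by
    rw [dist_eq_norm, NNReal.coe_one, one_mul]
    exact norm_delta_sub_le x₀ x y

end DoubleDual

/-! ### Bounded Lipschitz maps into a normed space -/

section BT

variable (Z : Type u) [MetricSpace Z] (B : Type v) [NormedAddCommGroup B] [NormedSpace ℝ B]

/-- Bounded Lipschitz maps from `Z` to `B`, as a vector space. -/
def btSubmodule : Submodule ℝ (Z → B) where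
  carrier := {f | IsLip f ∧ ∃ C : ℝ, ∀ z, ‖f z‖ ≤ C}
  add_mem' := by
    rintro f g ⟨hf, C, hC⟩ ⟨hg, D, hD⟩
    exact ⟨hf.add hg, C + D, fun z => (norm_add_le _ _).trans (add_le_add (hC z) (hD z))⟩
  zero_mem' := ⟨isLip_zero, 0, by simp⟩
  smul_mem' := by
    rintro c f ⟨hf, C, hC⟩
    refine ⟨hf.smul c, ‖c‖ * C, fun z => ?_⟩
    rw [Pi.smul_apply, norm_smul]
    exact mul_le_mul_of_nonneg_left (hC z) (norm_nonneg c)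

/-- The space of bounded Lipschitz maps from `Z` to `B`, with norm `‖f‖_∞ + Lip(f)`. -/
def BT : Type (max u v) := btSubmodule Z B

instance : AddCommGroup (BT Z B) := inferInstanceAs (AddCommGroup (btSubmodule Z B))

instance : Module ℝ (BT Z B) := inferInstanceAs (Module ℝ (btSubmodule Z B))

variable {Z B}

theorem BT.bddAbove (f : BT Z B) : BddAbove (Set.range fun z => ‖f.1 z‖) := by
  obtain ⟨C, hC⟩ := f.2.2
  exact ⟨C, by rintro _ ⟨z, rfl⟩; exact hC z⟩

instance : NormedAddCommGroup (BT Z B) :=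
  AddGroupNorm.toNormedAddCommGroup
    { toFun := fun f : BT Z B => (⨆ z, ‖f.1 z‖) + (lipConst f.1 : ℝ)
      map_zero' := by
        have h : lipConst (0 : Z → B) = 0 := lipConst_zero
        have h2 : (⨆ z : Z, ‖(0 : Z → B) z‖) = 0 := by simp
        change (⨆ z : Z, ‖(0 : Z → B) z‖) + (lipConst (0 : Z → B) : ℝ) = 0
        rw [h, h2]; simp
      add_le' := fun f g => by
        have h1 : (lipConst (f.1 + g.1) : ℝ) ≤ lipConst f.1 + lipConst g.1 := by
          exact_mod_cast lipConst_add_le f.2.1 g.2.1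
        have h2 : (⨆ z, ‖(f.1 + g.1) z‖) ≤ (⨆ z, ‖f.1 z‖) + ⨆ z, ‖g.1 z‖ := by
          refine Real.iSup_le (fun z => (norm_add_le _ _).trans
            (add_le_add (le_ciSup f.bddAbove z) (le_ciSup g.bddAbove z))) ?_
          exact add_nonneg (Real.iSup_nonneg fun _ => norm_nonneg _)
            (Real.iSup_nonneg fun _ => norm_nonneg _)
        change (⨆ z, ‖(f.1 + g.1) z‖) + (lipConst (f.1 + g.1) : ℝ) ≤ _
        linarith
      neg' := fun f => by
        change (⨆ z, ‖(-f.1) z‖) + (lipConst (-f.1) : ℝ) = _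
        rw [lipConst_neg]
        simp
      eq_zero_of_map_eq_zero' := fun f hf => by
        apply Subtype.ext
        funext z
        have h1 := le_ciSup f.bddAbove z
        have h2 : (⨆ z, ‖f.1 z‖) + (lipConst f.1 : ℝ) = 0 := hf
        have h3 : (0 : ℝ) ≤ lipConst f.1 := NNReal.coe_nonneg _
        exact norm_le_zero_iff.1 (by linarith) }

theorem BT.norm_def (f : BT Z B) : ‖f‖ = (⨆ z, ‖f.1 z‖) + (lipConst f.1 : ℝ) := rfl

end BT

/-! ### The space of bounded Lipschitz maps between metric spaces -/

/-- `Lip_b(Z, X)`: Lipschitz maps from `Z` to `X` with bounded image. -/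
structure LipB (Z : Type u) (X : Type v) [MetricSpace Z] [MetricSpace X] where
  /-- the underlying map -/
  toFun : Z → X
  isLip : IsLip toFun
  bounded : Bornology.IsBounded (Set.range toFun)

section LipB

variable {Z : Type u} {X : Type v} {W : Type w} [MetricSpace Z] [MetricSpace X] [MetricSpace W]

instance : CoeFun (LipB Z X) fun _ => Z → X := ⟨LipB.toFun⟩

@[ext] theorem LipB.ext {f g : LipB Z X} (h : ∀ z, f z = g z) : f = g := by
  cases f; cases g
  congr
  exact funext h

/-- Composition with the embedding `δ : X → (Lip_{x₀}(X))*`. -/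
def LipB.deltaPush (x₀ : X) (σ : LipB Z X) : BT Z (DoubleDual x₀) :=
  ⟨fun z => delta x₀ (σ z), ⟨_, (delta_lipschitz x₀).comp σ.isLip.lipschitzWith⟩, by
    obtain ⟨C, hC⟩ := (Metric.isBounded_iff_subset_closedBall x₀).1 σ.bounded
    refine ⟨C, fun z => ?_⟩
    have h0 : delta x₀ x₀ = 0 := by
      ext h
      exact h.2.2
    have h1 := norm_delta_sub_le x₀ (σ z) x₀
    rw [h0, sub_zero] at h1
    exact h1.trans (hC ⟨z, rfl⟩)⟩

/-- The topology on `Lip_b(Z, X)`: the coarsest one for which the maps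
`Lip_b(Z, X) → BT(Z, (Lip_{x₀}(X))*)` are continuous. All base points `x₀` induce the
same topology, so that the infimum only avoids the choice of one of them. -/
instance : TopologicalSpace (LipB Z X) :=
  ⨅ x₀ : X, TopologicalSpace.induced (LipB.deltaPush x₀) inferInstance

instance : MeasurableSpace (LipB Z X) := borel _

instance : BorelSpace (LipB Z X) := ⟨rfl⟩

/-- Precomposition with a Lipschitz map. -/
def LipB.precomp (ψ : W → Z) (hψ : IsLip ψ) (σ : LipB Z X) : LipB W X where
  toFun := fun z => σ (ψ z)
  isLip := ⟨_, σ.isLip.lipschitzWith.comp hψ.lipschitzWith⟩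
  bounded := σ.bounded.subset (by rintro _ ⟨z, rfl⟩; exact ⟨ψ z, rfl⟩)

theorem LipB.continuous_precomp (ψ : W → Z) (hψ : IsLip ψ) :
    Continuous (LipB.precomp ψ hψ : LipB Z X → LipB W X) := by
  refine continuous_iInf_rng.2 fun x₀ => continuous_induced_rng.2 ?_
  have h1 : Continuous (LipB.deltaPush x₀ : LipB Z X → BT Z (DoubleDual x₀)) :=
    continuous_iInf_dom (i := x₀) continuous_induced_dom
  have h2 : ∀ f g : BT Z (DoubleDual x₀), ∀ f' g' : BT W (DoubleDual x₀),
      (∀ z, f'.1 z = f.1 (ψ z)) → (∀ z, g'.1 z = g.1 (ψ z)) →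
      dist f' g' ≤ (1 + lipConst ψ) * dist f g := by
    intro f g f' g' hf hg
    rw [dist_eq_norm, dist_eq_norm, BT.norm_def, BT.norm_def]
    have hfun : (f' - g').1 = fun z => (f - g).1 (ψ z) := by
      funext z
      change f'.1 z - g'.1 z = f.1 (ψ z) - g.1 (ψ z)
      rw [hf, hg]
    have ha : (⨆ z, ‖(f' - g').1 z‖) ≤ ⨆ z, ‖(f - g).1 z‖ := by
      rw [hfun]
      exact Real.iSup_le (fun z => le_ciSup (f - g).bddAbove (ψ z))
        (Real.iSup_nonneg fun _ => norm_nonneg _)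
    have hb : (lipConst (f' - g').1 : ℝ) ≤ lipConst (f - g).1 * lipConst ψ := by
      have : lipConst (f' - g').1 ≤ lipConst (f - g).1 * lipConst ψ := by
        rw [hfun]
        exact lipConst_le ((f - g).2.1.lipschitzWith.comp hψ.lipschitzWith)
      exact_mod_cast this
    have hc : 0 ≤ ⨆ z, ‖(f - g).1 z‖ := Real.iSup_nonneg fun _ => norm_nonneg _
    have hd : (0 : ℝ) ≤ lipConst (f - g).1 := NNReal.coe_nonneg _
    have he : (0 : ℝ) ≤ lipConst ψ := NNReal.coe_nonneg _
    nlinarith [mul_nonneg hc he]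
  rw [continuous_iff_continuousAt]
  intro σ
  rw [ContinuousAt, tendsto_iff_dist_tendsto_zero]
  have h3 := ((tendsto_iff_dist_tendsto_zero.1 (h1.tendsto σ)).const_mul
    (1 + (lipConst ψ : ℝ)))
  rw [mul_zero] at h3
  exact squeeze_zero (fun _ => dist_nonneg)
    (fun τ => h2 (τ.deltaPush x₀) (σ.deltaPush x₀) _ _ (fun _ => rfl) fun _ => rfl) h3

end LipB

section BasePoint

variable {Z : Type u} {X : Type v} [MetricSpace Z] [MetricSpace X]

/-- The canonical map `(Lip_{x₁}(X))* → (Lip_{x₀}(X))*`, `μ ↦ (h ↦ μ(h - h(x₁)))`, has norm at most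
one; here in terms of the norms that define the topology of `Lip_b(Z, X)`. -/
theorem LipB.dist_deltaPush_le (x₀ x₁ : X) (f g : LipB Z X) :
    dist (f.deltaPush x₀) (g.deltaPush x₀) ≤ dist (f.deltaPush x₁) (g.deltaPush x₁) := by
  let S : LipZero x₀ → LipZero x₁ := fun h => ⟨fun x => h.1 x - h.1 x₁,
    ⟨lipConst h.1, LipschitzWith.of_dist_le_mul fun x y => by
      have := h.2.1.lipschitzWith.dist_le_mul x y
      rwa [Real.dist_eq, sub_sub_sub_cancel_right, ← Real.dist_eq]⟩, sub_self _⟩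
  have hS : ∀ h, ‖S h‖ ≤ ‖h‖ := fun h => by
    have : lipConst (S h).1 ≤ lipConst h.1 := lipConst_le <|
      LipschitzWith.of_dist_le_mul fun x y => by
        have := h.2.1.lipschitzWith.dist_le_mul x y
        change dist (h.1 x - h.1 x₁) (h.1 y - h.1 x₁) ≤ _
        rwa [Real.dist_eq, sub_sub_sub_cancel_right, ← Real.dist_eq]
    rw [LipZero.norm_def, LipZero.norm_def]
    exact_mod_cast this
  set F := f.deltaPush x₀ - g.deltaPush x₀ with hF
  set G := f.deltaPush x₁ - g.deltaPush x₁ with hG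
  have key : ∀ z h, F.1 z h = G.1 z (S h) := fun z h => by
    change h.1 (f z) - h.1 (g z) = (h.1 (f z) - h.1 x₁) - (h.1 (g z) - h.1 x₁)
    ring
  have hsup : (⨆ z, ‖F.1 z‖) ≤ ⨆ z, ‖G.1 z‖ := by
    refine Real.iSup_le (fun z => ?_) (Real.iSup_nonneg fun _ => norm_nonneg _)
    refine le_trans ?_ (le_ciSup G.bddAbove z)
    refine ContinuousLinearMap.opNorm_le_bound _ (norm_nonneg _) fun h => ?_
    rw [key]
    exact ((G.1 z).le_opNorm _).trans (mul_le_mul_of_nonneg_left (hS h) (norm_nonneg _))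
  have hlip : lipConst F.1 ≤ lipConst G.1 := by
    refine lipConst_le (LipschitzWith.of_dist_le_mul fun z w => ?_)
    refine le_trans ?_ (G.2.1.lipschitzWith.dist_le_mul z w)
    rw [dist_eq_norm, dist_eq_norm]
    refine ContinuousLinearMap.opNorm_le_bound _ (norm_nonneg _) fun h => ?_
    have : (F.1 z - F.1 w) h = (G.1 z - G.1 w) (S h) := by
      change F.1 z h - F.1 w h = G.1 z (S h) - G.1 w (S h)
      rw [key, key]
    rw [this]
    exact ((G.1 z - G.1 w).le_opNorm _).trans
      (mul_le_mul_of_nonneg_left (hS h) (norm_nonneg _))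
  have hlip' : (lipConst F.1 : ℝ) ≤ lipConst G.1 := by exact_mod_cast hlip
  rw [dist_eq_norm, dist_eq_norm, BT.norm_def, BT.norm_def]
  exact add_le_add hsup hlip'

/-- The topology of `Lip_b(Z, X)` is induced by any single base point. -/
theorem LipB.isInducing_deltaPush (x₀ : X) :
    IsInducing (LipB.deltaPush x₀ : LipB Z X → BT Z (DoubleDual x₀)) := by
  refine ⟨le_antisymm (iInf_le _ x₀) (le_iInf fun x₁ => ?_)⟩
  rw [← continuous_iff_le_induced]
  let _ : TopologicalSpace (LipB Z X) := TopologicalSpace.induced (LipB.deltaPush x₀ : LipB Z X → BT Z (DoubleDual x₀)) inferInstance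
  have h1 : Continuous (LipB.deltaPush x₀ : LipB Z X → BT Z (DoubleDual x₀)) :=
    continuous_induced_dom
  rw [continuous_iff_continuousAt]
  intro σ
  rw [ContinuousAt, tendsto_iff_dist_tendsto_zero]
  exact squeeze_zero (fun _ => dist_nonneg) (fun τ => LipB.dist_deltaPush_le x₁ x₀ τ σ)
    (tendsto_iff_dist_tendsto_zero.1 (h1.tendsto σ))

end BasePoint

/-! ### Simplices and the Lipschitz measure chain complex -/

/-- The regular `k`-simplex: the convex hull of the standard basis of Euclidean `ℝ^{k+1}`, with the
Euclidean metric. -/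
def Simplex (k : ℕ) : Type :=
  {x : EuclideanSpace ℝ (Fin (k + 1)) // (∀ i, 0 ≤ x i) ∧ ∑ i, x i = 1}

instance (k : ℕ) : MetricSpace (Simplex k) :=
  inferInstanceAs (MetricSpace
    {x : EuclideanSpace ℝ (Fin (k + 1)) // (∀ i, 0 ≤ x i) ∧ ∑ i, x i = 1})

/-- The inclusion of the `i`-th face, opposite to the `i`-th vertex. -/
def face {k : ℕ} (i : Fin (k + 2)) (x : Simplex k) : Simplex (k + 1) :=
  ⟨WithLp.toLp 2 (i.insertNth (0 : ℝ) fun j => x.1 j), by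
    refine ⟨fun j => ?_, ?_⟩
    · refine Fin.succAboveCases i ?_ (fun l => ?_) j
      · simp
      · simpa using x.2.1 l
    · rw [Fin.sum_univ_succAbove _ i]
      simpa using x.2.2⟩

theorem face_apply_same {k : ℕ} (i : Fin (k + 2)) (x : Simplex k) : (face i x).1 i = 0 := by
  simp [face]

theorem face_apply_succAbove {k : ℕ} (i : Fin (k + 2)) (x : Simplex k) (l : Fin (k + 1)) :
    (face i x).1 (i.succAbove l) = x.1 l := by
  simp [face]

theorem isLip_face {k : ℕ} (i : Fin (k + 2)) : IsLip (face i : Simplex k → Simplex (k + 1)) := by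
  refine ⟨1, LipschitzWith.of_dist_le_mul fun x y => le_of_eq ?_⟩
  rw [NNReal.coe_one, one_mul]
  change dist (face i x).1 (face i y).1 = dist x.1 y.1
  rw [EuclideanSpace.dist_eq, EuclideanSpace.dist_eq, Fin.sum_univ_succAbove _ i]
  simp [face_apply_same, face_apply_succAbove]

theorem face_comp_face {k : ℕ} {i j : Fin (k + 2)} (hij : i ≤ j) (x : Simplex k) :
    face j.succ (face i x) = face i.castSucc (face j x) := by
  have h1 : ∀ l : Fin (k + 1),
      j.succ.succAbove (i.succAbove l) = i.castSucc.succAbove (j.succAbove l) := by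
    intro l
    simp only [Fin.succAbove, Fin.lt_def, Fin.ext_iff, Fin.le_def] at *
    split_ifs <;> simp at * <;> omega
  have h2 : j.succ = i.castSucc.succAbove j := by
    rw [Fin.succAbove_of_le_castSucc]
    exact hij
  have h3 : i.castSucc = j.succ.succAbove i := by
    rw [Fin.succAbove_of_castSucc_lt]
    exact Fin.lt_def.2 (Nat.lt_succ_of_le hij)
  apply Subtype.ext
  ext m
  refine Fin.succAboveCases j.succ ?_ (fun m' => ?_) m
  · rw [face_apply_same]
    conv_rhs => rw [h2]
    rw [face_apply_succAbove, face_apply_same]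
  · rw [face_apply_succAbove]
    refine Fin.succAboveCases i ?_ (fun l => ?_) m'
    · rw [face_apply_same, ← h3, face_apply_same]
    · rw [face_apply_succAbove, h1, face_apply_succAbove, face_apply_succAbove]

section Chains

variable {S : Type u} [MeasurableSpace S]

/-- `D` is a determination set of the signed measure `μ`. -/
def IsDetermination (μ : SignedMeasure S) (D : Set S) : Prop :=
  ∀ A, MeasurableSet A → A ⊆ Dᶜ → μ A = 0

/-- The real vector space of (finite) signed Borel measures on `S` which have a compact
determination set. -/
def compactSignedMeasures (S : Type u) [TopologicalSpace S] [MeasurableSpace S] [BorelSpace S] :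
    Submodule ℝ (SignedMeasure S) where
  carrier := {μ | ∃ K, IsCompact K ∧ IsDetermination μ K}
  add_mem' := by
    rintro μ ν ⟨K, hK, hμ⟩ ⟨L, hL, hν⟩
    refine ⟨K ∪ L, hK.union hL, fun A hA hAK => ?_⟩
    rw [Set.compl_union] at hAK
    rw [_root_.add_apply, hμ A hA (hAK.trans Set.inter_subset_left),
      hν A hA (hAK.trans Set.inter_subset_right), add_zero]
  zero_mem' := ⟨∅, isCompact_empty, fun _ _ _ => rfl⟩
  smul_mem' := by
    rintro c μ ⟨K, hK, hμ⟩
    refine ⟨K, hK, fun A hA hAK => ?_⟩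
    rw [_root_.smul_apply, hμ A hA hAK, smul_zero]

/-- Push-forward of compactly determined signed measures under a continuous map. -/
def pushforward {S : Type u} {S' : Type v} [TopologicalSpace S] [MeasurableSpace S] [BorelSpace S]
    [TopologicalSpace S'] [MeasurableSpace S'] [BorelSpace S'] (f : S → S') (hf : Continuous f) :
    compactSignedMeasures S →ₗ[ℝ] compactSignedMeasures S' :=
  (VectorMeasure.mapₗ f).restrict (by
    rintro μ ⟨K, hK, hμ⟩
    refine ⟨f '' K, hK.image hf, fun A hA hAK => ?_⟩
    rw [VectorMeasure.mapₗ_apply, VectorMeasure.map_apply _ hf.measurable hA]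
    refine hμ _ (hf.measurable hA) fun x hx hxK => hAK hx ⟨x, hxK, rfl⟩)

end Chains

section LipChain

variable (X : Type u) [MetricSpace X]

/-- The `k`-th Lipschitz measure chain group. As `Simplex k` is compact, `LipB (Simplex k) X` is the
space of all Lipschitz maps from the simplex to `X`. -/
abbrev LipChain (k : ℕ) : Type u := compactSignedMeasures (LipB (Simplex k) X)

variable {X}

/-- Restriction of Lipschitz simplices to the `i`-th face. -/
def faceRestrict {k : ℕ} (i : Fin (k + 2)) : LipB (Simplex (k + 1)) X → LipB (Simplex k) X :=
  LipB.precomp (face i) (isLip_face i)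

theorem continuous_faceRestrict {k : ℕ} (i : Fin (k + 2)) :
    Continuous (faceRestrict i : LipB (Simplex (k + 1)) X → LipB (Simplex k) X) :=
  LipB.continuous_precomp _ _

/-- `(r_i)_#`, the push-forward of chains under restriction to the `i`-th face. -/
def facePush {k : ℕ} (i : Fin (k + 2)) : LipChain X (k + 1) →ₗ[ℝ] LipChain X k :=
  pushforward (faceRestrict i) (continuous_faceRestrict i)

theorem facePush_facePush {k : ℕ} {i j : Fin (k + 2)} (hij : i ≤ j) (μ : LipChain X (k + 2)) :
    facePush i (facePush j.succ μ) = facePush j (facePush i.castSucc μ) := by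
  apply Subtype.ext
  ext A hA
  have hm : ∀ (n : ℕ) (l : Fin (n + 2)),
      Measurable (faceRestrict l : LipB (Simplex (n + 1)) X → LipB (Simplex n) X) :=
    fun n l => (continuous_faceRestrict l).measurable
  change (μ.1.map (faceRestrict j.succ)).map (faceRestrict i) A =
    (μ.1.map (faceRestrict i.castSucc)).map (faceRestrict j) A
  rw [VectorMeasure.map_apply _ (hm _ _) hA, VectorMeasure.map_apply _ (hm _ _) (hm _ _ hA),
    VectorMeasure.map_apply _ (hm _ _) hA, VectorMeasure.map_apply _ (hm _ _) (hm _ _ hA),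
    ← Set.preimage_comp, ← Set.preimage_comp]
  congr 2
  funext σ
  ext z
  change σ (face j.succ (face i z)) = σ (face i.castSucc (face j z))
  rw [face_comp_face hij]

/-- The boundary `∂ = ∑ (-1)^i (r_i)_#` of Lipschitz measure chains. -/
def chainBoundary (k : ℕ) : LipChain X (k + 1) →ₗ[ℝ] LipChain X k :=
  ∑ i : Fin (k + 2), (-1 : ℝ) ^ (i : ℕ) • facePush i

theorem alternating_sum_eq_zero {k : ℕ} {M : Type u} [AddCommGroup M] [Module ℝ M]
    (F : Fin (k + 2) → Fin (k + 3) → M)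
    (hF : ∀ {i j : Fin (k + 2)}, i ≤ j → F i j.succ = F j i.castSucc) :
    ∑ p : Fin (k + 2) × Fin (k + 3), ((-1 : ℝ) ^ (p.2 : ℕ) * (-1) ^ (p.1 : ℕ)) • F p.1 p.2 = 0 := by
  let P := Fin (k + 2) × Fin (k + 3)
  let S : Finset P := {ij : P | (ij.2 : ℕ) ≤ (ij.1 : ℕ)}
  rw [← Finset.sum_add_sum_compl S]
  refine eq_neg_iff_add_eq_zero.1 ?_
  rw [← Finset.sum_neg_distrib]
  let φ : ∀ ij : P, ij ∈ S → P := fun ij hij =>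
    (Fin.castLT ij.2 (lt_of_le_of_lt (Finset.mem_filter.mp hij).right (Fin.is_lt ij.1)), ij.1.succ)
  apply Finset.sum_bij φ
  · intro ij hij
    simp_rw [S, φ, Finset.compl_filter, Finset.mem_filter_univ, Fin.val_succ,
      Fin.val_castLT] at hij ⊢
    lia
  · rintro ⟨i, j⟩ hij ⟨i', j'⟩ hij' h
    rw [Prod.mk_inj]
    exact ⟨by simpa [φ] using! congr_arg Prod.snd h,
      by simpa [φ, Fin.castSucc_castLT] using! congr_arg Fin.castSucc (congr_arg Prod.fst h)⟩
  · rintro ⟨i', j'⟩ hij'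
    simp_rw [S, Finset.compl_filter, Finset.mem_filter_univ, not_le] at hij'
    refine ⟨(j'.pred <| ?_, Fin.castSucc i'), ?_, ?_⟩
    · rintro rfl
      simp only [Fin.val_zero, not_lt_zero] at hij'
    · simpa [S] using! Nat.le_sub_one_of_lt hij'
    · simp only [φ, Fin.castLT_castSucc, Fin.succ_pred]
  · rintro ⟨i, j⟩ hij
    have hij' : (j : ℕ) ≤ i := (Finset.mem_filter.mp hij).right
    have h := hF (i := j.castLT (lt_of_le_of_lt hij' i.is_lt)) (j := i) hij'
    simp only [φ, ← neg_smul]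
    rw [h, Fin.castSucc_castLT]
    congr 1
    simp only [Fin.val_succ, Fin.val_castLT, pow_succ]
    ring

theorem chainBoundary_chainBoundary (k : ℕ) (μ : LipChain X (k + 2)) :
    chainBoundary k (chainBoundary (k + 1) μ) = 0 := by
  simp only [chainBoundary, LinearMap.sum_apply, LinearMap.smul_apply, map_sum, map_smul,
    Finset.smul_sum, smul_smul]
  rw [Finset.sum_comm, ← Finset.sum_product', Finset.univ_product_univ]
  exact alternating_sum_eq_zero (fun i j => facePush i (facePush j μ))
    fun hij => facePush_facePush hij μ

end LipChain

/-! ### Metric currents -/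

section Current

variable (X : Type u) [MetricSpace X]

/-- `Lip(X)`, the real Lipschitz functions on `X`. -/
def lipFun : Submodule ℝ (X → ℝ) where
  carrier := {f | IsLip f}
  add_mem' ha hb := ha.add hb
  zero_mem' := isLip_zero
  smul_mem' c _ ha := ha.smul c

/-- `Lip_b(X)`, the bounded real Lipschitz functions on `X`. -/
def blipFun : Submodule ℝ (X → ℝ) where
  carrier := {f | IsLip f ∧ ∃ C : ℝ, ∀ x, |f x| ≤ C}
  add_mem' := by
    rintro f g ⟨hf, C, hC⟩ ⟨hg, D, hD⟩
    exact ⟨hf.add hg, C + D, fun z => (abs_add_le _ _).trans (add_le_add (hC z) (hD z))⟩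
  zero_mem' := ⟨isLip_zero, 0, by simp⟩
  smul_mem' := by
    rintro c f ⟨hf, C, hC⟩
    refine ⟨hf.smul c, |c| * C, fun z => ?_⟩
    rw [Pi.smul_apply, smul_eq_mul, abs_mul]
    exact mul_le_mul_of_nonneg_left (hC z) (abs_nonneg c)

/-- Real functionals on `𝒟^k(X) = Lip_b(X) × Lip(X)^k`. -/
abbrev Functional (k : ℕ) : Type u := blipFun X → (Fin k → lipFun X) → ℝ

variable {X}

/-- The inclusion `Lip_b(X) → Lip(X)`. -/
def blipToLip : blipFun X →ₗ[ℝ] lipFun X :=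
  Submodule.inclusion fun _ h => h.1

/-- The constant function `1`. -/
def blipOne : blipFun X := ⟨fun _ => 1, ⟨0, LipschitzWith.const 1⟩, 1, fun _ => by simp⟩

/-- The boundary `∂T(f dπ) = T(1 df ∧ dπ)`. -/
def boundary {k : ℕ} (T : Functional X (k + 1)) : Functional X k :=
  fun f π => T blipOne (Fin.cons (blipToLip f) π)

/-- `T` is linear in each of its `k + 1` arguments. -/
def IsMultilin {k : ℕ} (T : Functional X k) : Prop :=
  ∃ M : blipFun X →ₗ[ℝ] MultilinearMap ℝ (fun _ : Fin k => lipFun X) ℝ,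
    ∀ f π, T f π = M f π

/-- Locality: `T(f dπ) = 0` if some `π_i` is constant on `{f ≠ 0}`. -/
def IsLocal {k : ℕ} (T : Functional X k) : Prop :=
  ∀ (f : blipFun X) (π : Fin k → lipFun X),
    (∃ i, ∃ c : ℝ, ∀ x, f.1 x ≠ 0 → (π i).1 x = c) → T f π = 0

/-- Continuity under pointwise convergence of `π` with bounded Lipschitz constants. -/
def IsCont {k : ℕ} (T : Functional X k) : Prop :=
  ∀ (f : blipFun X) (p : ℕ → Fin k → lipFun X) (π : Fin k → lipFun X),
    (∃ L : ℝ≥0, ∀ h i, LipschitzWith L (p h i).1) →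
    (∀ i x, Tendsto (fun h => (p h i).1 x) atTop (𝓝 ((π i).1 x))) →
    Tendsto (fun h => T f (p h)) atTop (𝓝 (T f π))

variable [MeasurableSpace X]

/-- `ν` is a finite tight measure as in the finite mass axiom for `T`. -/
def IsMassMeasure {k : ℕ} (T : Functional X k) (ν : Measure X) : Prop :=
  IsFiniteMeasure ν ∧ IsTightMeasureSet {ν} ∧
    ∀ (f : blipFun X) (π : Fin k → lipFun X),
      |T f π| ≤ (∏ i, (lipConst (π i).1 : ℝ)) * ∫ x, |f.1 x| ∂ν

/-- The finite mass axiom. -/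
def HasFiniteMass {k : ℕ} (T : Functional X k) : Prop := ∃ ν : Measure X, IsMassMeasure T ν

/-- Metric `k`-currents in the sense of Ambrosio and Kirchheim. -/
structure IsCurrent {k : ℕ} (T : Functional X k) : Prop where
  multilin : IsMultilin T
  isLocal : IsLocal T
  cont : IsCont T
  mass : HasFiniteMass T

/-- Normal currents: currents whose boundary has finite mass; there is no condition on the
boundary for `k = 0`. -/
def IsNormal : {k : ℕ} → Functional X k → Prop
  | 0, T => IsCurrent T
  | _ + 1, T => IsCurrent T ∧ HasFiniteMass (boundary T)

/-- The support of `T`: the intersection of the supports of all measures in the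
finite mass axiom for `T`. -/
def currentSupport {k : ℕ} (T : Functional X k) : Set X :=
  ⋂ ν ∈ {ν : Measure X | IsMassMeasure T ν}, ν.support

theorem notMem_currentSupport {k : ℕ} {T : Functional X k} {x : X} :
    x ∉ currentSupport T ↔ ∃ ν, IsMassMeasure T ν ∧ x ∉ ν.support := by
  simp [currentSupport]

theorem isClosed_currentSupport {k : ℕ} (T : Functional X k) : IsClosed (currentSupport T) :=
  isClosed_biInter fun _ _ => Measure.isClosed_support

theorem isTight_of_le {μ ν : Measure X} (h : IsTightMeasureSet {ν}) (hμ : μ ≤ ν) :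
    IsTightMeasureSet {μ} := by
  rw [isTightMeasureSet_iff_exists_isCompact_measure_compl_le] at *
  intro ε hε
  obtain ⟨K, hK, h2⟩ := h ε hε
  refine ⟨K, hK, fun ρ hρ => ?_⟩
  rw [Set.mem_singleton_iff.1 hρ]
  exact (hμ _).trans (h2 ν rfl)

theorem isTight_add {μ ν : Measure X} (hμ : IsTightMeasureSet {μ}) (hν : IsTightMeasureSet {ν}) :
    IsTightMeasureSet {μ + ν} := by
  rw [isTightMeasureSet_iff_exists_isCompact_measure_compl_le] at *
  intro ε hε
  obtain ⟨K, hK, h2⟩ := hμ (ε / 2) (ENNReal.half_pos hε.ne')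
  obtain ⟨L, hL, h3⟩ := hν (ε / 2) (ENNReal.half_pos hε.ne')
  refine ⟨K ∪ L, hK.union hL, fun ρ hρ => ?_⟩
  rw [Set.mem_singleton_iff.1 hρ, Measure.add_apply, ← ENNReal.add_halves ε]
  refine add_le_add ((measure_mono ?_).trans (h2 μ rfl)) ((measure_mono ?_).trans (h3 ν rfl))
  · exact Set.compl_subset_compl.2 Set.subset_union_left
  · exact Set.compl_subset_compl.2 Set.subset_union_right

theorem isTight_smul {μ : Measure X} (c : ℝ≥0) (hμ : IsTightMeasureSet {μ}) :
    IsTightMeasureSet {c • μ} := by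
  rw [isTightMeasureSet_iff_exists_isCompact_measure_compl_le] at *
  intro ε hε
  obtain ⟨K, hK, h2⟩ := hμ (ε / c) (ENNReal.div_pos hε.ne' ENNReal.coe_ne_top)
  refine ⟨K, hK, fun ρ hρ => ?_⟩
  rw [Set.mem_singleton_iff.1 hρ, Measure.smul_apply, ENNReal.smul_def, smul_eq_mul, mul_comm]
  exact ENNReal.mul_le_of_le_div (h2 μ rfl)

theorem isTight_zero : IsTightMeasureSet {(0 : Measure X)} := by
  rw [isTightMeasureSet_iff_exists_isCompact_measure_compl_le]
  exact fun ε _ => ⟨∅, isCompact_empty, fun ρ hρ => by simp [Set.mem_singleton_iff.1 hρ]⟩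

theorem isMassMeasure_zero {k : ℕ} : IsMassMeasure (0 : Functional X k) 0 :=
  ⟨inferInstance, isTight_zero, fun f π => by simp⟩

theorem IsMassMeasure.smul {k : ℕ} {T : Functional X k} {ν : Measure X} (h : IsMassMeasure T ν)
    (c : ℝ) : IsMassMeasure (c • T) (‖c‖₊ • ν) := by
  have := h.1
  refine ⟨inferInstance, isTight_smul _ h.2.1, fun f π => ?_⟩
  rw [integral_smul_nnreal_measure, Pi.smul_apply, Pi.smul_apply, smul_eq_mul, abs_mul]
  have h2 := mul_le_mul_of_nonneg_left (h.2.2 f π) (abs_nonneg c)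
  refine h2.trans (le_of_eq ?_)
  rw [NNReal.smul_def, coe_nnnorm, Real.norm_eq_abs, smul_eq_mul]
  ring

theorem HasFiniteMass.smul {k : ℕ} {T : Functional X k} (h : HasFiniteMass T) (c : ℝ) :
    HasFiniteMass (c • T) := by
  obtain ⟨ν, hν⟩ := h
  exact ⟨_, hν.smul c⟩

theorem isCurrent_zero {k : ℕ} : IsCurrent (0 : Functional X k) where
  multilin := ⟨0, fun _ _ => rfl⟩
  isLocal := fun _ _ _ => rfl
  cont := fun _ _ _ _ _ => tendsto_const_nhds
  mass := ⟨0, isMassMeasure_zero⟩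

theorem IsNormal.isCurrent : {k : ℕ} → {T : Functional X k} → IsNormal T → IsCurrent T
  | 0, _, h => h
  | _ + 1, _, h => h.1

theorem IsCurrent.smul {k : ℕ} {T : Functional X k} (h : IsCurrent T) (c : ℝ) :
    IsCurrent (c • T) where
  multilin := by
    obtain ⟨M, hM⟩ := h.multilin
    exact ⟨c • M, fun f π => by simp [hM]⟩
  isLocal := fun f π hf => by
    rw [Pi.smul_apply, Pi.smul_apply, h.isLocal f π hf, smul_zero]
  cont := fun f p π hp hπ => (h.cont f p π hp hπ).const_smul c
  mass := h.mass.smul c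

variable [BorelSpace X]

theorem integrable_blip (ν : Measure X) [IsFiniteMeasure ν] (f : blipFun X) :
    Integrable (fun x => |f.1 x|) ν := by
  obtain ⟨⟨K, hK⟩, C, hC⟩ := f.2
  refine Integrable.of_bound (hK.continuous.abs.aestronglyMeasurable) C (ae_of_all _ fun x => ?_)
  simpa using hC x

theorem IsMassMeasure.add {k : ℕ} {T U : Functional X k} {ν ρ : Measure X}
    (h : IsMassMeasure T ν) (h' : IsMassMeasure U ρ) : IsMassMeasure (T + U) (ν + ρ) := by
  have := h.1
  have := h'.1
  refine ⟨inferInstance, isTight_add h.2.1 h'.2.1, fun f π => ?_⟩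
  rw [integral_add_measure (integrable_blip ν f) (integrable_blip ρ f), mul_add]
  exact (abs_add_le _ _).trans (add_le_add (h.2.2 f π) (h'.2.2 f π))

theorem HasFiniteMass.add {k : ℕ} {T U : Functional X k} (h : HasFiniteMass T)
    (h' : HasFiniteMass U) : HasFiniteMass (T + U) := by
  obtain ⟨ν, hν⟩ := h
  obtain ⟨ρ, hρ⟩ := h'
  exact ⟨_, hν.add hρ⟩

theorem IsCurrent.add {k : ℕ} {T U : Functional X k} (h : IsCurrent T) (h' : IsCurrent U) :
    IsCurrent (T + U) where
  multilin := by
    obtain ⟨M, hM⟩ := h.multilin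
    obtain ⟨N, hN⟩ := h'.multilin
    exact ⟨M + N, fun f π => by simp [hM, hN]⟩
  isLocal := fun f π hf => by
    rw [Pi.add_apply, Pi.add_apply, h.isLocal f π hf, h'.isLocal f π hf, add_zero]
  cont := fun f p π hp hπ => (h.cont f p π hp hπ).add (h'.cont f p π hp hπ)
  mass := h.mass.add h'.mass

/-- `𝐍_k^c(X)`: the normal `k`-currents with compact support. -/
def NormalCurrent (X : Type u) [MetricSpace X] [MeasurableSpace X] [BorelSpace X] (k : ℕ) :
    Submodule ℝ (Functional X k) where
  carrier := {T | IsNormal T ∧ IsCompact (currentSupport T)}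
  add_mem' := by
    rintro T U ⟨hT, hT2⟩ ⟨hU, hU2⟩
    refine ⟨?_, (hT2.union hU2).of_isClosed_subset (isClosed_currentSupport _) ?_⟩
    · cases k with
      | zero => exact hT.isCurrent.add hU.isCurrent
      | succ k => exact ⟨hT.isCurrent.add hU.isCurrent, hT.2.add hU.2⟩
    · intro x hx
      contrapose! hx
      rw [Set.mem_union, not_or] at hx
      obtain ⟨ν, hν, h1⟩ := notMem_currentSupport.1 hx.1
      obtain ⟨ρ, hρ, h2⟩ := notMem_currentSupport.1 hx.2
      refine notMem_currentSupport.2 ⟨ν + ρ, hν.add hρ, ?_⟩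
      rw [Measure.support_add]
      exact not_or.2 ⟨h1, h2⟩
  zero_mem' := by
    refine ⟨?_, ?_⟩
    · cases k with
      | zero => exact isCurrent_zero
      | succ k => exact ⟨isCurrent_zero, 0, isMassMeasure_zero⟩
    · convert isCompact_empty (X := X)
      refine Set.eq_empty_of_forall_notMem fun x => notMem_currentSupport.2
        ⟨0, isMassMeasure_zero, ?_⟩
      simp
  smul_mem' := by
    rintro c T ⟨hT, hT2⟩
    refine ⟨?_, hT2.of_isClosed_subset (isClosed_currentSupport _) ?_⟩
    · cases k with
      | zero => exact hT.isCurrent.smul c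
      | succ k => exact ⟨hT.isCurrent.smul c, hT.2.smul c⟩
    · intro x hx
      contrapose! hx
      obtain ⟨ν, hν, h1⟩ := notMem_currentSupport.1 hx
      refine notMem_currentSupport.2 ⟨_, hν.smul c, fun h => h1 ?_⟩
      exact (Measure.absolutelyContinuous_of_le_smul le_rfl).support_mono h

end Current

/-! ### The boundary of normal currents -/

section CurrentBoundary

variable {X : Type u} [MetricSpace X]

/-- The product of two bounded Lipschitz functions. -/
def blipMul (f g : blipFun X) : blipFun X :=
  ⟨fun x => f.1 x * g.1 x, by
    obtain ⟨⟨K, hK⟩, C, hC⟩ := f.2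
    obtain ⟨⟨L, hL⟩, D, hD⟩ := g.2
    refine ⟨⟨C.toNNReal * L + D.toNNReal * K, LipschitzWith.of_dist_le_mul fun x y => ?_⟩,
      C * D, fun x => ?_⟩
    · have h1 := hK.dist_le_mul x y
      have h2 := hL.dist_le_mul x y
      have hC' : |f.1 x| ≤ C.toNNReal := (hC x).trans (Real.le_coe_toNNReal C)
      have hD' : |g.1 y| ≤ D.toNNReal := (hD y).trans (Real.le_coe_toNNReal D)
      rw [Real.dist_eq] at h1 h2 ⊢
      have h3 : f.1 x * g.1 x - f.1 y * g.1 y =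
        f.1 x * (g.1 x - g.1 y) + g.1 y * (f.1 x - f.1 y) := by ring
      rw [h3]
      refine (abs_add_le _ _).trans ?_
      rw [abs_mul, abs_mul, NNReal.coe_add, NNReal.coe_mul, NNReal.coe_mul, add_mul, mul_assoc,
        mul_assoc]
      exact add_le_add (mul_le_mul hC' h2 (abs_nonneg _) (NNReal.coe_nonneg _))
        (mul_le_mul hD' h1 (abs_nonneg _) (NNReal.coe_nonneg _))
    · rw [abs_mul]
      exact mul_le_mul (hC x) (hD x) (abs_nonneg _) ((abs_nonneg _).trans (hC x))⟩

/-- The truncation of a Lipschitz function to values in `[0, 1]`. -/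
def blipClamp (f : X → ℝ) (hf : IsLip f) : blipFun X :=
  ⟨fun x => max 0 (min 1 (f x)), by
    obtain ⟨K, hK⟩ := hf
    refine ⟨⟨K, (hK.const_min 1).const_max 0⟩, 1, fun x => ?_⟩
    rw [abs_of_nonneg (le_max_left _ _)]
    exact max_le zero_le_one (min_le_left _ _)⟩

theorem IsMultilin.split {k : ℕ} {T : Functional X k} (h : IsMultilin T) (f g : blipFun X)
    (π : Fin k → lipFun X) : T f π = T g π + T (f - g) π := by
  obtain ⟨M, hM⟩ := h
  simp [hM]

theorem IsMultilin.boundary {k : ℕ} {T : Functional X (k + 1)} (h : IsMultilin T) :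
    IsMultilin (boundary T) := by
  obtain ⟨M, hM⟩ := h
  exact ⟨(M blipOne).curryLeft ∘ₗ blipToLip, fun f π => by
    simp [LipCurrent.boundary, hM]⟩

theorem IsCont.boundary {k : ℕ} {T : Functional X (k + 1)} (h : IsCont T) :
    IsCont (boundary T) := by
  rintro f p π ⟨L, hL⟩ hp
  refine h _ _ _ ⟨max L (lipConst f.1), fun n i => ?_⟩ fun i x => ?_
  · refine Fin.cases ?_ (fun i => ?_) i
    · exact f.2.1.lipschitzWith.weaken (le_max_right _ _)
    · exact (hL n i).weaken (le_max_left _ _)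
  · refine Fin.cases ?_ (fun i => ?_) i
    · exact tendsto_const_nhds
    · exact hp i x

theorem IsLocal.boundary {k : ℕ} {T : Functional X (k + 1)} (h : IsLocal T) (hm : IsMultilin T)
    (hc : IsCont T) : IsLocal (boundary T) := by
  rintro f π ⟨i, c, hi⟩
  have hε : ∀ n : ℕ, (0 : ℝ) < 1 / ((n : ℝ) + 1) := fun n => Nat.one_div_pos_of_nat
  -- `t n` vanishes where `|f| ≤ ε` and is uniformly `ε`-close to `f`
  have hcl : ∀ n : ℕ, LipschitzWith (lipConst f.1)
      (fun x => max (-(1 / ((n : ℝ) + 1))) (min (1 / ((n : ℝ) + 1)) (f.1 x))) := fun n =>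
    (f.2.1.lipschitzWith.const_min _).const_max _
  let t : ℕ → lipFun X := fun n =>
    ⟨fun x => f.1 x - max (-(1 / ((n : ℝ) + 1))) (min (1 / ((n : ℝ) + 1)) (f.1 x)),
      _, f.2.1.lipschitzWith.sub (hcl n)⟩
  have key : ∀ n, T blipOne (Fin.cons (t n) π) = 0 := by
    intro n
    have hgl : IsLip fun x => ((n : ℝ) + 1) * |f.1 x| := by
      have h1 : LipschitzWith (lipConst f.1) fun x => |f.1 x| := by
        refine LipschitzWith.of_dist_le_mul fun x y => ?_
        exact (abs_abs_sub_abs_le _ _).trans (f.2.1.lipschitzWith.dist_le_mul x y)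
      exact ⟨_, lipschitzWith_const_smul h1 ((n : ℝ) + 1)⟩
    rw [hm.split blipOne (blipClamp _ hgl), h _ _ ⟨i.succ, c, fun x hx => ?_⟩,
      h _ _ ⟨0, 0, fun x hx => ?_⟩, add_zero]
    · have hx' : ((n : ℝ) + 1) * |f.1 x| < 1 := by
        by_contra! h1
        apply hx
        change 1 - max 0 (min 1 (((n : ℝ) + 1) * |f.1 x|)) = 0
        rw [min_eq_left h1, max_eq_right zero_le_one, sub_self]
      have hx2 : |f.1 x| ≤ 1 / ((n : ℝ) + 1) := by
        rw [le_div_iff₀ (by positivity), mul_comm]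
        exact hx'.le
      change f.1 x - max (-(1 / ((n : ℝ) + 1))) (min (1 / ((n : ℝ) + 1)) (f.1 x)) = 0
      rw [min_eq_right (abs_le.1 hx2).2, max_eq_right (abs_le.1 hx2).1, sub_self]
    · refine hi x fun h0 => hx ?_
      change max 0 (min 1 (((n : ℝ) + 1) * |f.1 x|)) = 0
      simp [h0]
  have hlim := hc blipOne (fun n => Fin.cons (t n) π) (Fin.cons (blipToLip f) π)
    ⟨(lipConst f.1 + lipConst f.1) + ∑ j, lipConst (π j).1, fun n j => ?_⟩ fun j x => ?_
  · simp only [key] at hlim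
    exact (tendsto_nhds_unique hlim tendsto_const_nhds)
  · refine Fin.cases ?_ (fun j => ?_) j
    · exact (f.2.1.lipschitzWith.sub (hcl n)).weaken le_self_add
    · refine (IsLip.lipschitzWith (π j).2).weaken (le_trans ?_ le_add_self)
      exact Finset.single_le_sum (f := fun j => lipConst (π j).1) (fun _ _ => zero_le)
        (Finset.mem_univ j)
  · refine Fin.cases ?_ (fun j => ?_) j
    · refine tendsto_iff_dist_tendsto_zero.2 (squeeze_zero (fun _ => dist_nonneg) (fun n => ?_)
        tendsto_one_div_add_atTop_nhds_zero_nat)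
      change |f.1 x - max (-(1 / ((n : ℝ) + 1))) (min (1 / ((n : ℝ) + 1)) (f.1 x)) - f.1 x| ≤ _
      rw [sub_sub_cancel_left, abs_neg, abs_le]
      exact ⟨le_max_left _ _, max_le (by linarith [hε n]) (min_le_left _ _)⟩
    · exact tendsto_const_nhds

theorem boundary_boundary {k : ℕ} {T : Functional X (k + 2)} (h : IsLocal T) :
    boundary (boundary T) = 0 := by
  funext f π
  exact h _ _ ⟨0, 1, fun _ _ => rfl⟩

theorem isLip_cutoff (x : X) (r c : ℝ) : IsLip fun y => c - dist y x / r := by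
  have h1 : LipschitzWith 1 fun y => dist y x := LipschitzWith.dist_left x
  have h2 := (LipschitzWith.const (α := X) c).add (lipschitzWith_const_smul h1 (-(1 / r)))
  have h3 : (fun y => c - dist y x / r) = fun y => c + (-(1 / r) • fun y => dist y x) y := by
    funext y
    rw [Pi.smul_apply, smul_eq_mul]
    ring
  rw [h3]
  exact ⟨_, h2⟩

variable [MeasurableSpace X]

theorem IsCurrent.boundary {k : ℕ} {T : Functional X (k + 1)} (h : IsCurrent T)
    (hb : HasFiniteMass (boundary T)) : IsCurrent (boundary T) :=
  ⟨h.multilin.boundary, h.isLocal.boundary h.multilin h.cont, h.cont.boundary, hb⟩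

variable [BorelSpace X]

theorem currentSupport_boundary_subset {k : ℕ} {T : Functional X (k + 1)} (h : IsCurrent T)
    (hb : HasFiniteMass (boundary T)) : currentSupport (boundary T) ⊆ currentSupport T := by
  intro x hx
  contrapose! hx
  obtain ⟨ν, hν, hxν⟩ := notMem_currentSupport.1 hx
  obtain ⟨ρ, hρ⟩ := hb
  obtain ⟨U, hU, hνU⟩ := Measure.notMem_support_iff_exists.1 hxν
  obtain ⟨s, hs, hsU⟩ := Metric.mem_nhds_iff.1 hU
  set r := s / 3 with hr
  have hr0 : 0 < r := by positivity
  let η₁ := blipClamp _ (isLip_cutoff x r 2)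
  let η₂ := blipClamp _ (isLip_cutoff x r 3)
  have := hν.1
  have := hρ.1
  refine notMem_currentSupport.2 ⟨ρ.restrict (Metric.ball x r)ᶜ,
    ⟨inferInstance, isTight_of_le hρ.2.1 Measure.restrict_le_self, fun f π => ?_⟩, ?_⟩
  · -- the part of `f` near `x` does not contribute
    have h0 : LipCurrent.boundary T (blipMul f η₁) π = 0 := by
      change T blipOne (Fin.cons (blipToLip (blipMul f η₁)) π) = 0
      rw [h.multilin.split blipOne η₂, h.isLocal (blipOne - η₂) _ ⟨0, 0, fun y hy => ?_⟩, add_zero]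
      · have h1 := hν.2.2 η₂ (Fin.cons (blipToLip (blipMul f η₁)) π)
        have h2 : ∫ y, |η₂.1 y| ∂ν = 0 := by
          refine integral_eq_zero_of_ae ?_
          refine measure_mono_null (fun y hy => ?_) hνU
          by_contra hyU
          apply hy
          have h3 : s ≤ dist y x := by
            by_contra! h4
            exact hyU (hsU (Metric.mem_ball.2 h4))
          have h4 : 3 ≤ dist y x / r := by
            rw [le_div_iff₀ hr0, hr]
            linarith
          change |max 0 (min 1 (3 - dist y x / r))| = 0
          rw [min_eq_right (by linarith), max_eq_left (by linarith), abs_zero]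
        rw [h2, mul_zero] at h1
        exact abs_nonpos_iff.1 h1
      · have h3 : 2 ≤ dist y x / r := by
          by_contra! h4
          apply hy
          change 1 - max 0 (min 1 (3 - dist y x / r)) = 0
          rw [min_eq_left (by linarith), max_eq_right zero_le_one, sub_self]
        change f.1 y * max 0 (min 1 (2 - dist y x / r)) = 0
        rw [min_eq_right (by linarith), max_eq_left (by linarith), mul_zero]
    have h1 := h.multilin.boundary.split f (blipMul f η₁) π
    rw [h0, zero_add] at h1
    rw [h1]
    refine (hρ.2.2 _ π).trans (mul_le_mul_of_nonneg_left ?_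
      (Finset.prod_nonneg fun _ _ => NNReal.coe_nonneg _))
    rw [← integral_indicator Metric.isOpen_ball.measurableSet.compl]
    refine integral_mono (integrable_blip ρ _)
      ((integrable_blip ρ f).indicator Metric.isOpen_ball.measurableSet.compl) fun y => ?_
    have hη : 0 ≤ η₁.1 y ∧ η₁.1 y ≤ 1 :=
      ⟨le_max_left _ _, max_le zero_le_one (min_le_left _ _)⟩
    change |f.1 y - f.1 y * η₁.1 y| ≤ _
    by_cases hy : y ∈ Metric.ball x r
    · rw [Set.indicator_of_notMem (by simpa using hy)]
      have h3 : dist y x / r ≤ 1 := by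
        rw [div_le_one hr0]
        exact (Metric.mem_ball.1 hy).le
      have h4 : η₁.1 y = 1 := by
        change max 0 (min 1 (2 - dist y x / r)) = 1
        rw [min_eq_left (by linarith), max_eq_right zero_le_one]
      rw [h4, mul_one, sub_self, abs_zero]
    · rw [Set.indicator_of_mem (by simpa using hy)]
      have h3 : f.1 y - f.1 y * η₁.1 y = f.1 y * (1 - η₁.1 y) := by ring
      rw [h3, abs_mul, abs_of_nonneg (by linarith : 0 ≤ 1 - η₁.1 y)]
      exact mul_le_of_le_one_right (abs_nonneg _) (by linarith)
  · refine Measure.notMem_support_iff_exists.2 ⟨Metric.ball x r, Metric.ball_mem_nhds x hr0, ?_⟩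
    rw [Measure.restrict_apply Metric.isOpen_ball.measurableSet, Set.inter_compl_self,
      measure_empty]

theorem boundary_mem {k : ℕ} {T : Functional X (k + 1)} (hT : T ∈ NormalCurrent X (k + 1)) :
    boundary T ∈ NormalCurrent X k := by
  obtain ⟨⟨h1, h2⟩, h3⟩ := hT
  refine ⟨?_, h3.of_isClosed_subset (isClosed_currentSupport _)
    (currentSupport_boundary_subset h1 h2)⟩
  cases k with
  | zero => exact h1.boundary h2
  | succ k =>
    refine ⟨h1.boundary h2, 0, ?_⟩
    rw [boundary_boundary h1.isLocal]
    exact isMassMeasure_zero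

/-- The boundary operator of normal currents with compact support. -/
def currentBoundary (k : ℕ) : NormalCurrent X (k + 1) →ₗ[ℝ] NormalCurrent X k where
  toFun T := ⟨boundary T.1, boundary_mem T.2⟩
  map_add' _ _ := rfl
  map_smul' _ _ := rfl

theorem currentBoundary_currentBoundary (k : ℕ) (T : NormalCurrent X (k + 2)) :
    currentBoundary k (currentBoundary (k + 1) T) = 0 :=
  Subtype.ext (boundary_boundary T.2.1.isCurrent.isLocal)

end CurrentBoundary

/-! ### The two chain complexes -/

section Complexes

open CategoryTheory

/-- The Lipschitz measure chain complex of `X`. -/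
def lipMeasureComplex (X : Type u) [MetricSpace X] : ChainComplex (ModuleCat.{u} ℝ) ℕ :=
  ChainComplex.of (fun k => ModuleCat.of ℝ (LipChain X k))
    (fun k => ModuleCat.ofHom (chainBoundary k)) fun k => by
      ext μ : 2
      exact chainBoundary_chainBoundary k μ

/-- The chain complex of normal currents with compact support in `X`. -/
def normalCurrentComplex (X : Type u) [MetricSpace X] [MeasurableSpace X] [BorelSpace X] :
    ChainComplex (ModuleCat.{u} ℝ) ℕ :=
  ChainComplex.of (fun k => ModuleCat.of ℝ (NormalCurrent X k))
    (fun k => ModuleCat.ofHom (currentBoundary k)) fun k => by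
      ext T : 2
      exact currentBoundary_currentBoundary k T

end Complexes

/-! ### The current of a Lipschitz measure chain -/

section Tmu

variable {X : Type u} [MetricSpace X]

/-- The simplex `{s : s_i ≥ 0, ∑ s_i ≤ 1}` in `ℝ^k`, the coordinate domain of `Simplex k`. -/
def corner (k : ℕ) : Set (Fin k → ℝ) := {s | (∀ i, 0 ≤ s i) ∧ ∑ i, s i ≤ 1}

/-- The affine parametrization `s ↦ (1 - ∑ s_i, s_1, …, s_k)` of `Simplex k` by `corner k`
(extended by a constant outside of `corner k`). It maps `0, e_1, …, e_k` to the vertices number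
`0, …, k`, so it is positively oriented for the order of the vertices. -/
def chart (k : ℕ) (s : Fin k → ℝ) : Simplex k :=
  open Classical in
  if h : s ∈ corner k then
    ⟨WithLp.toLp 2 (Fin.cons (1 - ∑ i, s i) s), by
      refine ⟨fun i => ?_, ?_⟩
      · refine Fin.cases ?_ (fun j => ?_) i
        · simpa using h.2
        · simpa using h.1 j
      · rw [Fin.sum_univ_succ]
        simp⟩
  else
    ⟨WithLp.toLp 2 (Fin.cons 1 0), by
      refine ⟨fun i => ?_, ?_⟩
      · refine Fin.cases ?_ (fun j => ?_) i <;> simp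
      · rw [Fin.sum_univ_succ]
        simp⟩

/-- `[σ](f dπ) = ∫_{Δ^k} f ∘ σ · det ∇(π ∘ σ) dℒ^k`. The integral is computed in the
positively oriented affine coordinates `chart k`; its value is the same in all such coordinates,
in particular when the regular simplex is placed isometrically and positively oriented in `ℝ^k`. -/
def simplexCurrent {k : ℕ} (σ : LipB (Simplex k) X) : Functional X k := fun f π =>
  ∫ s in corner k, f.1 (σ (chart k s)) *
    Matrix.det (Matrix.of fun i j : Fin k =>
      fderiv ℝ (fun t : Fin k → ℝ => (π i).1 (σ (chart k t))) s (Pi.single j 1))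

/-- `T^μ(f dπ) = ∫ [σ](f dπ) dμ(σ)`. -/
def measureCurrent {k : ℕ} (μ : LipChain X k) : Functional X k := fun f π =>
  ∫ᵛ σ, simplexCurrent σ f π ∂•μ.1

end Tmu

end

end LipCurrent

open LipCurrent

namespace LipCurrent

universe u v

/-! Everything reduces to single simplices. In affine coordinates, `[σ]` integrates `f ∘ σ` against
the Jacobian of the Lipschitz functions `π_i ∘ σ`. Three facts about it are needed. (a) `[σ](f dπ)`
is continuous in `σ` (`continuous_simplexCurrent`), hence bounded on a compact determination set and
integrable. Indeed `h ∘ σ` is, up to a constant, the pairing of `δ ∘ σ` with `h - h(x₀)`. Norm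
convergence of `δ ∘ σ` therefore makes the gradients of `π_i ∘ σ` converge almost everywhere, and
dominated convergence applies. (b) `[σ]` is local, continuous in `π`, and its mass is at most a
constant times the image of Lebesgue measure under `σ`; the constant depends on `σ` only through the
norm of `δ ∘ σ` (`isLocal_simplexCurrent`, `isCont_simplexCurrent`, `abs_simplexCurrent_le`). (c)
`∂[σ]` is the alternating sum of the currents of the faces (`boundary_simplexCurrent`). The constant
in (b) is uniform on the determination set. So continuity passes to `T^μ` by dominated convergence,
and a multiple of the image of `|μ| × ℒᵏ` under `(σ, s) ↦ σ(s)` is a mass measure for `T^μ`,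
concentrated on a compact set. Integrating (c) gives `∂T^μ = T^{∂μ}`, and normality follows because
`T^{∂μ}` has finite mass.

The analytic core is continuity in (b) and Stokes' theorem in (c), for functions that are
differentiable only almost everywhere. In (b) the `π_i` converge only pointwise, so their gradients
need not converge. Both are obtained by one induction on the dimension. Weak continuity of Jacobians
in dimension `k` gives Stokes' theorem in dimension `k + 1` (`JacContinuous.stokesMul`): mollify and
use the smooth theorem `stokes_smooth`. In the interior the gradients of the mollifications converge
almost everywhere; the faces are null sets, and there weak continuity in dimension `k` is used.
Stokes' theorem gives weak continuity in dimension `k + 1` (`StokesMul.jacContinuous`): replace one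
component at a time, and integrate by parts to free the difference, which tends to zero, of its
derivative. -/

/-! ### Jacobian determinants -/

section Jacobian

variable {n : ℕ}

/-- The vector of partial derivatives. -/
noncomputable def partials (g : (Fin n → ℝ) → ℝ) (s : Fin n → ℝ) : Fin n → ℝ :=
  fun j => fderiv ℝ g s (Pi.single j 1)

/-- The Jacobian determinant of `n` functions on `ℝⁿ`. -/
noncomputable def jac (G : Fin n → (Fin n → ℝ) → ℝ) (s : Fin n → ℝ) : ℝ :=
  Matrix.det (Matrix.of fun i => partials (G i) s)

/-- Leibniz expansion: each of the `n!` products takes one entry from every row. Keeping a separate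
constant per row is what later yields the product of the `Lip(π_i)` in the mass bound. -/
theorem abs_det_le_prod {M : Matrix (Fin n) (Fin n) ℝ} {a : Fin n → ℝ}
    (h : ∀ i j, |M i j| ≤ a i) : |M.det| ≤ n.factorial * ∏ i, a i := by
  rw [← Matrix.det_transpose, Matrix.det_apply]
  refine (Finset.abs_sum_le_sum_abs _ _).trans ?_
  have : ∀ σ : Equiv.Perm (Fin n),
      |Equiv.Perm.sign σ • ∏ i, M.transpose (σ i) i| ≤ ∏ i, a i := fun σ => by
    rw [Units.smul_def, zsmul_eq_mul, abs_mul]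
    have h1 : |((Equiv.Perm.sign σ : ℤ) : ℝ)| = 1 := by
      rcases Int.units_eq_one_or (Equiv.Perm.sign σ) with h | h <;> simp [h]
    rw [h1, one_mul, Finset.abs_prod]
    exact Finset.prod_le_prod (fun _ _ => abs_nonneg _) fun i _ => h i (σ i)
  refine (Finset.sum_le_sum fun σ _ => this σ).trans (le_of_eq ?_)
  rw [Finset.sum_const, Finset.card_univ, Fintype.card_perm, Fintype.card_fin, nsmul_eq_mul]

theorem abs_partials_le {g : (Fin n → ℝ) → ℝ} {L : ℝ≥0} (h : LipschitzWith L g) (s : Fin n → ℝ)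
    (j : Fin n) : |partials g s j| ≤ L := by
  have h1 := (fderiv ℝ g s).le_opNorm (Pi.single j 1)
  rw [Pi.norm_single, norm_one, mul_one] at h1
  exact h1.trans (norm_fderiv_le_of_lipschitz ℝ h)

theorem abs_jac_le {G : Fin n → (Fin n → ℝ) → ℝ} {L : Fin n → ℝ≥0}
    (h : ∀ i, LipschitzWith (L i) (G i)) (s : Fin n → ℝ) :
    |jac G s| ≤ n.factorial * ∏ i, (L i : ℝ) :=
  abs_det_le_prod fun i j => abs_partials_le (h i) s j

theorem abs_jac_le_pow {G : Fin n → (Fin n → ℝ) → ℝ} {L : ℝ≥0}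
    (h : ∀ i, LipschitzWith L (G i)) (s : Fin n → ℝ) :
    |jac G s| ≤ n.factorial * (L : ℝ) ^ n := by
  simpa using abs_jac_le h s

theorem measurable_partials (g : (Fin n → ℝ) → ℝ) (j : Fin n) :
    Measurable fun s => partials g s j :=
  measurable_fderiv_apply_const ℝ g _

theorem measurable_jac (G : Fin n → (Fin n → ℝ) → ℝ) : Measurable (jac G) := by
  unfold jac
  simp only [Matrix.det_apply]
  exact Finset.measurable_sum _ fun σ _ =>
    (Finset.measurable_prod _ fun i _ => measurable_partials _ _).const_smul _

theorem tendsto_det {ι : Type*} {l : Filter ι} {M : ι → Matrix (Fin n) (Fin n) ℝ}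
    {N : Matrix (Fin n) (Fin n) ℝ} (h : ∀ i j, Tendsto (fun m => M m i j) l (𝓝 (N i j))) :
    Tendsto (fun m => (M m).det) l (𝓝 N.det) := by
  have h1 : Tendsto M l (𝓝 N) := tendsto_pi_nhds.2 fun i => tendsto_pi_nhds.2 fun j => h i j
  exact ((continuous_id.matrix_det (n := Fin n) (R := ℝ)).tendsto N).comp h1

theorem tendsto_jac {ι : Type*} {l : Filter ι} {G : ι → Fin n → (Fin n → ℝ) → ℝ}
    {G₀ : Fin n → (Fin n → ℝ) → ℝ} {s : Fin n → ℝ}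
    (h : ∀ i j, Tendsto (fun m => partials (G m i) s j) l (𝓝 (partials (G₀ i) s j))) :
    Tendsto (fun m => jac (G m) s) l (𝓝 (jac G₀ s)) :=
  tendsto_det h

theorem partials_congr {g g' : (Fin n → ℝ) → ℝ} {s : Fin n → ℝ} (h : g =ᶠ[𝓝 s] g') :
    partials g s = partials g' s := by
  unfold partials
  rw [h.fderiv_eq]

theorem jac_congr {G G' : Fin n → (Fin n → ℝ) → ℝ} {s : Fin n → ℝ}
    (h : ∀ i, G i =ᶠ[𝓝 s] G' i) : jac G s = jac G' s := by
  unfold jac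
  simp only [partials_congr (h _)]

theorem partials_add {g h : (Fin n → ℝ) → ℝ} {s : Fin n → ℝ} (hg : DifferentiableAt ℝ g s)
    (hh : DifferentiableAt ℝ h s) :
    partials (fun t => g t + h t) s = partials g s + partials h s := by
  funext j
  simp [partials, fderiv_fun_add hg hh]

theorem partials_sub {g h : (Fin n → ℝ) → ℝ} {s : Fin n → ℝ} (hg : DifferentiableAt ℝ g s)
    (hh : DifferentiableAt ℝ h s) :
    partials (fun t => g t - h t) s = partials g s - partials h s := by
  funext j
  simp [partials, fderiv_fun_sub hg hh]

theorem partials_const_mul {g : (Fin n → ℝ) → ℝ} {s : Fin n → ℝ} (c : ℝ)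
    (hg : DifferentiableAt ℝ g s) :
    partials (fun t => c * g t) s = c • partials g s := by
  funext j
  simp [partials, fderiv_const_mul hg]

theorem partials_mul {g h : (Fin n → ℝ) → ℝ} {s : Fin n → ℝ} (hg : DifferentiableAt ℝ g s)
    (hh : DifferentiableAt ℝ h s) :
    partials (fun t => g t * h t) s = g s • partials h s + h s • partials g s := by
  funext j
  simp [partials, fderiv_fun_mul hg hh]

theorem partials_const (c : ℝ) (s : Fin n → ℝ) : partials (fun _ => c) s = 0 := by
  funext j
  simp [partials]

/-- Exposes the alternating form in the gradients, so that linearity in one component comes from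
`AlternatingMap`. -/
theorem jac_update {G : Fin n → (Fin n → ℝ) → ℝ} (i : Fin n) (g : (Fin n → ℝ) → ℝ)
    (s : Fin n → ℝ) :
    jac (Function.update G i g) s =
      Matrix.detRowAlternating (Function.update (fun i => partials (G i) s) i (partials g s)) := by
  change Matrix.detRowAlternating (fun l => partials (Function.update G i g l) s) = _
  congr 1
  funext l
  by_cases hl : l = i
  · subst hl; simp
  · simp [hl]

end Jacobian

/-! ### The coordinate simplex -/

section Corner

variable {n : ℕ}

theorem isClosed_corner (n : ℕ) : IsClosed (corner n) := by
  have : corner n = (⋂ i, {s | 0 ≤ s i}) ∩ {s | ∑ i, s i ≤ 1} := by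
    ext s; simp [corner]
  rw [this]
  exact (isClosed_iInter fun i => isClosed_le continuous_const (continuous_apply i)).inter
    (isClosed_le (continuous_finsetSum _ fun i _ => continuous_apply i) continuous_const)

theorem corner_coord_le {s : Fin n → ℝ} (hs : s ∈ corner n) (i : Fin n) : s i ≤ 1 :=
  (Finset.single_le_sum (fun j _ => hs.1 j) (Finset.mem_univ i)).trans hs.2

theorem corner_subset_closedBall (n : ℕ) : corner n ⊆ Metric.closedBall 0 1 := fun s hs => by
  rw [mem_closedBall_zero_iff, pi_norm_le_iff_of_nonneg zero_le_one]
  intro i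
  rw [Real.norm_eq_abs, abs_of_nonneg (hs.1 i)]
  exact corner_coord_le hs i

theorem isCompact_corner (n : ℕ) : IsCompact (corner n) :=
  (isCompact_closedBall _ _).of_isClosed_subset (isClosed_corner n) (corner_subset_closedBall n)

theorem measurableSet_corner (n : ℕ) : MeasurableSet (corner n) := (isClosed_corner n).measurableSet

theorem convex_corner (n : ℕ) : Convex ℝ (corner n) := by
  intro s hs t ht a b ha hb hab
  refine ⟨fun i => ?_, ?_⟩
  · exact add_nonneg (mul_nonneg ha (hs.1 i)) (mul_nonneg hb (ht.1 i))
  · simp only [Pi.add_apply, Pi.smul_apply, smul_eq_mul, Finset.sum_add_distrib, ← Finset.mul_sum]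
    nlinarith [hs.2, ht.2]

instance isFiniteMeasure_restrict_corner (n : ℕ) :
    IsFiniteMeasure (volume.restrict (corner n)) :=
  isFiniteMeasure_restrict.2 (isCompact_corner n).measure_lt_top.ne

theorem zero_mem_corner (n : ℕ) : (0 : Fin n → ℝ) ∈ corner n := by simp [corner]

/-- The frontier of a convex set is null. Derivatives at interior points see only values on the
corner, which is where pulled-back functions are controlled. -/
theorem ae_mem_interior_corner (n : ℕ) :
    ∀ᵐ s ∂(volume.restrict (corner n)), s ∈ interior (corner n) := by
  rw [ae_restrict_iff' (measurableSet_corner n)]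
  have h : ∀ᵐ s ∂(volume : Measure (Fin n → ℝ)), s ∉ frontier (corner n) :=
    measure_eq_zero_iff_ae_notMem.1 ((convex_corner n).addHaar_frontier volume)
  filter_upwards [h] with s hs hsc
  by_contra hi
  exact hs ⟨subset_closure hsc, hi⟩

theorem ae_corner_of_interior {P : (Fin n → ℝ) → Prop} (h : ∀ s ∈ interior (corner n), P s) :
    ∀ᵐ s ∂(volume.restrict (corner n)), P s :=
  (ae_mem_interior_corner n).mono h

theorem ae_corner_differentiableAt {g : (Fin n → ℝ) → ℝ} {L : ℝ≥0} (h : LipschitzWith L g) :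
    ∀ᵐ s ∂(volume.restrict (corner n)), DifferentiableAt ℝ g s :=
  ae_restrict_of_ae h.ae_differentiableAt

theorem jac_congr_corner {G G' : Fin n → (Fin n → ℝ) → ℝ} {s : Fin n → ℝ}
    (hs : s ∈ interior (corner n)) (h : ∀ i, Set.EqOn (G i) (G' i) (corner n)) :
    jac G s = jac G' s :=
  jac_congr fun i => Filter.eventually_of_mem (mem_interior_iff_mem_nhds.1 hs) (h i)

/-- Allows functions that are Lipschitz only on the corner to be exchanged for global Lipschitz
extensions. -/
theorem setIntegral_jac_congr {F F' : (Fin n → ℝ) → ℝ} {G G' : Fin n → (Fin n → ℝ) → ℝ}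
    (hF : Set.EqOn F F' (corner n)) (h : ∀ i, Set.EqOn (G i) (G' i) (corner n)) :
    ∫ s in corner n, F s * jac G s = ∫ s in corner n, F' s * jac G' s := by
  refine integral_congr_ae (ae_corner_of_interior fun s hs => ?_)
  simp only [jac_congr_corner hs h, hF (interior_subset hs)]

theorem abs_le_of_lipschitzOn_corner {F : (Fin n → ℝ) → ℝ} {L : ℝ≥0}
    (h : LipschitzOnWith L F (corner n)) {s : Fin n → ℝ} (hs : s ∈ corner n) :
    |F s| ≤ |F 0| + L := by
  have h1 := h.dist_le_mul s hs 0 (zero_mem_corner n)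
  have h2 : dist s 0 ≤ 1 := corner_subset_closedBall n hs
  rw [Real.dist_eq] at h1
  have h3 : |F s| ≤ |F 0| + |F s - F 0| := by
    have := abs_add_le (F 0) (F s - F 0)
    rwa [add_sub_cancel] at this
  nlinarith [L.coe_nonneg]

theorem integrable_mul_jac {F : (Fin n → ℝ) → ℝ} {G : Fin n → (Fin n → ℝ) → ℝ} {L : ℝ≥0}
    (hF : ContinuousOn F (corner n)) (hG : ∀ i, LipschitzWith L (G i)) :
    Integrable (fun s => F s * jac G s) (volume.restrict (corner n)) :=
  (hF.integrableOn_compact (isCompact_corner n)).mul_bdd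
    (measurable_jac G).aestronglyMeasurable (ae_of_all _ fun s => abs_jac_le_pow hG s)

/-- The easy, strong form of convergence: with gradients converging almost everywhere, dominated
convergence suffices. `JacContinuous` is the version without that assumption. -/
theorem tendsto_integral_mul_jac {F : ℕ → (Fin n → ℝ) → ℝ} {F₀ : (Fin n → ℝ) → ℝ}
    {G : ℕ → Fin n → (Fin n → ℝ) → ℝ} {G₀ : Fin n → (Fin n → ℝ) → ℝ} {L : ℝ≥0} {C : ℝ}
    (hF : ∀ m, ContinuousOn (F m) (corner n)) (hC : ∀ m, ∀ s ∈ corner n, |F m s| ≤ C)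
    (hFlim : ∀ s ∈ corner n, Tendsto (fun m => F m s) atTop (𝓝 (F₀ s)))
    (hG : ∀ m i, LipschitzWith L (G m i))
    (hGlim : ∀ i j, ∀ᵐ s ∂(volume.restrict (corner n)),
      Tendsto (fun m => partials (G m i) s j) atTop (𝓝 (partials (G₀ i) s j))) :
    Tendsto (fun m => ∫ s in corner n, F m s * jac (G m) s) atTop
      (𝓝 (∫ s in corner n, F₀ s * jac G₀ s)) := by
  refine tendsto_integral_of_dominated_convergence (fun _ => C * (n.factorial * (L : ℝ) ^ n))
    (fun m => ((hF m).aestronglyMeasurable (measurableSet_corner n)).mul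
      (measurable_jac (G m)).aestronglyMeasurable) (integrable_const _) (fun m => ?_) ?_
  · refine (ae_restrict_mem (measurableSet_corner n)).mono fun s hs => ?_
    rw [norm_mul]
    exact mul_le_mul (hC m s hs) (abs_jac_le_pow (hG m) s) (norm_nonneg _)
      ((abs_nonneg _).trans (hC m s hs))
  · filter_upwards [ae_restrict_mem (measurableSet_corner n),
      ae_all_iff.2 fun i => ae_all_iff.2 (hGlim i)] with s hs hs2
    exact (hFlim s hs).mul (tendsto_jac hs2)

end Corner

/-! ### Mollification of Lipschitz functions -/

section Mollify

open ContinuousLinearMap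

variable {n : ℕ}

/-- A sequence of smooth bumps shrinking to the origin. -/
noncomputable def shrinkingBump (n m : ℕ) : ContDiffBump (0 : Fin n → ℝ) where
  rIn := 1 / ((m : ℝ) + 1)
  -- The ratio of the radii stays equal to 2; the Lebesgue differentiation argument in
  -- `tendsto_partials_mollify` needs it bounded.
  rOut := 2 * (1 / ((m : ℝ) + 1))
  rIn_pos := Nat.one_div_pos_of_nat
  rIn_lt_rOut := by linarith [Nat.one_div_pos_of_nat (α := ℝ) (n := m)]

theorem tendsto_shrinkingBump_rOut (n : ℕ) :
    Tendsto (fun m => (shrinkingBump n m).rOut) atTop (𝓝 0) := by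
  have := (tendsto_one_div_add_atTop_nhds_zero_nat (𝕜 := ℝ)).const_mul 2
  rwa [mul_zero] at this

/-- Convolution with a shrinking bump. -/
noncomputable def mollify (g : (Fin n → ℝ) → ℝ) (m : ℕ) : (Fin n → ℝ) → ℝ :=
  convolution ((shrinkingBump n m).normed volume) g (lsmul ℝ ℝ) volume

theorem contDiff_mollify {g : (Fin n → ℝ) → ℝ} (hg : Continuous g) (m : ℕ) :
    ContDiff ℝ 2 (mollify g m) :=
  HasCompactSupport.contDiff_convolution_left (n := 2) _ (shrinkingBump n m).hasCompactSupport_normed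
    (shrinkingBump n m).contDiff_normed hg.locallyIntegrable

theorem integrable_mollify {g : (Fin n → ℝ) → ℝ} (hg : Continuous g) (m : ℕ) (x : Fin n → ℝ) :
    Integrable (fun t => (shrinkingBump n m).normed volume t * g (x - t)) volume :=
  ((shrinkingBump n m).continuous_normed.mul
    (hg.comp (continuous_const.sub continuous_id))).integrable_of_hasCompactSupport
    (shrinkingBump n m).hasCompactSupport_normed.mul_right

/-- A mollification averages translates with total weight one, so the Lipschitz constant does not
grow. -/
theorem lipschitzWith_mollify {g : (Fin n → ℝ) → ℝ} {L : ℝ≥0} (hg : LipschitzWith L g) (m : ℕ) :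
    LipschitzWith L (mollify g m) := by
  refine LipschitzWith.of_dist_le_mul fun x y => ?_
  rw [Real.dist_eq]
  change |(∫ t, (shrinkingBump n m).normed volume t * g (x - t)) -
    ∫ t, (shrinkingBump n m).normed volume t * g (y - t)| ≤ _
  rw [← integral_sub (integrable_mollify hg.continuous m x) (integrable_mollify hg.continuous m y)]
  have h1 : ∀ t, ‖(shrinkingBump n m).normed volume t * g (x - t) -
      (shrinkingBump n m).normed volume t * g (y - t)‖ ≤
      (shrinkingBump n m).normed volume t * (L * dist x y) := fun t => by
    rw [← mul_sub, norm_mul, Real.norm_of_nonneg ((shrinkingBump n m).nonneg_normed t)]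
    refine mul_le_mul_of_nonneg_left ?_ ((shrinkingBump n m).nonneg_normed t)
    have := hg.dist_le_mul (x - t) (y - t)
    rwa [dist_sub_right] at this
  have h2 := norm_integral_le_of_norm_le
    ((shrinkingBump n m).integrable_normed.mul_const (L * dist x y)) (ae_of_all _ h1)
  rwa [integral_mul_const, (shrinkingBump n m).integral_normed, one_mul] at h2

theorem tendsto_mollify {g : (Fin n → ℝ) → ℝ} (hg : Continuous g) (x : Fin n → ℝ) :
    Tendsto (fun m => mollify g m x) atTop (𝓝 (g x)) :=
  ContDiffBump.convolution_tendsto_right (tendsto_shrinkingBump_rOut n)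
    (Eventually.of_forall fun _ => hg.aestronglyMeasurable)
    ((hg.tendsto x).comp tendsto_snd) tendsto_const_nhds

/-- The derivative is put on `g` instead of the bump: by Rademacher `g` is differentiable at `x - t`
for almost every `t`, and the Lipschitz bound dominates the difference quotients. -/
theorem hasFDerivAt_mollify {g : (Fin n → ℝ) → ℝ} {L : ℝ≥0} (hg : LipschitzWith L g) (m : ℕ)
    (x : Fin n → ℝ) :
    HasFDerivAt (mollify g m) (convolution ((shrinkingBump n m).normed volume) (fderiv ℝ g)
      (lsmul ℝ ℝ) volume x) x := by
  refine (hasFDerivAt_integral_of_dominated_loc_of_lip (𝕜 := ℝ) (s := Set.univ)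
    (bound := fun t => (shrinkingBump n m).normed volume t * L)
    (F := fun x t => (shrinkingBump n m).normed volume t * g (x - t))
    (F' := fun t => (shrinkingBump n m).normed volume t • fderiv ℝ g (x - t)) univ_mem
    (Eventually.of_forall fun y => (integrable_mollify hg.continuous m y).aestronglyMeasurable)
    (integrable_mollify hg.continuous m x) ?_ ?_
    ((shrinkingBump n m).integrable_normed.mul_const _) ?_).2
  · exact (shrinkingBump n m).continuous_normed.aestronglyMeasurable.smul
      ((measurable_fderiv ℝ g).comp (measurable_const.sub measurable_id)).aestronglyMeasurable
  · refine ae_of_all _ fun t => (LipschitzWith.of_dist_le_mul fun y z => ?_).lipschitzOnWith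
    have h0 := (shrinkingBump n m).nonneg_normed (μ := volume) t
    rw [Real.dist_eq, ← mul_sub, abs_mul, abs_of_nonneg h0, Real.coe_nnabs,
      abs_of_nonneg (mul_nonneg h0 L.coe_nonneg), mul_assoc]
    refine mul_le_mul_of_nonneg_left ?_ h0
    have := hg.dist_le_mul (y - t) (z - t)
    rwa [dist_sub_right] at this
  · have h1 : ∀ᵐ t ∂(volume : Measure (Fin n → ℝ)), DifferentiableAt ℝ g (x - t) :=
      (quasiMeasurePreserving_sub_left_of_right_invariant volume x).ae hg.ae_differentiableAt
    filter_upwards [h1] with t ht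
    have h2 : HasFDerivAt (fun y => g (y - t)) (fderiv ℝ g (x - t)) x := by
      have := ht.hasFDerivAt.comp x ((hasFDerivAt_id x).sub_const t)
      simpa using! this
    exact h2.const_mul _

/-- The gradient of the mollification is the mollified gradient, which converges almost everywhere
by Lebesgue differentiation, the gradient being bounded by `L`. -/
theorem tendsto_partials_mollify {g : (Fin n → ℝ) → ℝ} {L : ℝ≥0} (hg : LipschitzWith L g) :
    ∀ᵐ s ∂(volume : Measure (Fin n → ℝ)), ∀ j,
      Tendsto (fun m => partials (mollify g m) s j) atTop (𝓝 (partials g s j)) := by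
  have hloc : LocallyIntegrable (fderiv ℝ g) (volume : Measure (Fin n → ℝ)) := by
    refine (locallyIntegrable_const (L : ℝ)).mono (measurable_fderiv ℝ g).aestronglyMeasurable
      (ae_of_all _ fun s => ?_)
    rw [Real.norm_of_nonneg L.coe_nonneg]
    exact norm_fderiv_le_of_lipschitz ℝ hg
  have h1 := ContDiffBump.ae_convolution_tendsto_right_of_locallyIntegrable
    (φ := fun m => shrinkingBump n m) (K := 2) (tendsto_shrinkingBump_rOut n)
    (Eventually.of_forall fun m => le_rfl) hloc
  filter_upwards [h1] with s hs j
  have h2 : ∀ m, partials (mollify g m) s j = (convolution ((shrinkingBump n m).normed volume)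
      (fderiv ℝ g) (lsmul ℝ ℝ) volume s) (Pi.single j 1) := fun m => by
    unfold partials
    rw [(hasFDerivAt_mollify hg m s).fderiv]
  simp only [h2]
  exact ((ContinuousLinearMap.apply ℝ ℝ (Pi.single j (1 : ℝ) : Fin n → ℝ)).continuous.tendsto
    _).comp hs

end Mollify

/-! ### Integration over the coordinate simplex -/

section Fubini

variable {k : ℕ}

/-- The faces of `corner (k + 1)`, parametrized by `corner k`: the `0`-th one is `∑ i, s i = 1` and
the others are the coordinate faces. -/
def cornerFace (j : Fin (k + 2)) (t : Fin k → ℝ) : Fin (k + 1) → ℝ :=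
  Fin.cases (Fin.cons (1 - ∑ i, t i) t) (fun i => i.insertNth (0 : ℝ) t) j

@[simp] theorem cornerFace_zero (t : Fin k → ℝ) :
    cornerFace 0 t = Fin.cons (1 - ∑ i, t i) t := rfl

@[simp] theorem cornerFace_succ (i : Fin (k + 1)) (t : Fin k → ℝ) :
    cornerFace i.succ t = i.insertNth (0 : ℝ) t := rfl

theorem insertNth_mem_corner {i : Fin (k + 1)} {r : ℝ} {t : Fin k → ℝ} :
    i.insertNth r t ∈ corner (k + 1) ↔ t ∈ corner k ∧ r ∈ Set.Icc 0 (1 - ∑ l, t l) := by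
  have h1 : (∀ j, 0 ≤ (i.insertNth r t : Fin (k + 1) → ℝ) j) ↔ 0 ≤ r ∧ ∀ l, 0 ≤ t l := by
    rw [Fin.forall_iff_succAbove i]
    simp
  simp only [corner, Set.mem_ofPred_eq, h1, Fin.sum_univ_succAbove _ i, Fin.insertNth_apply_same,
    Fin.insertNth_apply_succAbove, Set.mem_Icc]
  constructor
  · rintro ⟨⟨h2, h3⟩, h4⟩
    exact ⟨⟨h3, by linarith⟩, h2, by linarith⟩
  · rintro ⟨⟨h2, h3⟩, h4, h5⟩
    exact ⟨⟨h4, h2⟩, by linarith⟩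

theorem cornerFace_mem_corner (j : Fin (k + 2)) {t : Fin k → ℝ} (ht : t ∈ corner k) :
    cornerFace j t ∈ corner (k + 1) := by
  have h1 : 0 ≤ 1 - ∑ l, t l := by linarith [ht.2]
  refine Fin.cases ?_ (fun i => ?_) j
  · rw [cornerFace_zero, ← Fin.insertNth_zero']
    exact insertNth_mem_corner.2 ⟨ht, h1, le_rfl⟩
  · exact insertNth_mem_corner.2 ⟨ht, le_rfl, h1⟩

/-- Fubini with coordinate `i` innermost: over `t` in the smaller corner the slice is a segment from
the face `s_i = 0` to the slanted face. -/
theorem setIntegral_corner_succ (i : Fin (k + 1)) {h : (Fin (k + 1) → ℝ) → ℝ}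
    (hh : IntegrableOn h (corner (k + 1))) :
    ∫ s in corner (k + 1), h s =
      ∫ t in corner k, ∫ r in (0 : ℝ)..(1 - ∑ l, t l), h (i.insertNth r t) := by
  have hmp := (volume_preserving_piFinSuccAbove (fun _ : Fin (k + 1) => ℝ) i).symm
  have hint := (integrable_indicator_iff (measurableSet_corner (k + 1))).2 hh
  rw [← integral_indicator (measurableSet_corner _), ← hmp.integral_comp', Measure.volume_eq_prod,
    integral_prod_symm (fun z : ℝ × (Fin k → ℝ) => (corner (k + 1)).indicator h
      ((MeasurableEquiv.piFinSuccAbove (fun _ => ℝ) i).symm z)) ((hmp.integrable_comp_emb (MeasurableEquiv.measurableEmbedding _)).2 hint),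
    ← integral_indicator (measurableSet_corner _)]
  congr 1
  funext t
  change ∫ r : ℝ, (corner (k + 1)).indicator h (i.insertNth r t) = _
  by_cases ht : t ∈ corner k
  · rw [Set.indicator_of_mem ht, intervalIntegral.integral_of_le (by linarith [ht.2]),
      ← integral_Icc_eq_integral_Ioc, ← integral_indicator measurableSet_Icc]
    congr 1
    funext r
    by_cases hr : r ∈ Set.Icc 0 (1 - ∑ l, t l)
    · rw [Set.indicator_of_mem hr, Set.indicator_of_mem (insertNth_mem_corner.2 ⟨ht, hr⟩)]
    · rw [Set.indicator_of_notMem hr,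
        Set.indicator_of_notMem fun h' => hr (insertNth_mem_corner.1 h').2]
  · rw [Set.indicator_of_notMem ht]
    refine integral_eq_zero_of_ae (ae_of_all _ fun r => ?_)
    exact Set.indicator_of_notMem (fun h' => ht (insertNth_mem_corner.1 h').1) _

/-- The affine symmetry of `corner k` that exchanges the vertices `0` and `i + 1`. -/
def cornerReflect (i : Fin k) (t : Fin k → ℝ) : Fin k → ℝ := Function.update t i (1 - ∑ l, t l)

theorem sum_cornerReflect (i : Fin k) (t : Fin k → ℝ) : ∑ l, cornerReflect i t l = 1 - t i := by
  have h1 := Finset.sum_update_of_mem (Finset.mem_univ i) t (1 - ∑ l, t l)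
  have h2 := Finset.sum_sdiff_eq_sub (Finset.subset_univ {i}) (f := t)
  rw [Finset.sum_singleton] at h2
  unfold cornerReflect
  rw [h1, h2]
  ring

theorem cornerReflect_cornerReflect (i : Fin k) (t : Fin k → ℝ) :
    cornerReflect i (cornerReflect i t) = t := by
  rw [cornerReflect, sum_cornerReflect]
  simp [cornerReflect]

theorem cornerReflect_mem {i : Fin k} {t : Fin k → ℝ} (ht : t ∈ corner k) :
    cornerReflect i t ∈ corner k := by
  refine ⟨fun l => ?_, ?_⟩
  · by_cases hl : l = i
    · subst hl
      simpa [cornerReflect] using ht.2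
    · simpa [cornerReflect, hl] using ht.1 l
  · rw [sum_cornerReflect]
    linarith [ht.1 i]

/-- The map is affine: its linear part is the identity with row `i` replaced by `-1`s, of
determinant `-1`, followed by translation by the `i`-th basis vector. -/
theorem measurePreserving_cornerReflect (i : Fin k) :
    MeasurePreserving (cornerReflect i) (volume : Measure (Fin k → ℝ)) volume := by
  let M : Matrix (Fin k) (Fin k) ℝ := (1 : Matrix (Fin k) (Fin k) ℝ).updateRow i fun _ => -1
  have hdet : M.det = -1 := by
    -- By Cramer's rule the identity with one column replaced by `b` has the corresponding entry of
    -- `b` as its determinant.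
    rw [← Matrix.det_transpose, ← Matrix.updateCol_transpose, Matrix.transpose_one,
      ← Matrix.cramer_apply, Matrix.cramer_one]
    simp
  have h1 : MeasurePreserving (Matrix.toLin' M) (volume : Measure (Fin k → ℝ)) volume := by
    refine ⟨(LinearMap.continuous_of_finiteDimensional _).measurable, ?_⟩
    rw [Real.map_matrix_volume_pi_eq_smul_volume_pi (by rw [hdet]; norm_num), hdet]
    simp
  have h2 := (measurePreserving_add_right volume (Pi.single i 1 : Fin k → ℝ)).comp h1
  convert h2 using 1
  funext t
  funext l
  change _ = Matrix.mulVec M t l + (Pi.single i 1 : Fin k → ℝ) l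
  by_cases hl : l = i
  · subst hl
    simp [cornerReflect, M, Matrix.mulVec, dotProduct]
    ring
  · simp [cornerReflect, M, Matrix.mulVec, dotProduct, hl, Matrix.one_apply]

theorem setIntegral_cornerReflect (i : Fin k) (h : (Fin k → ℝ) → ℝ) :
    ∫ t in corner k, h (cornerReflect i t) = ∫ t in corner k, h t := by
  have hinv : Function.Involutive (cornerReflect i) := cornerReflect_cornerReflect i
  have hemb : MeasurableEmbedding (cornerReflect i) :=
    (MeasurableEquiv.mk hinv.toPerm (measurePreserving_cornerReflect i).measurable
      (measurePreserving_cornerReflect i).measurable).measurableEmbedding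
  have h1 := (measurePreserving_cornerReflect i).setIntegral_preimage_emb hemb h (corner k)
  have h2 : cornerReflect i ⁻¹' corner k = corner k := by
    ext t
    refine ⟨fun ht => ?_, cornerReflect_mem⟩
    rw [← hinv t]
    exact cornerReflect_mem ht
  rwa [h2] at h1

/-- The upper ends of the segments in direction `i` parametrize the slanted face with coordinate `i`
omitted, whereas `cornerFace 0` omits coordinate `0`. Passing from one omitted coordinate to the
next is precomposition with a reflection of the corner, which preserves volume. -/
theorem setIntegral_insertNth_top (i : Fin (k + 1)) (h : (Fin (k + 1) → ℝ) → ℝ) :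
    ∫ t in corner k, h (i.insertNth (1 - ∑ l, t l) t) = ∫ t in corner k, h (cornerFace 0 t) := by
  cases k with
  | zero =>
    obtain rfl : i = 0 := by lia
    simp
  | succ k =>
    induction i using Fin.induction with
    | zero => simp
    | succ i ih =>
      rw [← ih, ← setIntegral_cornerReflect i]
      congr 1
      funext t
      congr 1
      rw [sum_cornerReflect]
      funext l
      refine Fin.succAboveCases i.succ ?_ (fun m => ?_) l
      · rw [Fin.insertNth_apply_same]
        have : i.succ = i.castSucc.succAbove i := by simp
        conv_rhs => rw [this]
        rw [Fin.insertNth_apply_succAbove]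
        ring
      · rw [Fin.insertNth_apply_succAbove]
        by_cases hm : m = i
        · subst hm
          have : m.succ.succAbove m = m.castSucc := by simp
          rw [this, Fin.insertNth_apply_same]
          simp [cornerReflect]
        · have : i.succ.succAbove m = i.castSucc.succAbove m := by
            have : (m : ℕ) ≠ i := fun h => hm (Fin.ext h)
            simp only [Fin.succAbove, Fin.lt_def, Fin.ext_iff, Fin.val_castSucc, Fin.val_succ]
            split_ifs <;> simp <;> omega
          rw [this, Fin.insertNth_apply_succAbove]
          simp [cornerReflect, hm]

theorem hasDerivAt_insertNth (i : Fin (k + 1)) (t : Fin k → ℝ) (r : ℝ) :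
    HasDerivAt (fun r => (i.insertNth r t : Fin (k + 1) → ℝ)) (Pi.single i 1) r := by
  refine hasDerivAt_pi.2 fun l => ?_
  refine Fin.succAboveCases i ?_ (fun m => ?_) l
  · simpa using hasDerivAt_id' r
  · simpa using hasDerivAt_const r (t m)

/-- The divergence theorem on `corner (k + 1)` for one partial derivative. -/
theorem setIntegral_partials_corner {W : (Fin (k + 1) → ℝ) → ℝ} (hW : ContDiff ℝ 1 W)
    (i : Fin (k + 1)) :
    ∫ s in corner (k + 1), partials W s i =
      (∫ t in corner k, W (cornerFace 0 t)) - ∫ t in corner k, W (cornerFace i.succ t) := by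
  have hc : Continuous fun s => partials W s i :=
    (hW.continuous_fderiv one_ne_zero).clm_apply continuous_const
  have hins : ∀ r : (Fin k → ℝ) → ℝ, Continuous r →
      Continuous fun t : Fin k → ℝ => (i.insertNth (r t) t : Fin (k + 1) → ℝ) := fun r hr => by
    refine continuous_pi fun l => ?_
    refine Fin.succAboveCases i ?_ (fun m => ?_) l
    · simpa using hr
    · simpa using continuous_apply m
  rw [setIntegral_corner_succ i (hc.continuousOn.integrableOn_compact (isCompact_corner _)),
    ← setIntegral_insertNth_top i W, ← integral_sub]
  · refine integral_congr_ae (ae_of_all _ fun t => ?_)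
    have hd : ∀ r : ℝ, HasDerivAt (fun r => W (i.insertNth r t)) (partials W (i.insertNth r t) i) r :=
      fun r => (hW.differentiable one_ne_zero _).hasFDerivAt.comp_hasDerivAt r
        (hasDerivAt_insertNth i t r)
    refine intervalIntegral.integral_eq_sub_of_hasDerivAt (fun r _ => hd r) ?_
    exact (hc.comp (continuous_iff_continuousAt.2 fun r =>
      (hasDerivAt_insertNth i t r).continuousAt)).intervalIntegrable _ _
  · exact (hW.continuous.comp (hins _ (by fun_prop))).continuousOn.integrableOn_compact
      (isCompact_corner _)
  · exact (hW.continuous.comp (hins _ continuous_const)).continuousOn.integrableOn_compact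
      (isCompact_corner _)

end Fubini

/-! ### Stokes' theorem for smooth functions on the coordinate simplex -/

section Cofactor

variable {k : ℕ}

theorem det_cons_single (P : Fin k → Fin (k + 1) → ℝ) (j : Fin (k + 1)) :
    Matrix.det (Matrix.of (Fin.cons (Pi.single j 1) P : Fin (k + 1) → Fin (k + 1) → ℝ)) =
      (-1) ^ (j : ℕ) * Matrix.det (Matrix.of fun i l => P i (j.succAbove l)) := by
  rw [Matrix.det_succ_row_zero, Finset.sum_eq_single j]
  · simp only [Matrix.of_apply, Fin.cons_zero, Pi.single_eq_same, mul_one]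
    congr 1
  · intro l _ hl
    simp [Pi.single_eq_of_ne hl]
  · simp

theorem det_cons_eq_sum (a : Fin (k + 1) → ℝ) (P : Fin k → Fin (k + 1) → ℝ) :
    Matrix.det (Matrix.of (Fin.cons a P : Fin (k + 1) → Fin (k + 1) → ℝ)) =
      ∑ j, a j * Matrix.det (Matrix.of
        (Fin.cons (Pi.single j 1) P : Fin (k + 1) → Fin (k + 1) → ℝ)) := by
  simp only [det_cons_single]
  rw [Matrix.det_succ_row_zero]
  refine Finset.sum_congr rfl fun j _ => ?_
  simp only [Matrix.of_apply, Fin.cons_zero]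
  rw [mul_left_comm, mul_assoc]
  rfl

/-- By linearity the sum is the determinant with first row `(1, …, 1)`; subtracting column `0` from
the others turns that row into `(1, 0, …, 0)`. Geometrically, this is the flux through the slanted
face, with normal `(1, …, 1)`. -/
theorem sum_det_cons_single (P : Fin k → Fin (k + 1) → ℝ) :
    ∑ j, Matrix.det (Matrix.of
        (Fin.cons (Pi.single j 1) P : Fin (k + 1) → Fin (k + 1) → ℝ)) =
      Matrix.det (Matrix.of fun i l => P i l.succ - P i 0) := by
  have h1 := det_cons_eq_sum 1 P
  simp only [Pi.one_apply, one_mul] at h1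
  rw [← h1]
  let Q : Fin k → Fin (k + 1) → ℝ := fun i => Fin.cons (P i 0) fun l => P i l.succ - P i 0
  have h2 := det_cons_single Q 0
  rw [Fin.val_zero, pow_zero, one_mul] at h2
  simp only [Fin.zero_succAbove, Q, Fin.cons_succ] at h2
  rw [← h2, ← Matrix.det_transpose, ← Matrix.det_transpose (Matrix.of _)]
  -- The multipliers `(0, 1, …, 1)` add column `0` once to every other column of the matrix built
  -- from `Q`.
  refine Matrix.det_eq_of_forall_row_eq_smul_add_const (Fin.cons 0 1) 0 rfl fun i j => ?_
  simp only [Matrix.transpose_apply, Matrix.of_apply]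
  refine Fin.cases ?_ (fun j => ?_) j <;> refine Fin.cases ?_ (fun i => ?_) i <;> simp

theorem det_cons_update_swap (P : Fin k → Fin (k + 1) → ℝ) (i : Fin k) (a b : Fin (k + 1) → ℝ) :
    Matrix.det (Matrix.of
      (Fin.cons a (Function.update P i b) : Fin (k + 1) → Fin (k + 1) → ℝ)) =
    -Matrix.det (Matrix.of
      (Fin.cons b (Function.update P i a) : Fin (k + 1) → Fin (k + 1) → ℝ)) := by
  have h := (Matrix.detRowAlternating (R := ℝ) (n := Fin (k + 1))).map_swap
    (Fin.cons b (Function.update P i a)) (Fin.succ_ne_zero i).symm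
  refine Eq.trans ?_ h
  change Matrix.detRowAlternating _ = _
  congr 1
  funext l
  rw [Function.comp_apply]
  refine Fin.cases ?_ (fun l => ?_) l
  · rw [Equiv.swap_apply_left]
    exact (Function.update_self i a P).symm
  · by_cases hl : l = i
    · subst hl
      rw [Equiv.swap_apply_right]
      exact Function.update_self l b P
    · rw [Equiv.swap_apply_of_ne_of_ne (Fin.succ_ne_zero l) fun h => hl (Fin.succ_injective _ h)]
      exact (Function.update_of_ne hl b P).trans (Function.update_of_ne hl a P).symm

/-- Expanding `H j` in basis vectors contracts the symmetric `H` with a determinant antisymmetric in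
its two distinguished rows. -/
theorem sum_det_cons_update_symm (P : Fin k → Fin (k + 1) → ℝ) (i : Fin k)
    (H : Fin (k + 1) → Fin (k + 1) → ℝ) (hH : ∀ j l, H j l = H l j) :
    ∑ j, Matrix.det (Matrix.of (Fin.cons (Pi.single j 1) (Function.update P i (H j)) :
      Fin (k + 1) → Fin (k + 1) → ℝ)) = 0 := by
  have h1 : ∀ j, Matrix.det (Matrix.of (Fin.cons (Pi.single j 1) (Function.update P i (H j)) :
      Fin (k + 1) → Fin (k + 1) → ℝ)) = -∑ l, H j l * Matrix.det (Matrix.of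
        (Fin.cons (Pi.single l 1) (Function.update P i (Pi.single j 1)) :
          Fin (k + 1) → Fin (k + 1) → ℝ)) := fun j => by
    rw [det_cons_update_swap, det_cons_eq_sum]
  have h2 : ∀ j, Matrix.det (Matrix.of (Fin.cons (Pi.single j 1) (Function.update P i (H j)) :
      Fin (k + 1) → Fin (k + 1) → ℝ)) = ∑ l, H j l * Matrix.det (Matrix.of
        (Fin.cons (Pi.single j 1) (Function.update P i (Pi.single l 1)) :
          Fin (k + 1) → Fin (k + 1) → ℝ)) := fun j => by
    rw [h1, ← Finset.sum_neg_distrib]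
    refine Finset.sum_congr rfl fun l _ => ?_
    rw [det_cons_update_swap P i (Pi.single j 1), mul_neg]
  -- Renaming `j` and `l` identifies the sum with its own negative.
  refine self_eq_neg.1 ?_
  conv_rhs => rw [Finset.sum_congr rfl fun j _ => h1 j, Finset.sum_neg_distrib, neg_neg,
    Finset.sum_comm]
  rw [Finset.sum_congr rfl fun j _ => h2 j]
  simp only [hH]

end Cofactor

/-! ### Divergence-free cofactors, restriction to faces, and Stokes' theorem for smooth functions -/

section SmoothStokes

variable {k : ℕ}

/-- The cofactor of the `j`-th entry in an additional first row of the Jacobian matrix. -/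
noncomputable def cofactor (p : Fin k → (Fin (k + 1) → ℝ) → ℝ) (j : Fin (k + 1))
    (s : Fin (k + 1) → ℝ) : ℝ :=
  Matrix.det (Matrix.of (Fin.cons (Pi.single j 1) (fun i => partials (p i) s) :
    Fin (k + 1) → Fin (k + 1) → ℝ))

theorem jac_cons (f : (Fin (k + 1) → ℝ) → ℝ) (p : Fin k → (Fin (k + 1) → ℝ) → ℝ)
    (s : Fin (k + 1) → ℝ) :
    jac (Fin.cons f p : Fin (k + 1) → (Fin (k + 1) → ℝ) → ℝ) s =
      Matrix.det (Matrix.of (Fin.cons (partials f s) (fun i => partials (p i) s) :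
        Fin (k + 1) → Fin (k + 1) → ℝ)) := by
  unfold jac
  congr 2
  funext i
  refine Fin.cases rfl (fun i => rfl) i

theorem jac_cons_eq_sum (f : (Fin (k + 1) → ℝ) → ℝ) (p : Fin k → (Fin (k + 1) → ℝ) → ℝ)
    (s : Fin (k + 1) → ℝ) :
    jac (Fin.cons f p : Fin (k + 1) → (Fin (k + 1) → ℝ) → ℝ) s =
      ∑ j, partials f s j * cofactor p j s := by
  rw [jac_cons, det_cons_eq_sum]
  rfl

theorem contDiff_partials {n : ℕ} {g : (Fin n → ℝ) → ℝ} (hg : ContDiff ℝ 2 g) :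
    ContDiff ℝ 1 (partials g) :=
  contDiff_pi.2 fun _ => (hg.fderiv_right (m := 1) (by norm_num)).clm_apply contDiff_const

theorem fderiv_partials_symm {n : ℕ} {g : (Fin n → ℝ) → ℝ} (hg : ContDiff ℝ 2 g) (s : Fin n → ℝ)
    (j l : Fin n) :
    fderiv ℝ (partials g) s (Pi.single j 1) l = fderiv ℝ (partials g) s (Pi.single l 1) j := by
  have hd : Differentiable ℝ (fderiv ℝ g) :=
    (hg.fderiv_right (m := 1) (by norm_num)).differentiable one_ne_zero
  have h1 : ∀ v l, fderiv ℝ (partials g) s v l = fderiv ℝ (fderiv ℝ g) s v (Pi.single l 1) := by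
    intro v l
    have h2 : HasFDerivAt (fun s => fderiv ℝ g s (Pi.single l (1 : ℝ)))
        ((fderiv ℝ (fderiv ℝ g) s).flip (Pi.single l 1)) s := by
      simpa using! (hd s).hasFDerivAt.clm_apply (hasFDerivAt_const (Pi.single l (1 : ℝ)) s)
    have h3 := hasFDerivAt_pi'.1
      ((contDiff_partials hg).differentiable one_ne_zero s).hasFDerivAt l
    have h4 := h3.unique h2
    exact congrArg (fun A => A v) h4
  rw [h1, h1]
  exact second_derivative_symmetric
    (fun y => (hg.differentiable two_ne_zero y).hasFDerivAt) (hd s).hasFDerivAt _ _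

/-- The determinant as a continuous multilinear function of the rows. -/
noncomputable def detCont (n : ℕ) : ContinuousMultilinearMap ℝ (fun _ : Fin n => Fin n → ℝ) ℝ where
  toMultilinearMap := (Matrix.detRowAlternating (R := ℝ) (n := Fin n)).toMultilinearMap
  cont := (continuous_id (X := Matrix (Fin n) (Fin n) ℝ)).matrix_det

theorem detCont_apply {n : ℕ} (M : Fin n → Fin n → ℝ) :
    detCont n M = Matrix.det (Matrix.of M) := rfl

theorem contDiff_cofactor {p : Fin k → (Fin (k + 1) → ℝ) → ℝ} (hp : ∀ i, ContDiff ℝ 2 (p i))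
    (j : Fin (k + 1)) : ContDiff ℝ 1 (cofactor p j) := by
  refine (detCont (k + 1)).contDiff.comp (contDiff_pi.2 fun i => ?_)
  refine Fin.cases ?_ (fun i => ?_) i
  · exact contDiff_const
  · exact contDiff_partials (hp i)

/-- The Piola identity. Differentiating the determinant row by row, row `i` contributes the Hessian
of `p i` contracted antisymmetrically, which vanishes by symmetry of second derivatives. -/
theorem sum_partials_cofactor {p : Fin k → (Fin (k + 1) → ℝ) → ℝ} (hp : ∀ i, ContDiff ℝ 2 (p i))
    (s : Fin (k + 1) → ℝ) : ∑ j, partials (cofactor p j) s j = 0 := by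
  have h1 : ∀ j, partials (cofactor p j) s j = ∑ i, Matrix.det (Matrix.of
      (Fin.cons (Pi.single j 1) (Function.update (fun i => partials (p i) s) i
        (fderiv ℝ (partials (p i)) s (Pi.single j 1))) : Fin (k + 1) → Fin (k + 1) → ℝ)) := by
    intro j
    have h2 := HasFDerivAt.multilinear_comp (detCont (k + 1))
      (g := fun i t => (Fin.cons (Pi.single j 1) (fun i => partials (p i) t) :
        Fin (k + 1) → Fin (k + 1) → ℝ) i)
      (g' := Fin.cons 0 fun i => fderiv ℝ (partials (p i)) s) (x := s) (fun i => by
        refine Fin.cases ?_ (fun i => ?_) i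
        · exact hasFDerivAt_const _ _
        · exact ((contDiff_partials (hp i)).differentiable one_ne_zero s).hasFDerivAt)
    unfold partials
    rw [HasFDerivAt.fderiv (f := cofactor p j) h2, Fin.sum_univ_succ]
    simp only [_root_.add_apply, _root_.sum_apply,
      ContinuousLinearMap.comp_apply, Fin.cons_zero, Fin.cons_succ, _root_.zero_apply,
      map_zero, zero_add]
    refine Finset.sum_congr rfl fun i _ => ?_
    rw [ContinuousMultilinearMap.toContinuousLinearMap_apply, detCont_apply, Fin.cons_update]
    rfl
  rw [Finset.sum_congr rfl fun j _ => h1 j, Finset.sum_comm]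
  exact Finset.sum_eq_zero fun i _ => sum_det_cons_update_symm _ i _
    fun j l => fderiv_partials_symm (hp i) s j l

/-- The linear part of `cornerFace j`. -/
noncomputable def cornerFaceLinear (j : Fin (k + 2)) : (Fin k → ℝ) →L[ℝ] (Fin (k + 1) → ℝ) :=
  ContinuousLinearMap.pi (Fin.cases
    (Fin.cons (-∑ l, ContinuousLinearMap.proj l) fun l => ContinuousLinearMap.proj l)
    (fun i => i.insertNth (α := fun _ => (Fin k → ℝ) →L[ℝ] ℝ) 0
      fun l => ContinuousLinearMap.proj l) j :
    Fin (k + 1) → (Fin k → ℝ) →L[ℝ] ℝ)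

theorem hasFDerivAt_cornerFace (j : Fin (k + 2)) (t : Fin k → ℝ) :
    HasFDerivAt (cornerFace j) (cornerFaceLinear j) t := by
  refine hasFDerivAt_pi.2 fun l => ?_
  have hp : ∀ l : Fin k, HasFDerivAt (fun t : Fin k → ℝ => t l) (ContinuousLinearMap.proj l) t :=
    fun l => (ContinuousLinearMap.proj (R := ℝ) (φ := fun _ : Fin k => ℝ) l).hasFDerivAt
  refine Fin.cases ?_ (fun i => ?_) j
  · refine Fin.cases ?_ (fun l => ?_) l
    · exact (HasFDerivAt.fun_sum fun l _ => hp l).const_sub 1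
    · exact hp l
  · refine Fin.succAboveCases i ?_ (fun l => ?_) l
    · simpa using hasFDerivAt_const (0 : ℝ) t
    · simpa using hp l

theorem exists_lipschitzWith_cornerFace (j : Fin (k + 2)) :
    ∃ K : ℝ≥0, LipschitzWith K (cornerFace j : (Fin k → ℝ) → _) :=
  ⟨‖cornerFaceLinear j‖₊, lipschitzWith_of_nnnorm_fderiv_le
    (fun t => (hasFDerivAt_cornerFace j t).differentiableAt)
    fun t => by rw [(hasFDerivAt_cornerFace j t).fderiv]⟩

theorem continuous_cornerFace (j : Fin (k + 2)) :
    Continuous (cornerFace j : (Fin k → ℝ) → _) :=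
  let ⟨_, hK⟩ := exists_lipschitzWith_cornerFace j
  hK.continuous

/-- Chain rule: moving along `t_l` on the slanted face raises coordinate `l + 1` and lowers
coordinate `0` at the same rate. -/
theorem partials_comp_cornerFace_zero {g : (Fin (k + 1) → ℝ) → ℝ} {t : Fin k → ℝ}
    (hg : DifferentiableAt ℝ g (cornerFace 0 t)) (l : Fin k) :
    partials (fun t => g (cornerFace 0 t)) t l =
      partials g (cornerFace 0 t) l.succ - partials g (cornerFace 0 t) 0 := by
  unfold partials
  rw [HasFDerivAt.fderiv (f := fun t => g (cornerFace 0 t))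
    (hg.hasFDerivAt.comp t (hasFDerivAt_cornerFace 0 t)), ContinuousLinearMap.comp_apply,
    ← map_sub]
  congr 1
  funext m
  refine Fin.cases ?_ (fun m => ?_) m
  · simp [cornerFaceLinear, Pi.single_apply]
  · simp [cornerFaceLinear, Pi.single_apply]

theorem partials_comp_cornerFace_succ {g : (Fin (k + 1) → ℝ) → ℝ} {t : Fin k → ℝ}
    {i : Fin (k + 1)} (hg : DifferentiableAt ℝ g (cornerFace i.succ t)) (l : Fin k) :
    partials (fun t => g (cornerFace i.succ t)) t l =
      partials g (cornerFace i.succ t) (i.succAbove l) := by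
  unfold partials
  rw [HasFDerivAt.fderiv (f := fun t => g (cornerFace i.succ t))
    (hg.hasFDerivAt.comp t (hasFDerivAt_cornerFace i.succ t)),
    ContinuousLinearMap.comp_apply]
  congr 1
  funext m
  refine Fin.succAboveCases i ?_ (fun m => ?_) m
  · simp [cornerFaceLinear]
  · simp [cornerFaceLinear, Pi.single_apply]

theorem sum_cofactor_cornerFace_zero {p : Fin k → (Fin (k + 1) → ℝ) → ℝ}
    (hp : ∀ i, Differentiable ℝ (p i)) (t : Fin k → ℝ) :
    ∑ j, cofactor p j (cornerFace 0 t) = jac (fun i t => p i (cornerFace 0 t)) t := by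
  unfold cofactor jac
  rw [sum_det_cons_single]
  congr 1
  ext i l
  exact (partials_comp_cornerFace_zero (hp i _) l).symm

theorem cofactor_cornerFace_succ {p : Fin k → (Fin (k + 1) → ℝ) → ℝ}
    (hp : ∀ i, Differentiable ℝ (p i)) (j : Fin (k + 1)) (t : Fin k → ℝ) :
    cofactor p j (cornerFace j.succ t) =
      (-1) ^ (j : ℕ) * jac (fun i t => p i (cornerFace j.succ t)) t := by
  unfold cofactor jac
  rw [det_cons_single]
  congr 2
  ext i l
  exact (partials_comp_cornerFace_succ (hp i _) l).symm

/-- Since the cofactors are divergence-free, the integrand is the divergence of the field `V` with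
components `f` times a cofactor; integrate each partial derivative by `setIntegral_partials_corner`.
-/
theorem stokes_smooth {f : (Fin (k + 1) → ℝ) → ℝ} {p : Fin k → (Fin (k + 1) → ℝ) → ℝ}
    (hf : ContDiff ℝ 1 f) (hp : ∀ i, ContDiff ℝ 2 (p i)) :
    ∫ s in corner (k + 1), jac (Fin.cons f p : Fin (k + 1) → (Fin (k + 1) → ℝ) → ℝ) s =
      ∑ j : Fin (k + 2), (-1) ^ (j : ℕ) *
        ∫ t in corner k, f (cornerFace j t) * jac (fun i t => p i (cornerFace j t)) t := by
  have hpd : ∀ i, Differentiable ℝ (p i) := fun i => (hp i).differentiable two_ne_zero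
  let V : Fin (k + 1) → (Fin (k + 1) → ℝ) → ℝ := fun j s => f s * cofactor p j s
  have hV : ∀ j, ContDiff ℝ 1 (V j) := fun j => hf.mul (contDiff_cofactor hp j)
  have hcont : ∀ j l, Continuous fun s => partials (V j) s l := fun j l =>
    ((hV j).continuous_fderiv one_ne_zero).clm_apply continuous_const
  have hint : ∀ {n : ℕ} {h : (Fin n → ℝ) → ℝ}, Continuous h → IntegrableOn h (corner n) :=
    fun h => h.continuousOn.integrableOn_compact (isCompact_corner _)
  have h1 : ∀ s, jac (Fin.cons f p : Fin (k + 1) → (Fin (k + 1) → ℝ) → ℝ) s =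
      ∑ j, partials (V j) s j := fun s => by
    have h2 : ∀ j, partials (V j) s j =
        f s * partials (cofactor p j) s j + partials f s j * cofactor p j s := fun j => by
      rw [partials_mul (hf.differentiable one_ne_zero s)
        ((contDiff_cofactor hp j).differentiable one_ne_zero s)]
      simp [mul_comm]
    rw [jac_cons_eq_sum, Finset.sum_congr rfl fun j _ => h2 j, Finset.sum_add_distrib,
      ← Finset.mul_sum, sum_partials_cofactor hp, mul_zero, zero_add]
  simp only [h1]
  rw [integral_finsetSum _ fun j _ => hint (hcont j j),
    Finset.sum_congr rfl fun j _ => setIntegral_partials_corner (hV j) j, Finset.sum_sub_distrib,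
    Fin.sum_univ_succ (n := k + 1), ← integral_finsetSum (f := fun j t => V j (cornerFace 0 t)) _
      fun j _ => hint ((hV j).continuous.comp (continuous_cornerFace 0)), sub_eq_add_neg,
    ← Finset.sum_neg_distrib]
  congr 1
  -- On the slanted face all `k + 1` cofactors contribute and add up to the Jacobian of the
  -- restriction.
  · rw [Fin.val_zero, pow_zero, one_mul]
    congr 1
    funext t
    simp only [V, ← Finset.mul_sum]
    rw [sum_cofactor_cornerFace_zero hpd]
  -- On the face `s_j = 0` only the `j`-th cofactor contributes; the minus sign of a lower limit
  -- turns its `(-1)^j` into the sign of face number `j + 1`.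
  · refine Finset.sum_congr rfl fun j _ => ?_
    rw [← integral_neg, ← integral_const_mul]
    congr 1
    funext t
    simp only [V]
    rw [cofactor_cornerFace_succ hpd, Fin.val_succ, pow_succ]
    ring

end SmoothStokes

/-! ### Stokes' theorem for Lipschitz functions and weak continuity of Jacobians -/

section LipStokes

variable {n k : ℕ}

theorem lipschitzOnWith_mul_corner {f u : (Fin n → ℝ) → ℝ} {L : ℝ≥0}
    (hf : LipschitzOnWith L f (corner n)) (hu : LipschitzOnWith L u (corner n)) :
    ∃ K : ℝ≥0, LipschitzOnWith K (fun s => f s * u s) (corner n) := by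
  refine ⟨(‖f 0‖₊ + L) * L + (‖u 0‖₊ + L) * L, LipschitzOnWith.of_dist_le_mul fun s hs t ht => ?_⟩
  have h1 := hf.dist_le_mul s hs t ht
  have h2 := hu.dist_le_mul s hs t ht
  have h3 := abs_le_of_lipschitzOn_corner hf hs
  have h4 := abs_le_of_lipschitzOn_corner hu ht
  rw [Real.dist_eq] at h1 h2 ⊢
  have h5 : f s * u s - f t * u t = f s * (u s - u t) + u t * (f s - f t) := by ring
  rw [h5]
  refine (abs_add_le _ _).trans ?_
  rw [abs_mul, abs_mul]
  push_cast
  rw [add_mul, mul_assoc, mul_assoc _ (L : ℝ) (dist s t), Real.norm_eq_abs, Real.norm_eq_abs]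
  exact add_le_add (mul_le_mul h3 h2 (abs_nonneg _) (by positivity))
    (mul_le_mul h4 h1 (abs_nonneg _) (by positivity))

theorem exists_bound_of_tendsto {F : ℕ → (Fin n → ℝ) → ℝ} {a : ℝ} {L : ℝ≥0}
    (hF : ∀ m, LipschitzOnWith L (F m) (corner n))
    (h0 : Tendsto (fun m => F m 0) atTop (𝓝 a)) :
    ∃ C, ∀ m, ∀ s ∈ corner n, |F m s| ≤ C := by
  obtain ⟨C, hC⟩ := h0.abs.bddAbove_range
  exact ⟨C + L, fun m s hs => (abs_le_of_lipschitzOn_corner (hF m) hs).trans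
    (add_le_add_left (hC ⟨m, rfl⟩) _)⟩

/-- Only boundedness of the Jacobians is used: the undifferentiated factor supplies the convergence.
-/
theorem tendsto_integral_mul_jac_zero {W : ℕ → (Fin n → ℝ) → ℝ} {G : ℕ → Fin n → (Fin n → ℝ) → ℝ}
    {L : ℝ≥0} {C : ℝ} (hW : ∀ m, ContinuousOn (W m) (corner n))
    (hC : ∀ m, ∀ s ∈ corner n, |W m s| ≤ C)
    (hlim : ∀ s ∈ corner n, Tendsto (fun m => W m s) atTop (𝓝 0))
    (hG : ∀ m i, LipschitzWith L (G m i)) :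
    Tendsto (fun m => ∫ s in corner n, W m s * jac (G m) s) atTop (𝓝 0) := by
  have h0 : (0 : ℝ) = ∫ s in corner n, (0 : ℝ) := by simp
  rw [h0]
  refine tendsto_integral_of_dominated_convergence (fun _ => C * (n.factorial * (L : ℝ) ^ n))
    (fun m => ((hW m).aestronglyMeasurable (measurableSet_corner n)).mul
      (measurable_jac (G m)).aestronglyMeasurable) (integrable_const _) (fun m => ?_) ?_
  · refine (ae_restrict_mem (measurableSet_corner n)).mono fun s hs => ?_
    rw [norm_mul]
    exact mul_le_mul (hC m s hs) (abs_jac_le_pow (hG m) s) (norm_nonneg _)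
      ((abs_nonneg _).trans (hC m s hs))
  · refine (ae_restrict_mem (measurableSet_corner n)).mono fun s hs => ?_
    refine squeeze_zero_norm (a := fun m => |W m s| * (n.factorial * (L : ℝ) ^ n)) (fun m => ?_) ?_
    · rw [norm_mul]
      exact mul_le_mul_of_nonneg_left (abs_jac_le_pow (hG m) s) (abs_nonneg _)
    · have := (hlim s hs).abs.mul_const (n.factorial * (L : ℝ) ^ n)
      rwa [abs_zero, zero_mul] at this

/-- The Jacobian determinant is weakly continuous on `corner n`, tested with Lipschitz functions. -/
def JacContinuous (n : ℕ) : Prop :=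
  ∀ (F : (Fin n → ℝ) → ℝ) (K L : ℝ≥0) (G : ℕ → Fin n → (Fin n → ℝ) → ℝ)
    (G₀ : Fin n → (Fin n → ℝ) → ℝ), LipschitzOnWith K F (corner n) →
    (∀ m i, LipschitzWith L (G m i)) → (∀ i, LipschitzWith L (G₀ i)) →
    (∀ i, ∀ s ∈ corner n, Tendsto (fun m => G m i s) atTop (𝓝 (G₀ i s))) →
    Tendsto (fun m => ∫ s in corner n, F s * jac (G m) s) atTop
      (𝓝 (∫ s in corner n, F s * jac G₀ s))

/-- Stokes' theorem on `corner (k + 1)` for `d(fu) ∧ dv`, where `f`, `u` and `v` are Lipschitz. -/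
def StokesMul (k : ℕ) : Prop :=
  ∀ (L : ℝ≥0) (f u : (Fin (k + 1) → ℝ) → ℝ) (v : Fin k → (Fin (k + 1) → ℝ) → ℝ),
    LipschitzWith L f → LipschitzWith L u → (∀ i, LipschitzWith L (v i)) →
    (∫ s in corner (k + 1), f s * jac (Fin.cons u v : Fin (k + 1) → (Fin (k + 1) → ℝ) → ℝ) s) +
      ∫ s in corner (k + 1), u s * jac (Fin.cons f v : Fin (k + 1) → (Fin (k + 1) → ℝ) → ℝ) s =
      ∑ j : Fin (k + 2), (-1) ^ (j : ℕ) *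
        ∫ t in corner k, f (cornerFace j t) * u (cornerFace j t) *
          jac (fun i t => v i (cornerFace j t)) t

theorem lipschitzWith_cons {L : ℝ≥0} {u : (Fin (k + 1) → ℝ) → ℝ}
    {v : Fin k → (Fin (k + 1) → ℝ) → ℝ} (hu : LipschitzWith L u) (hv : ∀ i, LipschitzWith L (v i))
    (i : Fin (k + 1)) :
    LipschitzWith L ((Fin.cons u v : Fin (k + 1) → (Fin (k + 1) → ℝ) → ℝ) i) :=
  Fin.cases hu hv i

theorem jac_cons_mul {f u : (Fin (k + 1) → ℝ) → ℝ} {v : Fin k → (Fin (k + 1) → ℝ) → ℝ}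
    {s : Fin (k + 1) → ℝ} (hf : DifferentiableAt ℝ f s) (hu : DifferentiableAt ℝ u s) :
    jac (Fin.cons (fun s => f s * u s) v : Fin (k + 1) → (Fin (k + 1) → ℝ) → ℝ) s =
      f s * jac (Fin.cons u v : Fin (k + 1) → (Fin (k + 1) → ℝ) → ℝ) s +
      u s * jac (Fin.cons f v : Fin (k + 1) → (Fin (k + 1) → ℝ) → ℝ) s := by
  simp only [jac_cons_eq_sum, partials_mul hf hu, Finset.mul_sum, ← Finset.sum_add_distrib,
    Pi.add_apply, Pi.smul_apply, smul_eq_mul]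
  exact Finset.sum_congr rfl fun j _ => by ring

theorem jacContinuous_zero : JacContinuous 0 := fun F K L G G₀ _ _ _ _ => by
  have h : ∀ G : Fin 0 → (Fin 0 → ℝ) → ℝ, ∀ s, jac G s = 1 := fun G s => Matrix.det_isEmpty
  simp only [h]
  exact tendsto_const_nhds

/-- Apply `stokes_smooth` to mollifications and let them converge. The interior integrals converge
strongly. A face is a null set, so almost everywhere convergence of gradients says nothing there;
the mollifications still converge pointwise with a common Lipschitz bound, which is what
`JacContinuous k` requires. -/
theorem JacContinuous.stokesMul (hk : JacContinuous k) : StokesMul k := by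
  intro L f u v hf hu hv
  have hfm := fun m => lipschitzWith_mollify hf m
  have hum := fun m => lipschitzWith_mollify hu m
  have hvm := fun i m => lipschitzWith_mollify (hv i) m
  obtain ⟨C, hC⟩ := exists_bound_of_tendsto (fun m => (hfm m).lipschitzOnWith)
    (tendsto_mollify hf.continuous 0)
  obtain ⟨D, hD⟩ := exists_bound_of_tendsto (fun m => (hum m).lipschitzOnWith)
    (tendsto_mollify hu.continuous 0)
  have hpart : ∀ {g : (Fin (k + 1) → ℝ) → ℝ}, LipschitzWith L g →
      ∀ i j, ∀ᵐ s ∂(volume.restrict (corner (k + 1))),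
      Tendsto (fun m => partials ((Fin.cons (mollify g m) fun i => mollify (v i) m :
        Fin (k + 1) → (Fin (k + 1) → ℝ) → ℝ) i) s j) atTop
        (𝓝 (partials ((Fin.cons g v : Fin (k + 1) → (Fin (k + 1) → ℝ) → ℝ) i) s j)) := by
    intro g hg i j
    refine ae_restrict_of_ae ?_
    refine Fin.cases ?_ (fun i => ?_) i
    · exact (tendsto_partials_mollify hg).mono fun s hs => hs j
    · exact (tendsto_partials_mollify (hv i)).mono fun s hs => hs j
  have hlhs := (tendsto_integral_mul_jac (fun m => (hfm m).continuous.continuousOn) hC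
    (fun s _ => tendsto_mollify hf.continuous s)
    (fun m => lipschitzWith_cons (hum m) fun i => hvm i m) (hpart hu)).add
    (tendsto_integral_mul_jac (fun m => (hum m).continuous.continuousOn) hD
    (fun s _ => tendsto_mollify hu.continuous s)
    (fun m => lipschitzWith_cons (hfm m) fun i => hvm i m) (hpart hf))
  have hsm : ∀ m, ((∫ s in corner (k + 1), mollify f m s *
        jac (Fin.cons (mollify u m) fun i => mollify (v i) m :
          Fin (k + 1) → (Fin (k + 1) → ℝ) → ℝ) s) +
      ∫ s in corner (k + 1), mollify u m s *
        jac (Fin.cons (mollify f m) fun i => mollify (v i) m :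
          Fin (k + 1) → (Fin (k + 1) → ℝ) → ℝ) s) =
      ∑ j : Fin (k + 2), (-1) ^ (j : ℕ) *
        ∫ t in corner k, mollify f m (cornerFace j t) * mollify u m (cornerFace j t) *
          jac (fun i t => mollify (v i) m (cornerFace j t)) t := fun m => by
    have hf1 : ContDiff ℝ 1 (mollify f m) := (contDiff_mollify hf.continuous m).of_le (by norm_num)
    have hu1 : ContDiff ℝ 1 (mollify u m) := (contDiff_mollify hu.continuous m).of_le (by norm_num)
    rw [← stokes_smooth (hf1.mul hu1) fun i => contDiff_mollify (hv i).continuous m,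
      ← integral_add (integrable_mul_jac (hfm m).continuous.continuousOn
        (lipschitzWith_cons (hum m) fun i => hvm i m))
        (integrable_mul_jac (hum m).continuous.continuousOn
        (lipschitzWith_cons (hfm m) fun i => hvm i m))]
    congr 1
    funext s
    rw [jac_cons_mul (hf1.differentiable one_ne_zero s) (hu1.differentiable one_ne_zero s)]
  simp only [hsm] at hlhs
  refine tendsto_nhds_unique hlhs (tendsto_finsetSum _ fun j _ => Tendsto.const_mul _ ?_)
  obtain ⟨K, hK⟩ := exists_lipschitzWith_cornerFace j
  have hvK : ∀ m i, LipschitzWith (L * K) fun t => mollify (v i) m (cornerFace j t) :=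
    fun m i => (hvm i m).comp hK
  obtain ⟨Q, hQ⟩ := lipschitzOnWith_mul_corner (hf.comp hK).lipschitzOnWith
    (hu.comp hK).lipschitzOnWith
  have h1 := hk _ Q (L * K) (fun m i t => mollify (v i) m (cornerFace j t))
    (fun i t => v i (cornerFace j t)) hQ hvK (fun i => (hv i).comp hK)
    fun i s _ => tendsto_mollify (hv i).continuous _
  have hcm : ∀ m, Continuous fun t => mollify f m (cornerFace j t) * mollify u m (cornerFace j t) :=
    fun m => ((hfm m).continuous.comp hK.continuous).mul ((hum m).continuous.comp hK.continuous)
  have hc : Continuous fun t => f (cornerFace j t) * u (cornerFace j t) :=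
    (hf.continuous.comp hK.continuous).mul (hu.continuous.comp hK.continuous)
  obtain ⟨B, hB⟩ := (isCompact_corner k).exists_bound_of_continuousOn hc.continuousOn
  -- `h1` treats the fixed test function `f * u`; the error from mollifying this factor tends to
  -- zero pointwise and is multiplied by bounded Jacobians.
  have h2 := tendsto_integral_mul_jac_zero
    (W := fun m t => mollify f m (cornerFace j t) * mollify u m (cornerFace j t) -
      f (cornerFace j t) * u (cornerFace j t)) (C := C * D + B)
    (fun m => ((hcm m).sub hc).continuousOn) (fun m s hs => ?_) (fun s hs => ?_) hvK
  · have h3 := h2.add h1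
    rw [zero_add] at h3
    refine h3.congr fun m => ?_
    refine (integral_add (integrable_mul_jac ((hcm m).sub hc).continuousOn (hvK m))
      (integrable_mul_jac hc.continuousOn (hvK m))).symm.trans ?_
    congr 1
    funext t
    simp only [Pi.sub_apply]
    ring
  · refine (abs_sub _ _).trans (add_le_add ?_ (hB s hs))
    rw [abs_mul]
    exact mul_le_mul (hC m _ (cornerFace_mem_corner j hs)) (hD m _ (cornerFace_mem_corner j hs))
      (abs_nonneg _) ((abs_nonneg _).trans (hC m _ (cornerFace_mem_corner j hs)))
  · have := ((tendsto_mollify hf.continuous (cornerFace j s)).mul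
      (tendsto_mollify hu.continuous (cornerFace j s))).sub_const
      (f (cornerFace j s) * u (cornerFace j s))
    rwa [sub_self] at this

/-- Integration by parts replaces `F du ∧ dv` by boundary terms and `-u dF ∧ dv`. In each of them
`u` is undifferentiated and tends to zero, so `v` need not converge at all. -/
theorem StokesMul.tendsto_cons_zero (hk : StokesMul k) {F : (Fin (k + 1) → ℝ) → ℝ} {K L : ℝ≥0}
    {u : ℕ → (Fin (k + 1) → ℝ) → ℝ} {v : ℕ → Fin k → (Fin (k + 1) → ℝ) → ℝ}
    (hF : LipschitzOnWith K F (corner (k + 1))) (hu : ∀ m, LipschitzWith L (u m))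
    (hv : ∀ m i, LipschitzWith L (v m i))
    (hlim : ∀ s ∈ corner (k + 1), Tendsto (fun m => u m s) atTop (𝓝 0)) :
    Tendsto (fun m => ∫ s in corner (k + 1), F s *
      jac (Fin.cons (u m) (v m) : Fin (k + 1) → (Fin (k + 1) → ℝ) → ℝ) s) atTop (𝓝 0) := by
  -- Now the test function gets differentiated, and `StokesMul` expects it to be Lipschitz on the
  -- whole space.
  obtain ⟨F', hF', hFF'⟩ := hF.extend_real
  obtain ⟨C, hC⟩ := exists_bound_of_tendsto (fun m => (hu m).lipschitzOnWith)
    (hlim 0 (zero_mem_corner _))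
  have hF1 : LipschitzWith (max K L) F' := hF'.weaken (le_max_left _ _)
  have hu1 := fun m => (hu m).weaken (le_max_right K L)
  have hv1 := fun m i => (hv m i).weaken (le_max_right K L)
  have h1 : ∀ m, ∫ s in corner (k + 1), F s *
      jac (Fin.cons (u m) (v m) : Fin (k + 1) → (Fin (k + 1) → ℝ) → ℝ) s =
      (∑ j : Fin (k + 2), (-1) ^ (j : ℕ) *
        ∫ t in corner k, F' (cornerFace j t) * u m (cornerFace j t) *
          jac (fun i t => v m i (cornerFace j t)) t) -
      ∫ s in corner (k + 1), u m s *
        jac (Fin.cons F' (v m) : Fin (k + 1) → (Fin (k + 1) → ℝ) → ℝ) s := fun m => by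
    rw [← hk _ F' (u m) (v m) hF1 (hu1 m) (hv1 m), add_sub_cancel_right]
    exact setIntegral_jac_congr hFF' fun i => Set.eqOn_refl _ _
  simp only [h1]
  have h2 := tendsto_integral_mul_jac_zero (fun m => (hu m).continuous.continuousOn) hC hlim
    fun m => lipschitzWith_cons hF1 (hv1 m)
  have h3 : ∀ j : Fin (k + 2), Tendsto (fun m => (-1 : ℝ) ^ (j : ℕ) *
        ∫ t in corner k, F' (cornerFace j t) * u m (cornerFace j t) *
          jac (fun i t => v m i (cornerFace j t)) t) atTop (𝓝 ((-1) ^ (j : ℕ) * 0)) := by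
    intro j
    refine Tendsto.const_mul _ ?_
    obtain ⟨Q, hQ⟩ := exists_lipschitzWith_cornerFace j
    have hc := hF1.continuous.comp hQ.continuous
    obtain ⟨B, hB⟩ := (isCompact_corner k).exists_bound_of_continuousOn hc.continuousOn
    refine tendsto_integral_mul_jac_zero (C := B * C) (L := L * Q)
      (fun m => (hc.mul ((hu m).continuous.comp hQ.continuous)).continuousOn) (fun m s hs => ?_)
      (fun s hs => ?_) fun m i => (hv m i).comp hQ
    · rw [abs_mul]
      exact mul_le_mul (hB s hs) (hC m _ (cornerFace_mem_corner j hs)) (abs_nonneg _)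
        ((norm_nonneg _).trans (hB s hs))
    · have := (hlim _ (cornerFace_mem_corner j hs)).const_mul (F' (cornerFace j s))
      rwa [mul_zero] at this
  have h4 := (tendsto_finsetSum Finset.univ fun j _ => h3 j).sub h2
  simpa using h4

theorem jac_comp_swap {G : Fin n → (Fin n → ℝ) → ℝ} {i j : Fin n} (hij : i ≠ j) (s : Fin n → ℝ) :
    jac (fun l => G (Equiv.swap i j l)) s = -jac G s :=
  (Matrix.detRowAlternating (R := ℝ) (n := Fin n)).map_swap (fun l => partials (G l) s) hij

theorem StokesMul.tendsto_zero (hk : StokesMul k) {F : (Fin (k + 1) → ℝ) → ℝ} {K L : ℝ≥0}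
    {G : ℕ → Fin (k + 1) → (Fin (k + 1) → ℝ) → ℝ} (i : Fin (k + 1))
    (hF : LipschitzOnWith K F (corner (k + 1))) (hG : ∀ m i, LipschitzWith L (G m i))
    (hlim : ∀ s ∈ corner (k + 1), Tendsto (fun m => G m i s) atTop (𝓝 0)) :
    Tendsto (fun m => ∫ s in corner (k + 1), F s * jac (G m) s) atTop (𝓝 0) := by
  by_cases hi : i = 0
  · subst hi
    have h1 := hk.tendsto_cons_zero (v := fun m => Fin.tail (G m)) hF (fun m => hG m 0)
      (fun m i => hG m i.succ) hlim
    simpa only [Fin.cons_self_tail] using h1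
  · have h1 := hk.tendsto_cons_zero (u := fun m => G m i)
      (v := fun m => Fin.tail fun l => G m (Equiv.swap 0 i l)) hF (fun m => hG m i)
      (fun m l => hG m _) hlim
    have h2 : ∀ m, (Fin.cons (G m i) (Fin.tail fun l => G m (Equiv.swap 0 i l)) :
        Fin (k + 1) → (Fin (k + 1) → ℝ) → ℝ) = fun l => G m (Equiv.swap 0 i l) := fun m => by
      conv_rhs => rw [← Fin.cons_self_tail fun l => G m (Equiv.swap 0 i l)]
      rw [Equiv.swap_apply_left]
    simp only [h2, jac_comp_swap (Ne.symm hi), mul_neg, integral_neg] at h1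
    simpa using h1.neg

theorem jac_update_sub {G : Fin n → (Fin n → ℝ) → ℝ} {i : Fin n} {g h : (Fin n → ℝ) → ℝ}
    {s : Fin n → ℝ} (hg : DifferentiableAt ℝ g s) (hh : DifferentiableAt ℝ h s) :
    jac (Function.update G i fun t => g t - h t) s =
      jac (Function.update G i g) s - jac (Function.update G i h) s := by
  rw [jac_update, jac_update, jac_update, partials_sub hg hh, AlternatingMap.map_update_sub]

/-- Induction on the set `S` of components already changed from `G₀` to `G m`. By multilinearity,
changing one more adds a Jacobian with a component that tends to zero, covered by
`StokesMul.tendsto_zero`. -/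
theorem StokesMul.jacContinuous (hk : StokesMul k) : JacContinuous (k + 1) := by
  intro F K L G G₀ hF hG hG₀ hlim
  have key : ∀ S : Finset (Fin (k + 1)),
      Tendsto (fun m => ∫ s in corner (k + 1), F s * jac (S.piecewise (G m) G₀) s) atTop
        (𝓝 (∫ s in corner (k + 1), F s * jac G₀ s)) := by
    intro S
    induction S using Finset.induction_on with
    | empty => simp
    | insert i S hi ih =>
      have hpw : ∀ m l, LipschitzWith L (S.piecewise (G m) G₀ l) := fun m l => by
        by_cases hl : l ∈ S
        · rw [Finset.piecewise_eq_of_mem _ _ _ hl]; exact hG m l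
        · rw [Finset.piecewise_eq_of_notMem _ _ _ hl]; exact hG₀ l
      -- The constant `L + L` accommodates the difference of `G m i` and `G₀ i`.
      have hup : ∀ m (g : (Fin (k + 1) → ℝ) → ℝ), LipschitzWith (L + L) g → ∀ l,
          LipschitzWith (L + L) (Function.update (S.piecewise (G m) G₀) i g l) := fun m g hg l => by
        by_cases hl : l = i
        · subst hl; simpa using hg
        · simpa [hl] using (hpw m l).weaken le_self_add
      have h1 := hk.tendsto_zero (L := L + L)
        (G := fun m => Function.update (S.piecewise (G m) G₀) i fun t => G m i t - G₀ i t) i hF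
        (fun m => hup m _ ((hG m i).sub (hG₀ i)))
        (fun s hs => by
          have := (hlim i s hs).sub_const (G₀ i s)
          rw [sub_self] at this
          simpa using this)
      have h2 := h1.add ih
      rw [zero_add] at h2
      refine h2.congr fun m => ?_
      rw [← integral_add (integrable_mul_jac hF.continuousOn
        (hup m _ ((hG m i).sub (hG₀ i)))) (integrable_mul_jac hF.continuousOn (hpw m))]
      refine integral_congr_ae ?_
      filter_upwards [ae_corner_differentiableAt (hG m i), ae_corner_differentiableAt (hG₀ i)]
        with s hs1 hs2
      have h3 : Function.update (S.piecewise (G m) G₀) i (G₀ i) = S.piecewise (G m) G₀ := by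
        rw [Function.update_eq_self_iff, Finset.piecewise_eq_of_notMem _ _ _ hi]
      rw [jac_update_sub hs1 hs2, h3, Finset.piecewise_insert]
      ring
  simpa using key Finset.univ

theorem jacContinuous : ∀ n, JacContinuous n
  | 0 => jacContinuous_zero
  | n + 1 => (jacContinuous n).stokesMul.jacContinuous

/-- The case of `StokesMul` where one factor is `1`: the integral in which it is differentiated
vanishes. -/
theorem stokes_lipschitz {L : ℝ≥0} {f : (Fin (k + 1) → ℝ) → ℝ}
    {v : Fin k → (Fin (k + 1) → ℝ) → ℝ} (hf : LipschitzWith L f) (hv : ∀ i, LipschitzWith L (v i)) :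
    ∫ s in corner (k + 1), jac (Fin.cons f v : Fin (k + 1) → (Fin (k + 1) → ℝ) → ℝ) s =
      ∑ j : Fin (k + 2), (-1) ^ (j : ℕ) *
        ∫ t in corner k, f (cornerFace j t) * jac (fun i t => v i (cornerFace j t)) t := by
  have h1 := (jacContinuous k).stokesMul L (fun _ => 1) f v
    ((LipschitzWith.const 1).weaken zero_le) hf hv
  have h2 : ∀ s, jac (Fin.cons (fun _ => 1) v : Fin (k + 1) → (Fin (k + 1) → ℝ) → ℝ) s = 0 :=
    fun s => by simp [jac_cons_eq_sum, partials_const]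
  simpa only [h2, mul_zero, integral_zero, add_zero, one_mul] using h1

end LipStokes

/-! ### Pairing `δ ∘ σ` with Lipschitz functions -/

section Pairing

variable {Z : Type u} {X : Type v} [MetricSpace Z] [MetricSpace X]

/-- The function `h - h(x₀)` as an element of `Lip_{x₀}(X)`. -/
noncomputable def lipZeroOf (x₀ : X) (h : lipFun X) : LipZero x₀ :=
  ⟨fun x => h.1 x - h.1 x₀, ⟨lipConst h.1, LipschitzWith.of_dist_le_mul fun x y => by
    rw [dist_sub_right]
    exact (IsLip.lipschitzWith h.2).dist_le_mul x y⟩, sub_self _⟩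

theorem norm_lipZeroOf_le (x₀ : X) (h : lipFun X) : ‖lipZeroOf x₀ h‖ ≤ lipConst h.1 := by
  rw [LipZero.norm_def, NNReal.coe_le_coe]
  refine lipConst_le (LipschitzWith.of_dist_le_mul fun x y => ?_)
  change dist (h.1 x - h.1 x₀) (h.1 y - h.1 x₀) ≤ _
  rw [dist_sub_right]
  exact (IsLip.lipschitzWith h.2).dist_le_mul x y

theorem BT.norm_apply_le {B : Type*} [NormedAddCommGroup B] [NormedSpace ℝ B] (F : BT Z B) (z : Z) :
    ‖F.1 z‖ ≤ ‖F‖ :=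
  (le_ciSup F.bddAbove z).trans (le_add_of_nonneg_right (NNReal.coe_nonneg _))

theorem BT.norm_apply_sub_le {B : Type*} [NormedAddCommGroup B] [NormedSpace ℝ B] (F : BT Z B)
    (z w : Z) : ‖F.1 z - F.1 w‖ ≤ ‖F‖ * dist z w := by
  have h1 := F.2.1.lipschitzWith.dist_le_mul z w
  rw [dist_eq_norm] at h1
  refine h1.trans (mul_le_mul_of_nonneg_right ?_ dist_nonneg)
  exact le_add_of_nonneg_left (Real.iSup_nonneg fun _ => norm_nonneg _)

/-- The difference is the value of the functional `δ_{σ z} - δ_{τ z}` at `h - h(x₀)`; the constant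
`h(x₀)` cancels. -/
theorem LipB.abs_comp_sub_le (x₀ : X) (h : lipFun X) (σ τ : LipB Z X) (z : Z) :
    |h.1 (σ z) - h.1 (τ z)| ≤ lipConst h.1 * ‖σ.deltaPush x₀ - τ.deltaPush x₀‖ := by
  have h1 : h.1 (σ z) - h.1 (τ z) = (σ.deltaPush x₀ - τ.deltaPush x₀).1 z (lipZeroOf x₀ h) := by
    change _ = (h.1 (σ z) - h.1 x₀) - (h.1 (τ z) - h.1 x₀)
    ring
  rw [h1, mul_comm]
  exact (((σ.deltaPush x₀ - τ.deltaPush x₀).1 z).le_opNorm _).trans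
    (mul_le_mul (BT.norm_apply_le _ _) (norm_lipZeroOf_le x₀ h) (norm_nonneg _) (norm_nonneg _))

theorem LipB.lipschitzWith_comp (x₀ : X) (h : lipFun X) (σ : LipB Z X) :
    LipschitzWith (lipConst h.1 * ‖σ.deltaPush x₀‖₊) fun z => h.1 (σ z) := by
  refine LipschitzWith.of_dist_le_mul fun z w => ?_
  have h1 : h.1 (σ z) - h.1 (σ w) =
      ((σ.deltaPush x₀).1 z - (σ.deltaPush x₀).1 w) (lipZeroOf x₀ h) := by
    change _ = (h.1 (σ z) - h.1 x₀) - (h.1 (σ w) - h.1 x₀)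
    ring
  rw [Real.dist_eq, h1, NNReal.coe_mul, coe_nnnorm, mul_assoc, mul_comm]
  have h2 := BT.norm_apply_sub_le (σ.deltaPush x₀) z w
  exact (ContinuousLinearMap.le_opNorm _ _).trans (mul_le_mul h2
    (norm_lipZeroOf_le x₀ h) (norm_nonneg _) (mul_nonneg (norm_nonneg _) dist_nonneg))

/-- This is where the Lipschitz part of the norm pays off: closeness of simplices controls gradients
of `h ∘ σ - h ∘ τ`, although `X` has no linear structure. -/
theorem LipB.lipschitzWith_comp_sub (x₀ : X) (h : lipFun X) (σ τ : LipB Z X) :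
    LipschitzWith (lipConst h.1 * ‖σ.deltaPush x₀ - τ.deltaPush x₀‖₊)
      fun z => h.1 (σ z) - h.1 (τ z) := by
  refine LipschitzWith.of_dist_le_mul fun z w => ?_
  have h1 : h.1 (σ z) - h.1 (τ z) - (h.1 (σ w) - h.1 (τ w)) =
      ((σ.deltaPush x₀ - τ.deltaPush x₀).1 z - (σ.deltaPush x₀ - τ.deltaPush x₀).1 w)
        (lipZeroOf x₀ h) := by
    change _ = ((h.1 (σ z) - h.1 x₀) - (h.1 (τ z) - h.1 x₀)) -
      ((h.1 (σ w) - h.1 x₀) - (h.1 (τ w) - h.1 x₀))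
    ring
  rw [Real.dist_eq, h1, NNReal.coe_mul, coe_nnnorm, mul_assoc, mul_comm]
  have h2 := BT.norm_apply_sub_le (σ.deltaPush x₀ - τ.deltaPush x₀) z w
  exact (ContinuousLinearMap.le_opNorm _ _).trans (mul_le_mul h2
    (norm_lipZeroOf_le x₀ h) (norm_nonneg _) (mul_nonneg (norm_nonneg _) dist_nonneg))

theorem LipB.continuous_deltaPush (x₀ : X) :
    Continuous (LipB.deltaPush x₀ : LipB Z X → BT Z (DoubleDual x₀)) :=
  continuous_iInf_dom (i := x₀) continuous_induced_dom

/-- Evaluation is jointly continuous. -/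
theorem LipB.continuous_eval : Continuous fun p : LipB Z X × Z => p.1 p.2 := by
  rw [continuous_iff_continuousAt]
  rintro ⟨σ, z⟩
  let x₀ := σ z
  have hd : ∀ (τ : LipB Z X) (w : Z),
      dist (τ w) (σ w) ≤ ‖τ.deltaPush x₀ - σ.deltaPush x₀‖ := fun τ w => by
    have h1 : LipschitzWith 1 fun y => dist y (σ w) := LipschitzWith.dist_left _
    -- Testing with the distance to `σ w` recovers the metric of `X` from the norm.
    have h2 := LipB.abs_comp_sub_le x₀ ⟨_, 1, h1⟩ τ σ w
    simp only [dist_self, sub_zero, abs_dist] at h2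
    refine h2.trans (mul_le_of_le_one_left (norm_nonneg _) ?_)
    exact_mod_cast lipConst_le h1
  have h3 : Tendsto (fun p : LipB Z X × Z => ‖p.1.deltaPush x₀ - σ.deltaPush x₀‖) (𝓝 (σ, z))
      (𝓝 0) := by
    have h4 : Continuous fun p : LipB Z X × Z => ‖p.1.deltaPush x₀ - σ.deltaPush x₀‖ :=
      (((LipB.continuous_deltaPush x₀).comp continuous_fst).sub continuous_const).norm
    simpa using h4.tendsto (σ, z)
  have h5 : Tendsto (fun p : LipB Z X × Z => dist (σ p.2) (σ z)) (𝓝 (σ, z)) (𝓝 0) := by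
    have h6 : Continuous fun p : LipB Z X × Z => dist (σ p.2) (σ z) :=
      (σ.isLip.lipschitzWith.continuous.comp continuous_snd).dist continuous_const
    simpa using h6.tendsto (σ, z)
  refine tendsto_iff_dist_tendsto_zero.2 (squeeze_zero (fun _ => dist_nonneg)
    (fun p => (dist_triangle _ (σ p.2) _).trans (add_le_add_left (hd p.1 p.2) _)) ?_)
  simpa using h3.add h5

end Pairing

/-! ### The affine parametrization of the simplex -/

section Chart

variable {k : ℕ}

/-- The slanted face of `corner (k + 1)` is the standard simplex itself, so `chart k` coincides with
its parametrization `cornerFace 0`. -/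
theorem chart_val {s : Fin k → ℝ} (hs : s ∈ corner k) :
    (chart k s).1 = WithLp.toLp 2 (cornerFace 0 s) :=
  congrArg Subtype.val (dif_pos hs)

theorem exists_lipschitzOnWith_chart (k : ℕ) :
    ∃ C : ℝ≥0, LipschitzOnWith C (chart k) (corner k) := by
  obtain ⟨K, hK⟩ := exists_lipschitzWith_cornerFace (0 : Fin (k + 2))
  obtain ⟨C, hC⟩ : ∃ C, LipschitzWith C fun s : Fin k → ℝ => WithLp.toLp 2 (cornerFace 0 s) :=
    ⟨_, (PiLp.lipschitzWith_toLp 2 fun _ : Fin (k + 1) => ℝ).comp hK⟩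
  refine ⟨C, LipschitzOnWith.of_dist_le_mul fun s hs t ht => ?_⟩
  change dist (chart k s).1 (chart k t).1 ≤ _
  rw [chart_val hs, chart_val ht]
  exact hC.dist_le_mul s t

/-- A Lipschitz constant of `chart k` on `corner k`. -/
noncomputable def chartLip (k : ℕ) : ℝ≥0 := (exists_lipschitzOnWith_chart k).choose

theorem lipschitzOnWith_chart (k : ℕ) : LipschitzOnWith (chartLip k) (chart k) (corner k) :=
  (exists_lipschitzOnWith_chart k).choose_spec

/-- The numbering and parametrization of faces agree on both sides, so Stokes' theorem produces the
signs of `chainBoundary`. -/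
theorem face_chart (j : Fin (k + 2)) {t : Fin k → ℝ} (ht : t ∈ corner k) :
    face j (chart k t) = chart (k + 1) (cornerFace j t) := by
  apply Subtype.ext
  rw [chart_val (cornerFace_mem_corner j ht)]
  ext m
  refine Fin.succAboveCases j ?_ (fun l => ?_) m
  · rw [face_apply_same]
    refine Fin.cases ?_ (fun i => ?_) j
    · simp [Fin.sum_univ_succ]
    · simp
  · rw [face_apply_succAbove, chart_val ht]
    refine Fin.cases ?_ (fun i => ?_) j
    · simp
    · refine Fin.cases ?_ (fun l => ?_) l
      · simp [Fin.sum_univ_succAbove _ i]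
      · simp

end Chart

/-! ### The current of a Lipschitz simplex -/

section SimplexCurrent

variable {X : Type u} [MetricSpace X] {k : ℕ}

/-- A function on `X` in the affine coordinates of a simplex. -/
noncomputable def pull (σ : LipB (Simplex k) X) (h : X → ℝ) (s : Fin k → ℝ) : ℝ := h (σ (chart k s))

theorem simplexCurrent_eq (σ : LipB (Simplex k) X) (f : blipFun X) (π : Fin k → lipFun X) :
    simplexCurrent σ f π = ∫ s in corner k, pull σ f.1 s * jac (fun i => pull σ (π i).1) s := rfl

theorem lipschitzOnWith_pull (x₀ : X) (σ : LipB (Simplex k) X) (h : lipFun X) :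
    LipschitzOnWith (lipConst h.1 * ‖σ.deltaPush x₀‖₊ * chartLip k) (pull σ h.1) (corner k) :=
  (LipB.lipschitzWith_comp x₀ h σ).comp_lipschitzOnWith (lipschitzOnWith_chart k)

theorem lipschitzOnWith_pull_sub (x₀ : X) (σ τ : LipB (Simplex k) X) (h : lipFun X) :
    LipschitzOnWith (lipConst h.1 * ‖σ.deltaPush x₀ - τ.deltaPush x₀‖₊ * chartLip k)
      (fun s => pull σ h.1 s - pull τ h.1 s) (corner k) :=
  (LipB.lipschitzWith_comp_sub x₀ h σ τ).comp_lipschitzOnWith (lipschitzOnWith_chart k)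

theorem continuousOn_pull (σ : LipB (Simplex k) X) (f : blipFun X) :
    ContinuousOn (pull σ f.1) (corner k) :=
  f.2.1.lipschitzWith.continuous.comp_continuousOn
    (σ.isLip.lipschitzWith.continuous.comp_continuousOn (lipschitzOnWith_chart k).continuousOn)

/-- `chart` is constant off the corner, so `pull` may jump at its frontier; Rademacher and Stokes
are applied to this global extension instead. -/
theorem exists_extend_pull (x₀ : X) (σ : LipB (Simplex k) X) (h : lipFun X) :
    ∃ g, LipschitzWith (lipConst h.1 * ‖σ.deltaPush x₀‖₊ * chartLip k) g ∧
      Set.EqOn (pull σ h.1) g (corner k) :=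
  (lipschitzOnWith_pull x₀ σ h).extend_real

/-- A point in the image of a Lipschitz simplex. -/
noncomputable def LipB.basePoint (σ : LipB (Simplex k) X) : X := σ (chart k 0)

theorem ae_differentiableAt_pull (σ : LipB (Simplex k) X) (h : lipFun X) :
    ∀ᵐ s ∂(volume.restrict (corner k)), DifferentiableAt ℝ (pull σ h.1) s := by
  obtain ⟨g, hg, hgg⟩ := exists_extend_pull σ.basePoint σ h
  filter_upwards [ae_mem_interior_corner k, ae_corner_differentiableAt hg] with s hs hd
  exact hd.congr_of_eventuallyEq
    (Filter.eventually_of_mem (mem_interior_iff_mem_nhds.1 hs) hgg)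

theorem ae_abs_jac_pull_le (x₀ : X) (σ : LipB (Simplex k) X) (π : Fin k → lipFun X) :
    ∀ᵐ s ∂(volume.restrict (corner k)), |jac (fun i => pull σ (π i).1) s| ≤
      k.factorial * (‖σ.deltaPush x₀‖ * chartLip k) ^ k * ∏ i, (lipConst (π i).1 : ℝ) := by
  choose g hg hgg using fun i => exists_extend_pull x₀ σ (π i)
  refine ae_corner_of_interior fun s hs => ?_
  rw [jac_congr_corner hs hgg]
  refine (abs_jac_le hg s).trans (le_of_eq ?_)
  push_cast
  simp only [mul_assoc]
  rw [Finset.prod_mul_distrib, Finset.prod_const, Finset.card_univ, Fintype.card_fin]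
  ring

theorem integrable_pull_mul_jac (σ : LipB (Simplex k) X) (f : blipFun X) (π : Fin k → lipFun X) :
    Integrable (fun s => pull σ f.1 s * jac (fun i => pull σ (π i).1) s)
      (volume.restrict (corner k)) :=
  ((continuousOn_pull σ f).integrableOn_compact (isCompact_corner k)).mul_bdd
    (measurable_jac _).aestronglyMeasurable (ae_abs_jac_pull_le σ.basePoint σ π)

/-- The constant involves `σ` only through the norm of `σ.deltaPush x₀`, hence is uniform on compact
sets of simplices. -/
theorem abs_simplexCurrent_le (x₀ : X) (σ : LipB (Simplex k) X) (f : blipFun X)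
    (π : Fin k → lipFun X) :
    |simplexCurrent σ f π| ≤
      k.factorial * (‖σ.deltaPush x₀‖ * chartLip k) ^ k * (∏ i, (lipConst (π i).1 : ℝ)) *
        ∫ s in corner k, |pull σ f.1 s| := by
  rw [simplexCurrent_eq, ← Real.norm_eq_abs, ← integral_const_mul]
  refine norm_integral_le_of_norm_le ?_ ?_
  · exact (((continuousOn_pull σ f).integrableOn_compact (isCompact_corner k)).abs).const_mul _
  · filter_upwards [ae_abs_jac_pull_le x₀ σ π] with s hs
    rw [norm_mul, mul_comm]
    exact mul_le_mul_of_nonneg_right hs (norm_nonneg _)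

theorem simplexCurrent_add (σ : LipB (Simplex k) X) (f g : blipFun X) (π : Fin k → lipFun X) :
    simplexCurrent σ (f + g) π = simplexCurrent σ f π + simplexCurrent σ g π := by
  simp only [simplexCurrent_eq]
  rw [← integral_add (integrable_pull_mul_jac σ f π) (integrable_pull_mul_jac σ g π)]
  congr 1
  funext s
  exact add_mul _ _ _

theorem simplexCurrent_smul (σ : LipB (Simplex k) X) (c : ℝ) (f : blipFun X)
    (π : Fin k → lipFun X) : simplexCurrent σ (c • f) π = c * simplexCurrent σ f π := by
  simp only [simplexCurrent_eq]
  rw [← integral_const_mul]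
  congr 1
  funext s
  exact mul_assoc _ _ _

theorem jac_pull_update (σ : LipB (Simplex k) X) (π : Fin k → lipFun X) (i : Fin k)
    (h : lipFun X) (s : Fin k → ℝ) :
    jac (fun l => pull σ (Function.update π i h l).1) s =
      Matrix.detRowAlternating (Function.update (fun l => partials (pull σ (π l).1) s) i
        (partials (pull σ h.1) s)) := by
  rw [← jac_update]
  congr 1
  funext l
  by_cases hl : l = i
  · subst hl; simp
  · simp [hl]

theorem simplexCurrent_update_add (σ : LipB (Simplex k) X) (f : blipFun X)
    (π : Fin k → lipFun X) (i : Fin k) (h h' : lipFun X) :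
    simplexCurrent σ f (Function.update π i (h + h')) =
      simplexCurrent σ f (Function.update π i h) + simplexCurrent σ f (Function.update π i h') := by
  simp only [simplexCurrent_eq]
  rw [← integral_add (integrable_pull_mul_jac σ f _) (integrable_pull_mul_jac σ f _)]
  refine integral_congr_ae ?_
  filter_upwards [ae_differentiableAt_pull σ h, ae_differentiableAt_pull σ h'] with s hs hs'
  have h1 : partials (pull σ (h + h').1) s = partials (pull σ h.1) s + partials (pull σ h'.1) s :=
    partials_add hs hs'
  rw [jac_pull_update, jac_pull_update, jac_pull_update, h1, AlternatingMap.map_update_add, mul_add]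

theorem simplexCurrent_update_smul (σ : LipB (Simplex k) X) (f : blipFun X)
    (π : Fin k → lipFun X) (i : Fin k) (c : ℝ) (h : lipFun X) :
    simplexCurrent σ f (Function.update π i (c • h)) =
      c * simplexCurrent σ f (Function.update π i h) := by
  simp only [simplexCurrent_eq]
  rw [← integral_const_mul]
  refine integral_congr_ae ?_
  filter_upwards [ae_differentiableAt_pull σ h] with s hs
  have h1 : partials (pull σ (c • h).1) s = c • partials (pull σ h.1) s :=
    partials_const_mul c hs
  rw [jac_pull_update, jac_pull_update, h1, AlternatingMap.map_update_smul, smul_eq_mul]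
  ring

/-- Near an interior point with `f ∘ σ ≠ 0` this inequality persists, so `π_i ∘ σ` is locally
constant and the Jacobian has a zero row. -/
theorem isLocal_simplexCurrent (σ : LipB (Simplex k) X) : IsLocal (simplexCurrent σ) := by
  rintro f π ⟨i, c, hi⟩
  rw [simplexCurrent_eq]
  refine integral_eq_zero_of_ae (ae_corner_of_interior fun s hs => ?_)
  by_cases h0 : pull σ f.1 s = 0
  · simp [h0]
  · have hn := mem_interior_iff_mem_nhds.1 hs
    have h1 : ∀ᶠ t in 𝓝 s, pull σ f.1 t ≠ 0 :=
      ((continuousOn_pull σ f).continuousAt hn).eventually_ne h0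
    have h2 : partials (pull σ (π i).1) s = 0 := by
      rw [← partials_const c s]
      exact partials_congr (h1.mono fun t ht => hi _ ht)
    have h3 : jac (fun l => pull σ (π l).1) s = 0 :=
      Matrix.det_eq_zero_of_row_eq_zero i fun j => congrFun h2 j
    simp [h3]

theorem isCont_simplexCurrent (σ : LipB (Simplex k) X) : IsCont (simplexCurrent σ) := by
  rintro f p π ⟨L, hL⟩ hp
  -- Lipschitz bounds pass to pointwise limits.
  have hπ : ∀ i, LipschitzWith L (π i).1 := fun i => by
    refine LipschitzWith.of_dist_le_mul fun x y => ?_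
    exact le_of_tendsto ((hp i x).dist (hp i y))
      (Eventually.of_forall fun m => (hL m i).dist_le_mul x y)
  let M : ℝ≥0 := L * ‖σ.deltaPush σ.basePoint‖₊ * chartLip k
  have hM : ∀ h : lipFun X, LipschitzWith L h.1 →
      ∃ g, LipschitzWith M g ∧ Set.EqOn (pull σ h.1) g (corner k) := fun h hh => by
    obtain ⟨g, hg, hgg⟩ := exists_extend_pull σ.basePoint σ h
    exact ⟨g, hg.weaken (mul_le_mul' (mul_le_mul' (lipConst_le hh) le_rfl) le_rfl), hgg⟩
  choose G hG hGG using fun m i => hM (p m i) (hL m i)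
  choose G₀ hG₀ hGG₀ using fun i => hM (π i) (hπ i)
  have h1 := jacContinuous k (pull σ f.1) _ M G G₀
    (lipschitzOnWith_pull σ.basePoint σ (blipToLip f)) hG hG₀ fun i s hs => by
      simp only [← hGG _ i hs, ← hGG₀ i hs]
      exact hp i _
  have h2 : ∀ m, simplexCurrent σ f (p m) = ∫ s in corner k, pull σ f.1 s * jac (G m) s :=
    fun m => setIntegral_jac_congr (Set.eqOn_refl _ _) (hGG m)
  have h3 : simplexCurrent σ f π = ∫ s in corner k, pull σ f.1 s * jac G₀ s :=
    setIntegral_jac_congr (Set.eqOn_refl _ _) hGG₀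
  simp only [h2, h3]
  exact h1

/-- Stokes' theorem for extensions of the pulled-back functions, read off on the faces through
`face_chart`. -/
theorem boundary_simplexCurrent (σ : LipB (Simplex (k + 1)) X) (f : blipFun X)
    (π : Fin k → lipFun X) :
    boundary (simplexCurrent σ) f π =
      ∑ j : Fin (k + 2), (-1) ^ (j : ℕ) * simplexCurrent (faceRestrict j σ) f π := by
  obtain ⟨g, hg, hgg⟩ := exists_extend_pull σ.basePoint σ (blipToLip f)
  choose v hv hvv using fun i => exists_extend_pull σ.basePoint σ (π i)
  let L : ℝ≥0 := (lipConst f.1 + ∑ i, lipConst (π i).1) * ‖σ.deltaPush σ.basePoint‖₊ *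
    chartLip (k + 1)
  have hgL : LipschitzWith L g := hg.weaken (mul_le_mul' (mul_le_mul' le_self_add le_rfl) le_rfl)
  have hvL : ∀ i, LipschitzWith L (v i) := fun i => (hv i).weaken
    (mul_le_mul' (mul_le_mul' ((Finset.single_le_sum (f := fun j => lipConst (π j).1)
      (fun _ _ => zero_le) (Finset.mem_univ i)).trans le_add_self) le_rfl) le_rfl)
  have h1 : boundary (simplexCurrent σ) f π = ∫ s in corner (k + 1),
      jac (Fin.cons g v : Fin (k + 1) → (Fin (k + 1) → ℝ) → ℝ) s := by
    have h2 : boundary (simplexCurrent σ) f π = ∫ s in corner (k + 1), 1 *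
      jac (Fin.cons g v : Fin (k + 1) → (Fin (k + 1) → ℝ) → ℝ) s :=
      setIntegral_jac_congr (fun s _ => rfl) (Fin.cases hgg hvv)
    simpa only [one_mul] using h2
  rw [h1, stokes_lipschitz hgL hvL]
  refine Finset.sum_congr rfl fun j _ => ?_
  congr 1
  have hface : ∀ (h : X → ℝ) (g : (Fin (k + 1) → ℝ) → ℝ), Set.EqOn (pull σ h) g (corner (k + 1)) →
      Set.EqOn (fun t => g (cornerFace j t)) (pull (faceRestrict j σ) h) (corner k) :=
    fun h g hg t ht => by
      change g (cornerFace j t) = h (σ (face j (chart k t)))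
      rw [face_chart j ht, ← hg (cornerFace_mem_corner j ht)]
      rfl
  exact setIntegral_jac_congr (hface _ g hgg) fun i => hface _ (v i) (hvv i)

/-- Here the gradients converge almost everywhere by `lipschitzOnWith_pull_sub`, so no weak
continuity is needed. -/
theorem continuous_simplexCurrent (f : blipFun X) (π : Fin k → lipFun X) :
    Continuous fun σ : LipB (Simplex k) X => simplexCurrent σ f π := by
  rw [continuous_iff_continuousAt]
  intro σ
  let x₀ := σ.basePoint
  -- The topology is induced from a normed space, so sequences suffice and dominated convergence is
  -- available.
  have := (LipB.isInducing_deltaPush (Z := Simplex k) x₀).firstCountableTopology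
  refine tendsto_of_seq_tendsto fun τ hτ => ?_
  have h1 : Tendsto (fun m => (τ m).deltaPush x₀) atTop (𝓝 (σ.deltaPush x₀)) :=
    ((LipB.continuous_deltaPush x₀).tendsto σ).comp hτ
  have h2 : Tendsto (fun m => ‖(τ m).deltaPush x₀ - σ.deltaPush x₀‖) atTop (𝓝 0) :=
    tendsto_iff_norm_sub_tendsto_zero.1 h1
  obtain ⟨N, hN⟩ := h1.nnnorm.bddAbove_range
  have hN' : ∀ m, ‖(τ m).deltaPush x₀‖₊ ≤ N := fun m => hN ⟨m, rfl⟩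
  have hNσ : ‖σ.deltaPush x₀‖₊ ≤ N := le_of_tendsto' h1.nnnorm hN'
  choose G hG hGG using fun m i => exists_extend_pull x₀ (τ m) (π i)
  choose G₀ hG₀ hGG₀ using fun i => exists_extend_pull x₀ σ (π i)
  let L : ℝ≥0 := (∑ i, lipConst (π i).1) * N * chartLip k
  have hGL : ∀ m i, LipschitzWith L (G m i) := fun m i => (hG m i).weaken
    (mul_le_mul' (mul_le_mul' (Finset.single_le_sum (f := fun j => lipConst (π j).1)
      (fun _ _ => zero_le) (Finset.mem_univ i)) (hN' m)) le_rfl)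
  obtain ⟨C, hC⟩ := f.2.2
  have h3 := tendsto_integral_mul_jac (F := fun m => pull (τ m) f.1) (F₀ := pull σ f.1)
    (G₀ := G₀) (C := C)
    (fun m => continuousOn_pull (τ m) f) (fun m s _ => hC _) (fun s _ => ?_) hGL fun i j => ?_
  · refine (h3.congr fun m => ?_).trans_eq ?_
    · exact (setIntegral_jac_congr (Set.eqOn_refl _ _) (hGG m)).symm
    · congr 1
      exact (setIntegral_jac_congr (Set.eqOn_refl _ _) hGG₀).symm
  · rw [tendsto_iff_dist_tendsto_zero]
    refine squeeze_zero (fun _ => dist_nonneg)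
      (fun m => LipB.abs_comp_sub_le x₀ (blipToLip f) (τ m) σ (chart k s)) ?_
    simpa using h2.const_mul (lipConst (blipToLip f).1 : ℝ)
  · filter_upwards [ae_mem_interior_corner k, ae_corner_differentiableAt (hG₀ i),
      ae_all_iff.2 fun m => ae_corner_differentiableAt (hG m i)] with s hs hd hdm
    rw [tendsto_iff_dist_tendsto_zero]
    refine squeeze_zero (fun _ => dist_nonneg) (g := fun m =>
      (lipConst (π i).1 : ℝ) * ‖(τ m).deltaPush x₀ - σ.deltaPush x₀‖ * chartLip k) (fun m => ?_) ?_
    -- At an interior point a Lipschitz constant on the corner bounds the derivative; the extensions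
    -- need not be close elsewhere.
    · rw [Real.dist_eq, ← Pi.sub_apply, ← partials_sub (hdm m) hd]
      have h4 : LipschitzOnWith
          (lipConst (π i).1 * ‖(τ m).deltaPush x₀ - σ.deltaPush x₀‖₊ * chartLip k)
          (fun t => G m i t - G₀ i t) (corner k) := by
        refine LipschitzOnWith.of_dist_le_mul fun t ht t' ht' => ?_
        rw [← hGG m i ht, ← hGG m i ht', ← hGG₀ i ht, ← hGG₀ i ht']
        exact (lipschitzOnWith_pull_sub x₀ (τ m) σ (π i)).dist_le_mul t ht t' ht'
      have h5 := norm_fderiv_le_of_lipschitzOn ℝ (mem_interior_iff_mem_nhds.1 hs) h4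
      have h6 := (fderiv ℝ (fun t => G m i t - G₀ i t) s).le_opNorm (Pi.single j 1)
      rw [Pi.norm_single, norm_one, mul_one] at h6
      exact h6.trans h5
    · simpa using (h2.const_mul (lipConst (π i).1 : ℝ)).mul_const (chartLip k : ℝ)

end SimplexCurrent

/-! ### The current of a Lipschitz measure chain -/

section LipBTopology

variable {Z : Type u} {X : Type v} [MetricSpace Z] [MetricSpace X]

/-- Evaluations are continuous and separate points. Compact determination sets thereby become
closed, hence Borel. -/
instance : T2Space (LipB Z X) :=
  T2Space.of_injective_continuous (f := fun σ : LipB Z X => σ.toFun)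
    (fun _ _ h => LipB.ext (congrFun h))
    (continuous_pi fun _ => LipB.continuous_eval.comp (continuous_id.prodMk continuous_const))

end LipBTopology

/-! ### Total variation of compactly determined signed measures -/

section Variation

variable {S : Type u} [MeasurableSpace S]

instance isFiniteMeasure_variation (μ : SignedMeasure S) :
    IsFiniteMeasure (VectorMeasure.variation μ) := by
  rw [← μ.totalVariation_eq_variation]
  infer_instance

theorem exists_isCompact_variation_compl [TopologicalSpace S] [T2Space S] [BorelSpace S]
    (μ : compactSignedMeasures S) :
    ∃ K, IsCompact K ∧ VectorMeasure.variation μ.1 Kᶜ = 0 := by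
  obtain ⟨K, hK, h⟩ := μ.2
  refine ⟨K, hK, ?_⟩
  rw [VectorMeasure.variation_apply_eq_zero hK.measurableSet.compl]
  exact fun t ht htm => h t htm ht

/-- The finite variation measure lives on a compact set, where a continuous function is bounded. -/
theorem integrable_of_continuous [TopologicalSpace S] [T2Space S] [BorelSpace S]
    (μ : compactSignedMeasures S) {g : S → ℝ} (hg : Continuous g) : μ.1.Integrable g := by
  obtain ⟨K, hK, hμK⟩ := exists_isCompact_variation_compl μ
  have hae : ∀ᵐ σ ∂(VectorMeasure.variation μ.1), σ ∈ K := hμK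
  obtain ⟨C, hC⟩ := hK.exists_bound_of_continuousOn hg.continuousOn
  exact Integrable.of_bound hg.aestronglyMeasurable C (hae.mono hC)

theorem abs_integral_le_integral_variation (μ : SignedMeasure S) (g : S → ℝ) :
    |∫ᵛ σ, g σ ∂•μ| ≤ ∫ σ, |g σ| ∂(VectorMeasure.variation μ) := by
  refine (VectorMeasure.norm_integral_le_integral_norm (μ := μ) (f := g)
    (B := ContinuousLinearMap.lsmul ℝ ℝ)).trans (mul_le_of_le_one_left ?_ ?_)
  · exact integral_nonneg fun _ => norm_nonneg _
  · exact ContinuousLinearMap.opNorm_lsmul_le (𝕜 := ℝ) (R := ℝ) (E := ℝ)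

end Variation

/-! ### Multilinearity, locality and continuity of `T^μ` -/

section MeasureCurrent

variable {X : Type u} [MetricSpace X] {k : ℕ}

theorem integrable_simplexCurrent (μ : LipChain X k) (f : blipFun X) (π : Fin k → lipFun X) :
    μ.1.Integrable fun σ => simplexCurrent σ f π :=
  integrable_of_continuous μ (continuous_simplexCurrent f π)

/-- The continuous map `deltaPush` is bounded in norm on the determination set. One constant and one
null set serve all `f` and `π`. -/
theorem exists_ae_simplexCurrent_le (μ : LipChain X k) :
    ∃ B : ℝ≥0, ∀ᵐ σ ∂(VectorMeasure.variation μ.1), ∀ (f : blipFun X) (π : Fin k → lipFun X),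
      |simplexCurrent σ f π| ≤
        B * (∏ i, (lipConst (π i).1 : ℝ)) * ∫ s in corner k, |pull σ f.1 s| := by
  obtain ⟨K, hK, hμK⟩ := exists_isCompact_variation_compl μ
  have hae : ∀ᵐ σ ∂(VectorMeasure.variation μ.1), σ ∈ K := hμK
  -- An empty `X` offers no base point, but then there is no simplex either.
  rcases isEmpty_or_nonempty X with hX | ⟨⟨x₀⟩⟩
  · exact ⟨0, ae_of_all _ fun σ => isEmptyElim σ.basePoint⟩
  · obtain ⟨N, hN⟩ := hK.exists_bound_of_continuousOn
      (LipB.continuous_deltaPush (Z := Simplex k) x₀).continuousOn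
    refine ⟨⟨k.factorial * (|N| * chartLip k) ^ k, by positivity⟩, hae.mono fun σ hσ f π => ?_⟩
    refine (abs_simplexCurrent_le x₀ σ f π).trans ?_
    have h1 : ‖σ.deltaPush x₀‖ ≤ |N| := (hN σ hσ).trans (le_abs_self N)
    refine mul_le_mul_of_nonneg_right (mul_le_mul_of_nonneg_right ?_
      (Finset.prod_nonneg fun _ _ => NNReal.coe_nonneg _)) (integral_nonneg fun _ => abs_nonneg _)
    change _ ≤ k.factorial * (|N| * chartLip k) ^ k
    gcongr

theorem isMultilin_of {T : Functional X k} (hadd : ∀ f g π, T (f + g) π = T f π + T g π)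
    (hsmul : ∀ (c : ℝ) f π, T (c • f) π = c * T f π)
    (hupd : ∀ f (π : Fin k → lipFun X) i h h', T f (Function.update π i (h + h')) =
      T f (Function.update π i h) + T f (Function.update π i h'))
    (hupds : ∀ f (π : Fin k → lipFun X) i (c : ℝ) h, T f (Function.update π i (c • h)) =
      c * T f (Function.update π i h)) : IsMultilin T :=
  ⟨{ toFun := fun f => MultilinearMap.mk' (T f) (hupd f) (hupds f)
     map_add' := fun f g => MultilinearMap.ext (hadd f g)
     map_smul' := fun c f => MultilinearMap.ext (hsmul c f) }, fun _ _ => rfl⟩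

theorem isMultilin_measureCurrent (μ : LipChain X k) : IsMultilin (measureCurrent μ) := by
  refine isMultilin_of (fun f g π => ?_) (fun c f π => ?_) (fun f π i h h' => ?_)
    fun f π i c h => ?_
  · simp only [measureCurrent, simplexCurrent_add]
    exact VectorMeasure.integral_fun_add (integrable_simplexCurrent μ f π)
      (integrable_simplexCurrent μ g π)
  · simp only [measureCurrent, simplexCurrent_smul]
    exact VectorMeasure.integral_fun_smul _ _ c _
  · simp only [measureCurrent, simplexCurrent_update_add]
    exact VectorMeasure.integral_fun_add (integrable_simplexCurrent μ f _)
      (integrable_simplexCurrent μ f _)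
  · simp only [measureCurrent, simplexCurrent_update_smul]
    exact VectorMeasure.integral_fun_smul _ _ c _

theorem isLocal_measureCurrent (μ : LipChain X k) : IsLocal (measureCurrent μ) := fun f π h => by
  have h1 : ∀ σ : LipB (Simplex k) X, simplexCurrent σ f π = 0 :=
    fun σ => isLocal_simplexCurrent σ f π h
  simp only [measureCurrent, h1]
  exact VectorMeasure.integral_zero

theorem setIntegral_abs_pull_le (σ : LipB (Simplex k) X) (f : blipFun X) {C : ℝ}
    (hC : ∀ x, |f.1 x| ≤ C) :
    ∫ s in corner k, |pull σ f.1 s| ≤ C * volume.real (corner k) := by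
  have h1 := norm_setIntegral_le_of_norm_le_const (μ := volume) (f := fun s => |pull σ f.1 s|)
    (C := C) (isCompact_corner k).measure_lt_top fun s _ => by
      rw [Real.norm_eq_abs, abs_abs]
      exact hC _
  exact (le_abs_self _).trans h1

/-- Dominated convergence over simplices, with a constant majorant thanks to the uniform mass bound.
-/
theorem isCont_measureCurrent (μ : LipChain X k) : IsCont (measureCurrent μ) := by
  rintro f p π ⟨L, hL⟩ hp
  obtain ⟨B, hB⟩ := exists_ae_simplexCurrent_le μ
  obtain ⟨C, hC⟩ := f.2.2
  refine VectorMeasure.tendsto_integral_of_dominated_convergence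
    (fun _ => B * (L : ℝ) ^ k * (C * volume.real (corner k)))
    (fun m => (continuous_simplexCurrent f (p m)).aestronglyMeasurable) (integrable_const _)
    (fun m => ?_) (ae_of_all _ fun σ => isCont_simplexCurrent σ f p π ⟨L, hL⟩ hp)
  filter_upwards [hB] with σ hσ
  refine (hσ f (p m)).trans (mul_le_mul (mul_le_mul_of_nonneg_left ?_ B.coe_nonneg)
    (setIntegral_abs_pull_le σ f hC) (integral_nonneg fun _ => abs_nonneg _) (by positivity))
  refine (Finset.prod_le_prod (fun _ _ => NNReal.coe_nonneg _) fun i _ =>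
    NNReal.coe_le_coe.2 (lipConst_le (hL m i))).trans_eq (by simp)

end MeasureCurrent

/-! ### Finite mass and compact support of `T^μ` -/

section Mass

variable {X : Type u} [MetricSpace X] {k : ℕ}

/-- Lebesgue measure on `corner k`. -/
noncomputable def cornerMeasure (k : ℕ) : Measure (corner k) := volume.comap Subtype.val

instance (k : ℕ) : IsFiniteMeasure (cornerMeasure k) where
  measure_univ_lt_top := by
    rw [cornerMeasure, comap_subtype_coe_apply (measurableSet_corner k), Set.image_univ,
      Subtype.range_coe]
    exact (isCompact_corner k).measure_lt_top

/-- Evaluation of simplices in affine coordinates. -/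
noncomputable def chartEval (p : LipB (Simplex k) X × corner k) : X := p.1 (chart k p.2)

theorem continuous_chartEval :
    Continuous (chartEval : LipB (Simplex k) X × corner k → X) :=
  LipB.continuous_eval.comp (continuous_fst.prodMk
    ((continuousOn_iff_continuous_domRestrict.1 (lipschitzOnWith_chart k).continuousOn).comp
      continuous_snd))

theorem integrable_setIntegral_abs_pull (μ : LipChain X k) (f : blipFun X) :
    Integrable (fun σ => ∫ s in corner k, |pull σ f.1 s|) (VectorMeasure.variation μ.1) := by
  have hf : Continuous fun x => |f.1 x| := f.2.1.lipschitzWith.continuous.abs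
  obtain ⟨C, hC⟩ := f.2.2
  have h1 : Integrable (fun p : LipB (Simplex k) X × corner k => |f.1 (chartEval p)|)
      ((VectorMeasure.variation μ.1).prod (cornerMeasure k)) := by
    refine Integrable.of_bound (hf.comp continuous_chartEval).aestronglyMeasurable C
      (ae_of_all _ fun p => ?_)
    rw [Real.norm_eq_abs, abs_abs]
    exact hC _
  refine h1.integral_prod_left.congr (ae_of_all _ fun σ => ?_)
  exact integral_subtype_comap (measurableSet_corner k) fun s => |pull σ f.1 s|

variable [MeasurableSpace X] [BorelSpace X]

/-- The image of `|μ| × ℒᵏ` under evaluation; it controls the mass of the current of `μ`. -/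
noncomputable def evalMeasure (μ : LipChain X k) : Measure X :=
  ((VectorMeasure.variation μ.1).prod (cornerMeasure k)).map chartEval

instance (μ : LipChain X k) : IsFiniteMeasure (evalMeasure μ) :=
  Measure.isFiniteMeasure_map _ _

/-- Evaluation is jointly continuous, so the points swept out by a compact set of simplices form a
compact set. Both tightness and compactness of the support come from here. -/
theorem exists_isCompact_evalMeasure_compl (μ : LipChain X k) :
    ∃ K, IsCompact K ∧ evalMeasure μ Kᶜ = 0 := by
  obtain ⟨K, hK, hμK⟩ := exists_isCompact_variation_compl μ
  have := isCompact_iff_compactSpace.1 (isCompact_corner k)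
  have hK' : IsCompact (chartEval '' (K ×ˢ (Set.univ : Set (corner k)))) :=
    (hK.prod isCompact_univ).image continuous_chartEval
  refine ⟨_, hK', ?_⟩
  rw [evalMeasure, Measure.map_apply continuous_chartEval.measurable hK'.measurableSet.compl]
  refine measure_mono_null (t := Kᶜ ×ˢ Set.univ) (fun p hp => ⟨fun h => hp ⟨p, ⟨h, trivial⟩, rfl⟩,
    trivial⟩) ?_
  rw [Measure.prod_prod, hμK, zero_mul]

theorem integral_evalMeasure (μ : LipChain X k) (f : blipFun X) :
    ∫ x, |f.1 x| ∂(evalMeasure μ) =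
      ∫ σ, (∫ s in corner k, |pull σ f.1 s|) ∂(VectorMeasure.variation μ.1) := by
  have hf : Continuous fun x => |f.1 x| := f.2.1.lipschitzWith.continuous.abs
  obtain ⟨C, hC⟩ := f.2.2
  rw [evalMeasure, integral_map continuous_chartEval.aemeasurable hf.aestronglyMeasurable,
    integral_prod]
  · congr 1
    funext σ
    exact integral_subtype_comap (measurableSet_corner k) fun s => |pull σ f.1 s|
  · refine Integrable.of_bound (hf.comp continuous_chartEval).aestronglyMeasurable C
      (ae_of_all _ fun p => ?_)
    rw [Real.norm_eq_abs, abs_abs]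
    exact hC _

/-- Integrate the mass bounds of the single simplices against `|μ|`; `integral_evalMeasure` rewrites
the iterated integral over `X`. -/
theorem exists_isMassMeasure_measureCurrent (μ : LipChain X k) :
    ∃ B : ℝ≥0, IsMassMeasure (measureCurrent μ) (B • evalMeasure μ) := by
  obtain ⟨B, hB⟩ := exists_ae_simplexCurrent_le μ
  obtain ⟨K, hK, hμK⟩ := exists_isCompact_evalMeasure_compl μ
  refine ⟨B, inferInstance, isTight_smul B ?_, fun f π => ?_⟩
  · rw [isTightMeasureSet_iff_exists_isCompact_measure_compl_le]
    exact fun ε _ => ⟨K, hK, fun ν hν => by simp [Set.mem_singleton_iff.1 hν, hμK]⟩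
  · rw [integral_smul_nnreal_measure, integral_evalMeasure, NNReal.smul_def, smul_eq_mul]
    refine (abs_integral_le_integral_variation μ.1 _).trans ?_
    rw [mul_left_comm, ← mul_assoc, ← integral_const_mul]
    exact integral_mono_ae (integrable_simplexCurrent μ f π).abs
      ((integrable_setIntegral_abs_pull μ f).const_mul _) (hB.mono fun σ hσ => hσ f π)

theorem isCurrent_measureCurrent (μ : LipChain X k) : IsCurrent (measureCurrent μ) :=
  ⟨isMultilin_measureCurrent μ, isLocal_measureCurrent μ, isCont_measureCurrent μ,
    let ⟨_, hB⟩ := exists_isMassMeasure_measureCurrent μ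
    ⟨_, hB⟩⟩

theorem isCompact_currentSupport_measureCurrent (μ : LipChain X k) :
    IsCompact (currentSupport (measureCurrent μ)) := by
  obtain ⟨B, hB⟩ := exists_isMassMeasure_measureCurrent μ
  obtain ⟨K, hK, hμK⟩ := exists_isCompact_evalMeasure_compl μ
  refine hK.of_isClosed_subset (isClosed_currentSupport _) fun x hx => ?_
  contrapose! hx
  refine notMem_currentSupport.2 ⟨_, hB, Measure.notMem_support_iff_exists.2
    ⟨Kᶜ, hK.isClosed.isOpen_compl.mem_nhds hx, ?_⟩⟩
  simp [hμK]

end Mass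

/-! ### Linearity in `μ`, compatibility with boundaries, and the chain map -/

section ChainMap

variable {X : Type u} [MetricSpace X] {k : ℕ}

theorem measureCurrent_add (μ ν : LipChain X k) :
    measureCurrent (μ + ν) = measureCurrent μ + measureCurrent ν := by
  funext f π
  exact VectorMeasure.integral_add_vectorMeasure (integrable_simplexCurrent μ f π)
    (integrable_simplexCurrent ν f π)

theorem measureCurrent_smul (c : ℝ) (μ : LipChain X k) :
    measureCurrent (c • μ) = c • measureCurrent μ := by
  funext f π
  exact VectorMeasure.integral_smul_vectorMeasure _ c

/-- `μ ↦ T^μ` as a linear map. -/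
noncomputable def measureCurrentLinear (X : Type u) [MetricSpace X] (k : ℕ) :
    LipChain X k →ₗ[ℝ] Functional X k where
  toFun := measureCurrent
  map_add' := measureCurrent_add
  map_smul' := measureCurrent_smul

theorem measureCurrent_facePush (j : Fin (k + 2)) (μ : LipChain X (k + 1)) (f : blipFun X)
    (π : Fin k → lipFun X) :
    measureCurrent (facePush j μ) f π = ∫ᵛ σ, simplexCurrent (faceRestrict j σ) f π ∂•μ.1 := by
  have hcont := continuous_simplexCurrent (k := k) f π
  exact VectorMeasure.integral_map (continuous_faceRestrict (X := X) j).measurable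
    hcont.aestronglyMeasurable
    (integrable_of_continuous μ (hcont.comp (continuous_faceRestrict j)))

/-- Stokes' theorem under the integral sign, followed by the change of variables
`measureCurrent_facePush` on each face. -/
theorem boundary_measureCurrent (μ : LipChain X (k + 1)) :
    boundary (measureCurrent μ) = measureCurrent (chainBoundary k μ) := by
  have h1 : measureCurrent (chainBoundary k μ) =
      ∑ j : Fin (k + 2), (-1 : ℝ) ^ (j : ℕ) • measureCurrent (facePush j μ) := by
    change measureCurrentLinear X k _ = _
    simp only [chainBoundary, LinearMap.sum_apply, LinearMap.smul_apply, map_sum, map_smul]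
    rfl
  rw [h1]
  funext f π
  have h2 : boundary (measureCurrent μ) f π =
      ∫ᵛ σ, ∑ j : Fin (k + 2), (-1 : ℝ) ^ (j : ℕ) • simplexCurrent (faceRestrict j σ) f π ∂•μ.1 := by
    -- Taking the boundary only substitutes special arguments, so it commutes with the integral by
    -- definition.
    change ∫ᵛ σ, boundary (simplexCurrent σ) f π ∂•μ.1 = _
    simp only [boundary_simplexCurrent, smul_eq_mul]
  have hint : ∀ j : Fin (k + 2), μ.1.Integrable fun σ =>
      (-1 : ℝ) ^ (j : ℕ) • simplexCurrent (faceRestrict j σ) f π := fun j =>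
    by
    have hc : Continuous fun σ : LipB (Simplex (k + 1)) X =>
        simplexCurrent (faceRestrict j σ) f π :=
      (continuous_simplexCurrent f π).comp (continuous_faceRestrict j)
    exact integrable_of_continuous μ (hc.const_smul ((-1 : ℝ) ^ (j : ℕ)))
  rw [h2, VectorMeasure.integral_finsetSum Finset.univ fun j _ => hint j,
    Finset.sum_apply, Finset.sum_apply]
  refine Finset.sum_congr rfl fun j _ => ?_
  rw [VectorMeasure.integral_fun_smul, ← measureCurrent_facePush]
  rfl

variable [MeasurableSpace X] [BorelSpace X]

/-- The boundary is itself the current of a chain, so its mass is finite by the result already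
obtained one dimension lower. -/
theorem isNormal_measureCurrent : {k : ℕ} → (μ : LipChain X k) → IsNormal (measureCurrent μ)
  | 0, μ => isCurrent_measureCurrent μ
  | _ + 1, μ => ⟨isCurrent_measureCurrent μ, by
      rw [boundary_measureCurrent]
      exact (isCurrent_measureCurrent _).mass⟩

/-- `μ ↦ T^μ` as a linear map to the normal currents with compact support. -/
noncomputable def measureCurrentNormal (X : Type u) [MetricSpace X] [MeasurableSpace X]
    [BorelSpace X] (k : ℕ) : LipChain X k →ₗ[ℝ] NormalCurrent X k :=
  (measureCurrentLinear X k).codRestrict (NormalCurrent X k) fun μ =>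
    ⟨isNormal_measureCurrent μ, isCompact_currentSupport_measureCurrent μ⟩

open CategoryTheory in
/-- `μ ↦ T^μ` as a chain map. -/
noncomputable def measureCurrentChainMap (X : Type u) [MetricSpace X] [MeasurableSpace X]
    [BorelSpace X] : lipMeasureComplex X ⟶ normalCurrentComplex X :=
  ChainComplex.ofHom (fun k => ModuleCat.ofHom (measureCurrentNormal X k)) fun k => by
    have h1 : (lipMeasureComplex X).d (k + 1) k = ModuleCat.ofHom (chainBoundary k) :=
      ChainComplex.of_d (fun k => ModuleCat.of ℝ (LipChain X k))
        (fun k => ModuleCat.ofHom (chainBoundary k)) k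
    have h2 : (normalCurrentComplex X).d (k + 1) k = ModuleCat.ofHom (currentBoundary k) :=
      ChainComplex.of_d (fun k => ModuleCat.of ℝ (NormalCurrent X k))
        (fun k => ModuleCat.ofHom (currentBoundary k)) k
    rw [h1, h2]
    ext μ : 2
    exact Subtype.ext (boundary_measureCurrent μ)

end ChainMap

end LipCurrent

open LipCurrent
theorem theorem3p13 {X : Type*} [MetricSpace X] [MeasurableSpace X] [BorelSpace X] :
    (∀ (k : ℕ) (μ : LipChain X k),
      (∀ (f : blipFun X) (π : Fin k → lipFun X),
        μ.1.Integrable fun σ => simplexCurrent σ f π) ∧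
      IsNormal (measureCurrent μ) ∧ IsCompact (currentSupport (measureCurrent μ))) ∧
    ∃ Φ : lipMeasureComplex X ⟶ normalCurrentComplex X,
      ∀ (k : ℕ) (μ : LipChain X k),
        ((Φ.f k).hom μ : NormalCurrent X k).1 = measureCurrent μ :=
  ⟨fun _ μ => ⟨integrable_simplexCurrent μ, isNormal_measureCurrent μ,
    isCompact_currentSupport_measureCurrent μ⟩, measureCurrentChainMap X, fun _ _ => rfl⟩
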